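/- **Filler Lemma.** *Setting.* Write $\varepsilon_n=2^{-n}$. Let $\mathcal A$ and $\mathcal C$ be stationary Markov systems of memory $1$ on two-sided sequences over the finite alphabets $\Sigma_A,\Sigma_C\ni 0$, all of whose one-step conditional probabilities lie strictly between $0$ and $1$ (so they are mixing), with $P_A(0)=P_C(0)$, $P_A(00)=P_C(00)$ and equal entropy $H$ (base $2$; $H=\sum_{a,b}P_A(ab)\log_2\frac{P_A(a)}{P_A(ab)}$). For $D\in\{A,C\}$ let a Turing machine be given which for a word $w$ and $n\in\mathbb N$ outputs a rational $P_D(w,n)$ with $|P_D(w,n)-P_D(w)|\le\varepsilon_nP_D(w)$. The approximation $P_A(Z,n)$ for a cylinder $Z$ that fixes only some of the positions of an interval is the sum of $P_A(w,n)$ over the words $w$ on the interval that extend it. Let $\eta_n$ and $\theta_n$ be the minimum and the maximum, over $D\in\{A,C\}$ and $a,b\in\Sigma_D$, of the approximate conditional probabilities $P_D(ab,n+2)/P_D(a,n+2)$ (which have relative error at most $\varepsilon_n$). *Schnorr layerings.* A Schnorr layering of $\mathcal A$ is a sequence of sets $K_p$ whose complements are effectively open uniformly in $p$, with $P_A(K_p^c)<2^{-p}$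 computable uniformly in $p$. *Skeletons.* Let $N_0<N_1<\cdots$ be positive integers and $r\ge1$. A skeleton of rank $r$ of a sequence $x$ at the position $i$ is obtained from an interval containing $i$ which begins and ends with maximal blocks of at least $N_r$ zeros of $x$, has at least one nonzero symbol, and has no other block of $N_r$ or more zeros, by replacing the nonzero symbols and the isolated zeros of $x$ by blanks. (It is unique unless $x_i$ itself lies in a block of at least $N_r$ zeros; then there are two, one on each side.) For a skeleton $S$ let $\ell$ be its length (the number of blanks), $Z_S$ its set of zeros, and $L=\ell+|Z_S|$. A skeleton $S$ of rank $r\ge2$ decomposes into skeletons $S_1,\dots,S_t$ of rank $r-1$, neighbouring ones sharing their delimiting block of zeros. $\mathcal F(S)$ is the set of fillers: assignments of symbols of $\Sigma_A$ to the blanks such that the filled word has skeleton $S$. For a set $I$ of positions, $\langle I,F,S\rangle$ is the cylinder fixing the zeros of $S$ and the symbols of $F$ at the positions in $I$. *Determined positions.* For $F\in\mathcal F(S)$ and $n$, the set $J(F,n)$ is defined by recursion on the rank. In rank $1$, $J(F,n)=Z_S\cup B$, where $B$ is the longest initial segment of the blanks with $P_A(\langle B,F,S\rangle,n)\ge\frac{1+\varepsilon_1}{\eta_1}2^{-L(H-\varepsilon_1)}$.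 In rank $r\ge2$, let $J_0=\bigcup_{i=1}^tJ(F_i,\lceil n\log_2(3t)\rceil)$, with $F_i$ the part of $F$ in $S_i$; then $J(F,n)=Z_S\cup J_0\cup T$, where $T$ is the longest initial segment of the blanks outside $J_0$ with $P_A(\langle J_0\cup T,F,S\rangle,n)>\frac{1+\varepsilon_r}{\eta_r}2^{-L(H-\varepsilon_r)}$. (If there is no such segment, $B$ resp. $T$ is empty.) Fillers $F,F'$ are equivalent, $F\sim_nF'$, if $J(F,n)=J(F',n)$ and they agree on this set; $P_A(\tilde F_n,n):=P_A(\langle J(F,n),F,S\rangle,n)$ is the approximate probability of the class of $F$. *Statement.* Let $(L_r)$ be a computable strictly increasing sequence of natural numbers with $\lim_{r\to\infty}\frac1{\eta_r}2^{-L_r(\varepsilon_{r-1}-\varepsilon_r)}=0$. Then there is a computable strictly increasing sequence of positive integers $(N_r)$ such that (i) there is a Schnorr layering $(K'_r)$ of $\mathcal A$ such that for all $r\ge1$, every $x\in K'_r$ has a skeleton of rank $r$ at position $0$, and every such skeleton has length at least $L_r$; and (ii) there is a Schnorr layering $(K''_p)$ of $\mathcal A$ such that for every $n$ there is an $r\ge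 n$, $r\ge1$, such that for every $x\in K''_r$ and every skeleton $S$ of rank $r$ of $x$ at position $0$, the following hold. 1. For all $F\in\mathcal F(S)$: $P_A(\tilde F_r,r)\ge(1+\varepsilon_r)2^{-L(H-\varepsilon_r)}$. 2. For all $F\in\mathcal F(S)$ outside an exceptional set $E\subseteq\mathcal F(S)$ of measure at most $\varepsilon_n$ (that is, the words obtained by filling $S$ with the members of $E$ have total probability at most $\varepsilon_n$ times that for all of $\mathcal F(S)$): (a) $P_A(\tilde F_r,r)<\frac{1+\varepsilon_n}{\eta_n}2^{-L(H-\varepsilon_n)}$, and (b) $\frac1L|J(F,r)|>1-\frac{2}{|\log_2\theta_r|}\varepsilon_n$. -/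

import Mathlib

open MeasureTheory Filter Topology

noncomputable section

/-! ### Error bounds and computability -/

/-- The error bound `ε_n = 2⁻ⁿ`. -/
def eps (n : ℕ) : ℝ := 1 / 2 ^ n

/-- A rational-valued function is computable: numerator and denominator are produced by a
Turing machine (computable functions in the sense of Mathlib). -/
def ComputableRat {α : Type*} [Primcodable α] (f : α → ℚ) : Prop :=
  ∃ (u : α → ℤ) (v : α → ℕ), Computable u ∧ Computable v ∧
    ∀ a, f a = (u a : ℚ) / ((v a : ℚ) + 1)

/-- The cylinder of all two-sided sequences carrying the word `w` at the positions
`i, i + 1, …`. -/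
def cylinderAt {σ : Type*} (i : ℤ) (w : List σ) : Set (ℤ → σ) :=
  {x | ∀ j : Fin w.length, x (i + (j : ℕ)) = w.get j}

/-! ### Stationary mixing Markov systems -/

/-- The product of the transition probabilities `p` along the word `a w`. -/
def transProd {σ : Type*} (p : σ → σ → ℝ) : σ → List σ → ℝ
  | _, [] => 1
  | a, b :: w => p a b * transProd p b w

/-- A stationary mixing Markov system of memory `1` on two-sided sequences over the alphabet
`{0, …, k}`, all of whose conditional probabilities lie strictly between `0` and `1`:
its stationary vector, its transition matrix and its (shift invariant) law. -/
structure MarkovSystem (k : ℕ) where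
  /-- The stationary probability of a symbol. -/
  init : Fin (k + 1) → ℝ
  /-- `trans a b` is the conditional probability of the symbol `b` after the symbol `a`. -/
  trans : Fin (k + 1) → Fin (k + 1) → ℝ
  init_nonneg : ∀ a, 0 ≤ init a
  init_sum : ∑ a, init a = 1
  trans_pos : ∀ a b, 0 < trans a b
  trans_lt_one : ∀ a b, trans a b < 1
  trans_sum : ∀ a, ∑ b, trans a b = 1
  stationary : ∀ b, ∑ a, init a * trans a b = init b
  /-- The law of the system. -/
  measure : Measure (ℤ → Fin (k + 1))
  measure_cylinder : ∀ (i : ℤ) (a : Fin (k + 1)) (w : List (Fin (k + 1))),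
    measure (cylinderAt i (a :: w)) = ENNReal.ofReal (init a * transProd trans a w)

namespace MarkovSystem

variable {k : ℕ}

/-- The probability of (the cylinder of) a word. -/
def wordProb (A : MarkovSystem k) : List (Fin (k + 1)) → ℝ
  | [] => 1
  | a :: w => A.init a * transProd A.trans a w

/-- The entropy of the Markov system, in bits. -/
def entropy (A : MarkovSystem k) : ℝ :=
  ∑ a, ∑ b, A.init a * A.trans a b * Real.logb 2 (1 / A.trans a b)

/-- `M` is (the input-output function of) a Turing machine which on a word `w` and a number `n`
returns a rational within `ε_n P(w)` of the probability `P(w)`. -/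
def IsMachine (A : MarkovSystem k) (M : List (Fin (k + 1)) → ℕ → ℚ) : Prop :=
  ComputableRat (fun q : List (Fin (k + 1)) × ℕ => M q.1 q.2) ∧
    ∀ w n, |(M w n : ℝ) - A.wordProb w| ≤ eps n * A.wordProb w

end MarkovSystem

/-- The approximation at level `n` of the conditional probability of the symbol `b` after the
symbol `a`. The word probabilities are queried at level `n + 2`, which makes the relative error
of the quotient at most `ε_n`. -/
def condApprox {k : ℕ} (M : List (Fin (k + 1)) → ℕ → ℚ) (n : ℕ) (a b : Fin (k + 1)) : ℝ :=
  (M [a, b] (n + 2) : ℝ) / (M [a] (n + 2) : ℝ)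

/-- The smallest level-`n` conditional probability over both systems, `η_n`. -/
def etaMin {a c : ℕ} (MA : List (Fin (a + 1)) → ℕ → ℚ) (MC : List (Fin (c + 1)) → ℕ → ℚ)
    (n : ℕ) : ℝ :=
  min (⨅ p : Fin (a + 1) × Fin (a + 1), condApprox MA n p.1 p.2)
    (⨅ p : Fin (c + 1) × Fin (c + 1), condApprox MC n p.1 p.2)

/-- The largest level-`n` conditional probability over both systems, `θ_n`. -/
def thetaMax {a c : ℕ} (MA : List (Fin (a + 1)) → ℕ → ℚ) (MC : List (Fin (c + 1)) → ℕ → ℚ)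
    (n : ℕ) : ℝ :=
  max (⨆ p : Fin (a + 1) × Fin (a + 1), condApprox MA n p.1 p.2)
    (⨆ p : Fin (c + 1) × Fin (c + 1), condApprox MC n p.1 p.2)

/-! ### Schnorr layerings -/

/-- The sets `U p` are effectively open, uniformly in `p`: they are the unions of a computably
enumerable family of cylinders. -/
def UniformlyEffectivelyOpen {k : ℕ} (U : ℕ → Set (ℤ → Fin (k + 1))) : Prop :=
  ∃ E : ℕ × ℤ × List (Fin (k + 1)) → Prop, REPred E ∧
    ∀ p, U p = {x | ∃ (i : ℤ) (w : List (Fin (k + 1))), E (p, i, w) ∧ x ∈ cylinderAt i w}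

/-- The reals `s p` are computable, uniformly in `p`. -/
def UniformlyComputableReal (s : ℕ → ℝ) : Prop :=
  ∃ q : ℕ × ℕ → ℚ, ComputableRat q ∧ ∀ p n, |(q (p, n) : ℝ) - s p| ≤ eps n

/-- A Schnorr test: uniformly effectively open sets `U p` of measure below `2⁻ᵖ`, with measures
computable uniformly in `p`. -/
def IsSchnorrTest {k : ℕ} (P : Measure (ℤ → Fin (k + 1))) (U : ℕ → Set (ℤ → Fin (k + 1))) :
    Prop :=
  UniformlyEffectivelyOpen U ∧ UniformlyComputableReal (fun p => P.real (U p)) ∧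
    ∀ p, P (U p) < ENNReal.ofReal (eps p)

/-- A Schnorr layering: the complements of the layers form a Schnorr test. -/
def IsSchnorrLayering {k : ℕ} (P : Measure (ℤ → Fin (k + 1)))
    (K : ℕ → Set (ℤ → Fin (k + 1))) : Prop :=
  IsSchnorrTest P (fun p => (K p)ᶜ)

/-! ### Skeletons -/

/-- A pattern of zeros and blanks on the interval of positions `[lo, hi]`: `zeros` is the set of
positions that carry a `0`, the other positions are blanks. -/
@[ext]
structure Skeleton where
  lo : ℤ
  hi : ℤ
  zeros : Finset ℤ

namespace Skeleton

/-- All positions. -/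
def window (S : Skeleton) : Finset ℤ := Finset.Icc S.lo S.hi

/-- The blank positions. -/
def blanks (S : Skeleton) : Finset ℤ := S.window \ S.zeros

/-- The length `ℓ` of a skeleton: its number of blanks. -/
def length (S : Skeleton) : ℕ := S.blanks.card

/-- The total size `L = ℓ + |Z_S|`. -/
def size (S : Skeleton) : ℕ := S.length + S.zeros.card

/-- The part of the pattern on the interval `[u, v]`. -/
def restrict (S : Skeleton) (u v : ℤ) : Skeleton := ⟨u, v, S.zeros ∩ Finset.Icc u v⟩

/-- `S` has the form of a skeleton with threshold `m`: a block of at least `m` zeros, then a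
non-empty middle part `[c, d]` which begins and ends with a blank and contains no `m`
consecutive zeros, then a block of at least `m` zeros. -/
def HasForm (m : ℕ) (S : Skeleton) : Prop :=
  S.zeros ⊆ S.window ∧ ∃ c d : ℤ, c ≤ d ∧ S.lo + m ≤ c ∧ d + m ≤ S.hi ∧
    Finset.Ico S.lo c ⊆ S.zeros ∧ c ∉ S.zeros ∧
    Finset.Ioc d S.hi ⊆ S.zeros ∧ d ∉ S.zeros ∧
    ∀ i : ℤ, c ≤ i → i + m ≤ d + 1 → ¬ Finset.Ico i (i + m) ⊆ S.zeros

open Classical in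
/-- The intervals occupied by the members of the decomposition of `S` into skeletons of
threshold `m`. Each member contains the two maximal blocks of zeros that delimit it, so that
neighbouring members share a block. -/
def parts (m : ℕ) (S : Skeleton) : Finset (ℤ × ℤ) :=
  (S.window ×ˢ S.window).filter fun p =>
    (S.restrict p.1 p.2).HasForm m ∧ p.1 - 1 ∉ S.zeros ∧ p.2 + 1 ∉ S.zeros

end Skeleton

open Classical in
/-- The positions in `[lo, hi]` at which `x` carries a `0` that is not isolated. -/
def blockZeros {k : ℕ} (x : ℤ → Fin (k + 1)) (lo hi : ℤ) : Finset ℤ :=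
  (Finset.Icc lo hi).filter fun i => x i = 0 ∧ (x (i - 1) = 0 ∨ x (i + 1) = 0)

/-- `S` is a skeleton of threshold `m` in `x` around the position `i`: it is the pattern of `x`
(nonzero symbols and isolated zeros being blanked) on an interval around `i` which is delimited
on both sides by maximal blocks of at least `m` zeros of `x` and has no such block in between. -/
def IsSkeletonAt {k : ℕ} (m : ℕ) (x : ℤ → Fin (k + 1)) (i : ℤ) (S : Skeleton) : Prop :=
  S.lo ≤ i ∧ i ≤ S.hi ∧ S.zeros = blockZeros x S.lo S.hi ∧ S.HasForm m ∧
    x (S.lo - 1) ≠ 0 ∧ x (S.hi + 1) ≠ 0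

/-! ### Fillers -/

open Classical in
/-- Filling the blanks of `S` by `F`. (Outside the window of `S` the value is irrelevant.) -/
def fill {k : ℕ} (S : Skeleton) (F : S.blanks → Fin (k + 1)) : ℤ → Fin (k + 1) :=
  fun i => if h : i ∈ S.blanks then F ⟨i, h⟩ else 0

open Classical in
/-- The set of fillers of `S`: the assignments of symbols to the blanks for which the filled
word has the skeleton `S`, that is, every `0` among them stays isolated. -/
def fillers (k : ℕ) (S : Skeleton) : Finset (S.blanks → Fin (k + 1)) :=
  Finset.univ.filter fun F => ∀ i ∈ S.blanks, fill S F i = 0 →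
    fill S F (i - 1) ≠ 0 ∧ fill S F (i + 1) ≠ 0

/-- The word carried by `y` on the window of `S`. -/
def wordOn {k : ℕ} (S : Skeleton) (y : ℤ → Fin (k + 1)) : List (Fin (k + 1)) :=
  List.ofFn fun j : Fin (S.hi + 1 - S.lo).toNat => y (S.lo + (j : ℕ))

open Classical in
/-- The level-`n` approximation of the probability of the cylinder of all sequences which agree
with `y` on the set `D` of positions in the window of `S`: the approximate probabilities of the
words on the window which extend it are added up. -/
def cylApprox {k : ℕ} (M : List (Fin (k + 1)) → ℕ → ℚ) (S : Skeleton) (D : Finset ℤ)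
    (y : ℤ → Fin (k + 1)) (n : ℕ) : ℝ :=
  ∑ w ∈ (Finset.univ : Finset (Fin (S.hi + 1 - S.lo).toNat → Fin (k + 1))).filter
      (fun w => ∀ j : Fin (S.hi + 1 - S.lo).toNat,
        S.lo + (j : ℕ) ∈ D → w j = y (S.lo + (j : ℕ))),
    (M (List.ofFn w) n : ℝ)

/-- The first `j` elements of a finite set of positions. -/
def firstElems (T : Finset ℤ) (j : ℕ) : Finset ℤ :=
  T.filter fun i => (T.filter (· < i)).card < j

/-- The threshold `((1 + ε_r) / η_r) 2^(-L (H - ε_r))`. -/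
def fillBound (H : ℝ) (η : ℕ → ℝ) (r L : ℕ) : ℝ :=
  (1 + eps r) / η r * (2 : ℝ) ^ (-(L : ℝ) * (H - eps r))

open Classical in
/-- The set `J(F, n)` of determined positions for a skeleton `S` of rank `r`, where `y` is `S`
filled by `F`. In rank `1`, an initial segment of the blanks is added to the zeros of `S`, the
longest one for which the approximate probability of the resulting cylinder is at least the
threshold of rank `1`. In rank `r ≥ 2`, let `J₀` be the union of the sets determined for the `t`
members of the rank `r - 1` decomposition of `S`, at level `⌈n log₂ (3 t)⌉`; then an initial
segment of the remaining positions is added to it, the longest one for which the approximate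
probability exceeds the threshold of rank `r`. (The segment is empty if there is no such
segment. Ranks start at `1`; rank `0` is a dummy.) -/
def determined {k : ℕ} (N : ℕ → ℕ) (M : List (Fin (k + 1)) → ℕ → ℚ) (H : ℝ) (η : ℕ → ℝ) :
    ℕ → Skeleton → (ℤ → Fin (k + 1)) → ℕ → Finset ℤ
  | 0, S, _, _ => S.zeros
  | 1, S, y, n =>
      S.zeros ∪ firstElems S.blanks (Nat.findGreatest
        (fun j => fillBound H η 1 S.size ≤
          cylApprox M S (S.zeros ∪ firstElems S.blanks j) y n) S.length)
  | r + 2, S, y, n =>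
      let Q := S.parts (N (r + 1))
      let J₀ := Q.biUnion fun p =>
        determined N M H η (r + 1) (S.restrict p.1 p.2) y (Nat.clog 2 ((3 * Q.card) ^ n))
      let T := S.blanks \ J₀
      S.zeros ∪ J₀ ∪ firstElems T (Nat.findGreatest
        (fun j => fillBound H η (r + 2) S.size <
          cylApprox M S (S.zeros ∪ J₀ ∪ firstElems T j) y n) T.card)

/-- The equivalence of fillers at level `n`: equal sets of determined positions, and agreement
on them. -/
def FillerEquiv {k : ℕ} (N : ℕ → ℕ) (M : List (Fin (k + 1)) → ℕ → ℚ) (H : ℝ) (η : ℕ → ℝ)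
    (r : ℕ) (S : Skeleton) (n : ℕ) (F G : S.blanks → Fin (k + 1)) : Prop :=
  determined N M H η r S (fill S F) n = determined N M H η r S (fill S G) n ∧
    ∀ i ∈ determined N M H η r S (fill S F) n, fill S F i = fill S G i

/-- The level-`n` probability of the equivalence class of a filler: the approximate probability
of the cylinder that is fixed by the symbols at the determined positions. -/
def classProb {k : ℕ} (N : ℕ → ℕ) (M : List (Fin (k + 1)) → ℕ → ℚ) (H : ℝ) (η : ℕ → ℝ)
    (r : ℕ) (S : Skeleton) (F : S.blanks → Fin (k + 1)) (n : ℕ) : ℝ :=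
  cylApprox M S (determined N M H η r S (fill S F) n) (fill S F) n

/-- The class probability depends on the equivalence class only. -/
theorem classProb_congr {k : ℕ} {N : ℕ → ℕ} {M : List (Fin (k + 1)) → ℕ → ℚ} {H : ℝ}
    {η : ℕ → ℝ} {r : ℕ} {S : Skeleton} {n : ℕ} {F G : S.blanks → Fin (k + 1)}
    (h : FillerEquiv N M H η r S n F G) :
    classProb N M H η r S F n = classProb N M H η r S G n := by
  obtain ⟨h1, h2⟩ := h
  unfold classProb cylApprox
  rw [← h1]
  refine Finset.sum_congr (Finset.filter_congr fun w _ => ?_) fun _ _ => rfl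
  refine forall_congr' fun j => ?_
  constructor
  · intro h hj
    rw [h hj, h2 _ hj]
  · intro h hj
    rw [h hj, h2 _ hj]

/-- The (exact) measure of a set of fillers of `S`: the total probability of the filled
words. -/
def fillerMeasure {k : ℕ} (A : MarkovSystem k) (S : Skeleton)
    (E : Finset (S.blanks → Fin (k + 1))) : ℝ :=
  ∑ F ∈ E, A.wordProb (wordOn S (fill S F))

end

/-! Three facts about a Markov system with positive transition probabilities carry the proof. Fixing
one more symbol multiplies the probability of a cylinder by a factor bounded away from `0` and from
`1` (`pr_insert_ge`, `pr_insert_le`). Cylinders over disjoint intervals are independent up to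
constant factors (`quasi_independent`, `pr_ge_prod`). A word in which all pairs occur with about the
right frequency has probability about `2 ^ (-L H)` (`logb_pr_typical`).

Claim 1 is a lower bound for the probability of the determined set `J`, proved by induction on the
rank (`le_logb_determined`). If the last segment added to `J` is non-empty, the threshold in its
definition is already the bound. If it is empty in rank `1`, only the zeros are fixed. A typical
filler then leaves a positive fraction of the positions free, so the probability exceeds `2 ^ (-L
H)` exponentially. If it is empty in higher rank, `J` comes from the parts of the skeleton, whose
bounds are multiplied (`le_logb_pr_of_parts`). The loss is proportional to the number of positions
outside the cores of good parts, a fraction `2 ^ (-(r + c₀))` of the whole. This fits into the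
decrease of the exponents `rate`, which is of order `ε_r`; from some rank on, `rate r` equals `ε_r`.

Claim 2 rests on `determined_dichotomy`. Either every position is determined, and typicality gives
the upper bound, or one more position would fall to the threshold, so that `J` has probability at
most a constant times `2 ^ (-L (H - ε_r))`. A typical filler as a whole has probability about `2 ^
(-L H)`, and each undetermined position accounts for at least a fixed number of bits, so few
positions are undetermined. With `r = n + c` and `c` a constant, `ε_r = ε_n ε_c` makes all errors
small compared with `ε_n`.

The sequences to which this applies are described by layers: a threshold `N`, a window radius and a
finite list of bad words. A word not in the list certifies that its centre lies in the core of a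
part that is long and typical, has few bad positions of the preceding layer, and whose zero pattern
has mostly typical fillers. A refining layer always exists (`exists_nextLayer`). A law of large
numbers for exponentially mixing events gives typical parts around the origin
(`exists_regularParts`), and Markov's inequality over the classes of words with equal zero pattern
bounds the atypical fillers (`measure_not_mostlyTypical_le`).

Whether one layer refines another is decidable from integer approximations of the probabilities, so
unbounded search produces a computable sequence of layers. Each layer is a clopen set with a finite
description, which makes the sequence a Schnorr layering; it serves for both (i) and (ii). -/

noncomputable section

/-! ### Words of a sequence and their probabilities -/

/-- The word of length `n` carried by `y` from the position `u` on. -/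
def wordFrom {σ : Type*} (y : ℤ → σ) (u : ℤ) (n : ℕ) : List σ :=
  List.ofFn fun j : Fin n => y (u + (j : ℕ))

@[simp] theorem length_wordFrom {σ : Type*} (y : ℤ → σ) (u : ℤ) (n : ℕ) :
    (wordFrom y u n).length = n := by simp [wordFrom]

theorem getElem_wordFrom {σ : Type*} (y : ℤ → σ) (u : ℤ) (n j : ℕ)
    (h : j < (wordFrom y u n).length) : (wordFrom y u n)[j] = y (u + j) := by
  simp [wordFrom]

theorem wordFrom_succ {σ : Type*} (y : ℤ → σ) (u : ℤ) (n : ℕ) :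
    wordFrom y u (n + 1) = y u :: wordFrom y (u + 1) n := by
  simp only [wordFrom, List.ofFn_succ, Fin.val_zero, Fin.val_succ]
  simp [add_comm, add_left_comm]

theorem mem_cylinderAt_wordFrom {σ : Type*} (x y : ℤ → σ) (u : ℤ) (n : ℕ) :
    x ∈ cylinderAt u (wordFrom y u n) ↔ ∀ j < n, x (u + (j : ℕ)) = y (u + (j : ℕ)) := by
  constructor
  · intro h j hj
    have := h ⟨j, by simpa using hj⟩
    simpa [wordFrom] using this
  · intro h j
    have hj : (j : ℕ) < n := by simpa using j.2
    rw [h j hj, List.get_eq_getElem, getElem_wordFrom]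

/-- The sequences that agree with `y` on `D`. -/
def agreeOn {σ : Type*} (D : Finset ℤ) (y : ℤ → σ) : Set (ℤ → σ) := {x | ∀ i ∈ D, x i = y i}

theorem agreeOn_Icc {σ : Type*} (y : ℤ → σ) (u : ℤ) (n : ℕ) :
    agreeOn (Finset.Ico u (u + n)) y = cylinderAt u (wordFrom y u n) := by
  ext x
  rw [mem_cylinderAt_wordFrom]
  constructor
  · intro h j hj
    exact h _ (by simp; omega)
  · intro h i hi
    rw [Finset.mem_Ico] at hi
    have := h (i - u).toNat (by omega)
    rwa [show u + ((i - u).toNat : ℕ) = i by omega] at this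

theorem measurableSet_agreeOn {k : ℕ} (D : Finset ℤ) (y : ℤ → Fin (k + 1)) :
    MeasurableSet (agreeOn D y) := by
  have : agreeOn D y = ⋂ i ∈ D, (fun x : ℤ → Fin (k + 1) => x i) ⁻¹' {y i} := by
    ext x; simp [agreeOn]
  rw [this]
  exact Finset.measurableSet_biInter _ fun i _ => measurable_pi_apply i (measurableSet_singleton _)

theorem transProd_wordFrom {k : ℕ} (p : Fin (k + 1) → Fin (k + 1) → ℝ) (y : ℤ → Fin (k + 1))
    (n : ℕ) : ∀ u : ℤ, transProd p (y u) (wordFrom y (u + 1) n) =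
      ∏ i ∈ Finset.range n, p (y (u + (i : ℕ))) (y (u + (i : ℕ) + 1)) := by
  induction n with
  | zero => intro u; simp [wordFrom, transProd]
  | succ n ih =>
    intro u
    rw [wordFrom_succ, transProd, ih, Finset.prod_range_succ']
    rw [mul_comm]
    congr 1
    · refine Finset.prod_congr rfl fun i _ => ?_
      rw [show u + 1 + (i : ℤ) = u + ((i + 1 : ℕ) : ℤ) by push_cast; ring]
    · simp

/-! ### Cylinder probabilities, the Markov property and quasi-independence -/

namespace MarkovSystem

variable {k : ℕ} (A : MarkovSystem k)

theorem wordProb_wordFrom_succ (y : ℤ → Fin (k + 1)) (u : ℤ) (n : ℕ) :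
    A.wordProb (wordFrom y u (n + 1)) = A.init (y u) *
      ∏ i ∈ Finset.range n, A.trans (y (u + (i : ℕ))) (y (u + (i : ℕ) + 1)) := by
  rw [wordFrom_succ, wordProb, transProd_wordFrom]

theorem exists_bound : ∃ β : ℝ, 0 < β ∧ β < 1 ∧ (∀ a b, β ≤ A.trans a b) ∧
    ∀ a, β ≤ A.init a := by
  have hi : ∃ a, 0 < A.init a := by
    by_contra! h
    have := A.init_sum
    have h2 : ∑ a, A.init a ≤ 0 := Finset.sum_nonpos fun a _ => h a
    linarith
  obtain ⟨a₀, ha₀⟩ := hi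
  have hpos : ∀ b, 0 < A.init b := by
    intro b
    rw [← A.stationary b]
    refine Finset.sum_pos' (fun a _ => mul_nonneg (A.init_nonneg a) (A.trans_pos a b).le)
      ⟨a₀, Finset.mem_univ _, mul_pos ha₀ (A.trans_pos _ _)⟩
  obtain ⟨q, -, hq⟩ := Finset.exists_min_image (Finset.univ : Finset (Fin (k+1) × Fin (k+1)))
    (fun q => A.trans q.1 q.2) Finset.univ_nonempty
  obtain ⟨b, -, hb⟩ := Finset.exists_min_image (Finset.univ : Finset (Fin (k+1)))
    (fun q => A.init q) Finset.univ_nonempty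
  refine ⟨min (A.trans q.1 q.2) (A.init b), lt_min (A.trans_pos _ _) (hpos _),
    (min_le_left _ _).trans_lt (A.trans_lt_one _ _), fun a c => (min_le_left _ _).trans
      (hq (a, c) (Finset.mem_univ _)), fun a => (min_le_right _ _).trans (hb a (Finset.mem_univ _))⟩

/-- A positive lower bound for all transition and stationary probabilities. -/
def bd : ℝ := A.exists_bound.choose

theorem bd_pos : 0 < A.bd := A.exists_bound.choose_spec.1
theorem bd_lt_one : A.bd < 1 := A.exists_bound.choose_spec.2.1
theorem bd_le_trans (a b) : A.bd ≤ A.trans a b := A.exists_bound.choose_spec.2.2.1 a b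
theorem bd_le_init (a) : A.bd ≤ A.init a := A.exists_bound.choose_spec.2.2.2 a
theorem init_pos (a) : 0 < A.init a := A.bd_pos.trans_le (A.bd_le_init a)

theorem init_le_one (a) : A.init a ≤ 1 := by
  rw [← A.init_sum]
  exact Finset.single_le_sum (fun b _ => A.init_nonneg b) (Finset.mem_univ a)

theorem exists_ne (A : MarkovSystem k) (a : Fin (k + 1)) : ∃ b, b ≠ a := by
  by_contra! h
  have h1 := A.trans_sum a
  have : (Finset.univ : Finset (Fin (k+1))) = {a} := by
    ext b; simp [h b]
  rw [this, Finset.sum_singleton] at h1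
  exact absurd h1 (A.trans_lt_one a a).ne

theorem transProd_pos (w : List (Fin (k + 1))) : ∀ a, 0 < transProd A.trans a w := by
  induction w with
  | nil => intro a; simp [transProd]
  | cons b w ih => intro a; exact mul_pos (A.trans_pos a b) (ih b)

theorem wordProb_pos (w : List (Fin (k + 1))) : 0 < A.wordProb w := by
  cases w with
  | nil => simp [wordProb]
  | cons a w => exact mul_pos (A.init_pos a) (A.transProd_pos w a)

instance : IsProbabilityMeasure A.measure := by
  constructor
  have h : (Set.univ : Set (ℤ → Fin (k + 1))) = ⋃ a ∈ (Finset.univ : Finset (Fin (k + 1))),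
      cylinderAt 0 [a] := by
    ext x; simp [cylinderAt]
  rw [h, measure_biUnion_finset]
  · simp only [A.measure_cylinder, transProd, mul_one]
    rw [← ENNReal.ofReal_sum_of_nonneg (fun a _ => A.init_nonneg a), A.init_sum, ENNReal.ofReal_one]
  · intro a _ b _ hab
    rw [Function.onFun, Set.disjoint_left]
    intro x hx hy
    exact hab (by have h1 := hx 0; have h2 := hy 0; simp at h1 h2; rw [← h1, ← h2])
  · intro a _
    have := agreeOn_Icc (fun _ => a) 0 1
    rw [show wordFrom (fun _ : ℤ => a) 0 1 = [a] by simp [wordFrom]] at this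
    rw [← this]
    exact measurableSet_agreeOn _ _

theorem measureReal_cylinderAt (i : ℤ) (w : List (Fin (k + 1))) :
    A.measure.real (cylinderAt i w) = A.wordProb w := by
  cases w with
  | nil =>
    have : cylinderAt i ([] : List (Fin (k + 1))) = Set.univ := by
      ext x; simp [cylinderAt]
    simp [this, wordProb]
  | cons a w =>
    rw [measureReal_def, A.measure_cylinder, ENNReal.toReal_ofReal, wordProb]
    exact (A.wordProb_pos (a :: w)).le

theorem wordProb_le_one (w : List (Fin (k + 1))) : A.wordProb w ≤ 1 := by
  rw [← A.measureReal_cylinderAt 0 w]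
  exact measureReal_le_one

/-- The probability of the cylinder of all sequences that agree with `y` on `D`. -/
def pr (D : Finset ℤ) (y : ℤ → Fin (k + 1)) : ℝ := A.measure.real (agreeOn D y)

theorem pr_Ico (y : ℤ → Fin (k + 1)) (u : ℤ) (n : ℕ) :
    A.pr (Finset.Ico u (u + n)) y = A.wordProb (wordFrom y u n) := by
  rw [pr, agreeOn_Icc, measureReal_cylinderAt]

theorem pr_mono {D D' : Finset ℤ} (h : D ⊆ D') (y) : A.pr D' y ≤ A.pr D y :=
  measureReal_mono (fun _ hx i hi => hx i (h hi))

theorem exists_Ico (D : Finset ℤ) : ∃ (u : ℤ) (n : ℕ), D ⊆ Finset.Ico u (u + n) := by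
  refine ⟨-(∑ i ∈ D, |i|), (∑ i ∈ D, |i| + ∑ i ∈ D, |i| + 1).toNat, fun i hi => ?_⟩
  have h := Finset.single_le_sum (f := fun i : ℤ => |i|) (fun j _ => abs_nonneg j) hi
  have h1 := neg_abs_le i
  have h2 := le_abs_self i
  simp only [Finset.mem_Ico] at h ⊢
  omega

theorem pr_pos (D y) : 0 < A.pr D y := by
  obtain ⟨u, n, h⟩ := exists_Ico D
  refine lt_of_lt_of_le ?_ (A.pr_mono h y)
  rw [pr_Ico]
  exact A.wordProb_pos _

theorem pr_congr {D : Finset ℤ} {y z : ℤ → Fin (k + 1)} (h : ∀ i ∈ D, y i = z i) :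
    A.pr D y = A.pr D z := by
  unfold pr
  congr 1
  ext x
  exact forall₂_congr fun i hi => by rw [h i hi]

theorem pr_empty (y) : A.pr ∅ y = 1 := by
  simp [pr, agreeOn]

theorem pr_singleton (i : ℤ) (y) : A.pr {i} y = A.init (y i) := by
  have : ({i} : Finset ℤ) = Finset.Ico i (i + (1 : ℕ)) := by ext j; simp; omega
  rw [this, pr_Ico, wordProb_wordFrom_succ]; simp

theorem pr_pair (i : ℤ) (y) : A.pr {i, i + 1} y = A.init (y i) * A.trans (y i) (y (i + 1)) := by
  have : ({i, i + 1} : Finset ℤ) = Finset.Ico i (i + (2 : ℕ)) := by ext j; simp; omega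
  rw [this, pr_Ico, wordProb_wordFrom_succ]; simp

/-- Summing over the symbol at a free position. -/
theorem pr_eq_sum {D : Finset ℤ} {i : ℤ} (hi : i ∉ D) (y : ℤ → Fin (k + 1)) :
    A.pr D y = ∑ b, A.pr (insert i D) (Function.update y i b) := by
  have h : agreeOn D y = ⋃ b ∈ (Finset.univ : Finset (Fin (k + 1))),
      agreeOn (insert i D) (Function.update y i b) := by
    ext x
    simp only [agreeOn, Set.mem_ofPred_eq, Finset.mem_univ, Set.iUnion_true, Set.mem_iUnion,
      Finset.mem_insert, forall_eq_or_imp, Function.update_self, exists_eq_left']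
    refine forall₂_congr fun j hj => ?_
    rw [Function.update_of_ne (fun h : j = i => hi (h ▸ hj))]
  unfold pr
  rw [h, measureReal_biUnion_finset]
  · intro a _ b _ hab
    rw [Function.onFun, Set.disjoint_left]
    intro x hx hy
    have h1 := hx i (Finset.mem_insert_self _ _)
    have h2 := hy i (Finset.mem_insert_self _ _)
    simp at h1 h2
    exact hab (h1 ▸ h2)
  · intro b _
    exact measurableSet_agreeOn _ _

theorem pr_update_of_notMem {D : Finset ℤ} {i : ℤ} (hi : i ∉ D) (y : ℤ → Fin (k + 1)) (b) :
    A.pr D (Function.update y i b) = A.pr D y :=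
  A.pr_congr fun j hj => Function.update_of_ne (fun h : j = i => hi (h ▸ hj)) _ _

theorem pr_split_Icc (y : ℤ → Fin (k + 1)) (u m v : ℤ) (hu : u ≤ m) (hv : m ≤ v) :
    A.pr (Finset.Icc u m ∪ Finset.Icc m v) y * A.init (y m) =
      A.pr (Finset.Icc u m) y * A.pr (Finset.Icc m v) y := by
  obtain ⟨n, rfl⟩ : ∃ n : ℕ, m = u + n := ⟨(m - u).toNat, by omega⟩
  obtain ⟨l, rfl⟩ : ∃ l : ℕ, v = u + n + l := ⟨(v - (u + n)).toNat, by omega⟩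
  have e1 : Finset.Icc u (u + (n : ℤ)) ∪ Finset.Icc (u + (n : ℤ)) (u + n + l) =
      Finset.Ico u (u + ((n + l + 1 : ℕ) : ℤ)) := by
    ext j; simp; omega
  have e2 : Finset.Icc u (u + (n : ℤ)) = Finset.Ico u (u + ((n + 1 : ℕ) : ℤ)) := by
    ext j; simp; omega
  have e3 : Finset.Icc (u + (n : ℤ)) (u + n + l) =
      Finset.Ico (u + (n : ℤ)) (u + n + ((l + 1 : ℕ) : ℤ)) := by
    ext j; simp; omega
  rw [e1, e2, e3, pr_Ico, pr_Ico, pr_Ico, wordProb_wordFrom_succ, wordProb_wordFrom_succ,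
    wordProb_wordFrom_succ, Finset.prod_range_add]
  push_cast
  simp only [← add_assoc]
  ring

/-- The Markov property: past and future of the position `m` are independent given its symbol. -/
theorem pr_split {m : ℤ} (s : ℕ) : ∀ {D₁ D₂ : Finset ℤ} {u v : ℤ} (y : ℤ → Fin (k + 1)),
    D₁ ⊆ Finset.Icc u m → D₂ ⊆ Finset.Icc m v → m ∈ D₁ → m ∈ D₂ →
    (Finset.Icc u m \ D₁).card + (Finset.Icc m v \ D₂).card = s →
    A.pr (D₁ ∪ D₂) y * A.init (y m) = A.pr D₁ y * A.pr D₂ y := by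
  -- Both sides are sums over the symbol at any position not fixed. The number of such positions is
  -- the induction parameter, and the base case is that of two full intervals meeting in `m`.
  induction s with
  | zero =>
    intro D₁ D₂ u v y h1 h2 hm1 hm2 hs
    have e1 : D₁ = Finset.Icc u m := by
      refine h1.antisymm ?_
      rw [← Finset.sdiff_eq_empty_iff_subset, ← Finset.card_eq_zero]; omega
    have e2 : D₂ = Finset.Icc m v := by
      refine h2.antisymm ?_
      rw [← Finset.sdiff_eq_empty_iff_subset, ← Finset.card_eq_zero]; omega
    have := h1 hm1
    have := h2 hm2
    rw [e1, e2]
    apply pr_split_Icc <;> simp_all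
  | succ s ih =>
    intro D₁ D₂ u v y h1 h2 hm1 hm2 hs
    by_cases hc : (Finset.Icc u m \ D₁).Nonempty
    · obtain ⟨i, hi⟩ := hc
      have hi' := Finset.mem_sdiff.1 hi
      have him : i < m := lt_of_le_of_ne (Finset.mem_Icc.1 hi'.1).2 (fun h => hi'.2 (h ▸ hm1))
      have hi2 : i ∉ D₂ := fun h => by
        have := Finset.mem_Icc.1 (h2 h); omega
      have hi12 : i ∉ D₁ ∪ D₂ := by simp [hi'.2, hi2]
      rw [A.pr_eq_sum hi12, A.pr_eq_sum hi'.2, Finset.sum_mul, Finset.sum_mul]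
      refine Finset.sum_congr rfl fun b _ => ?_
      rw [← Finset.insert_union, ← A.pr_update_of_notMem hi2 y b]
      have hcard : (Finset.Icc u m \ insert i D₁).card + (Finset.Icc m v \ D₂).card = s := by
        have : Finset.Icc u m \ insert i D₁ = (Finset.Icc u m \ D₁).erase i := by
          ext j; simp; tauto
        rw [this, Finset.card_erase_of_mem hi]
        have := Finset.card_pos.2 ⟨i, hi⟩
        omega
      have := ih (Function.update y i b) (Finset.insert_subset hi'.1 h1) h2
        (Finset.mem_insert_of_mem hm1) hm2 hcard
      rwa [Function.update_of_ne him.ne'] at this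
    · rw [Finset.not_nonempty_iff_eq_empty] at hc
      have hc2 : (Finset.Icc m v \ D₂).Nonempty := by
        rw [← Finset.card_pos]; rw [hc, Finset.card_empty] at hs; omega
      obtain ⟨i, hi⟩ := hc2
      have hi' := Finset.mem_sdiff.1 hi
      have him : m < i := lt_of_le_of_ne (Finset.mem_Icc.1 hi'.1).1 (fun h => hi'.2 (h ▸ hm2))
      have hi2 : i ∉ D₁ := fun h => by
        have := Finset.mem_Icc.1 (h1 h); omega
      have hi12 : i ∉ D₁ ∪ D₂ := by simp [hi'.2, hi2]
      rw [A.pr_eq_sum hi12, A.pr_eq_sum hi'.2, Finset.sum_mul, Finset.mul_sum]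
      refine Finset.sum_congr rfl fun b _ => ?_
      rw [← Finset.union_insert, ← A.pr_update_of_notMem hi2 y b]
      have hcard : (Finset.Icc u m \ D₁).card + (Finset.Icc m v \ insert i D₂).card = s := by
        have : Finset.Icc m v \ insert i D₂ = (Finset.Icc m v \ D₂).erase i := by
          ext j; simp; tauto
        rw [this, Finset.card_erase_of_mem hi]
        have := Finset.card_pos.2 ⟨i, hi⟩
        omega
      have := ih (Function.update y i b) h1 (Finset.insert_subset hi'.1 h2)
        hm1 (Finset.mem_insert_of_mem hm2) hcard
      rwa [Function.update_of_ne him.ne] at this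

theorem pr_markov {m : ℤ} {D₁ D₂ : Finset ℤ} (y : ℤ → Fin (k + 1))
    (h1 : ∀ i ∈ D₁, i ≤ m) (h2 : ∀ i ∈ D₂, m ≤ i) (hm1 : m ∈ D₁) (hm2 : m ∈ D₂) :
    A.pr (D₁ ∪ D₂) y * A.init (y m) = A.pr D₁ y * A.pr D₂ y := by
  obtain ⟨u, n, h⟩ := exists_Ico (D₁ ∪ D₂)
  refine A.pr_split _ (u := u) (v := u + n) y (fun i hi => ?_) (fun i hi => ?_) hm1 hm2 rfl
  · have := Finset.mem_Ico.1 (h (Finset.mem_union_left _ hi))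
    have := h1 i hi
    simp; omega
  · have := Finset.mem_Ico.1 (h (Finset.mem_union_right _ hi))
    have := h2 i hi
    simp; omega

/-- The Markov property is applied at `m` and at `m + 1`, with the pair `{m, m + 1}` as the link.
The exact correction to independence is the factor `trans / init`. -/
theorem pr_join {m : ℤ} {D₁ D₂ : Finset ℤ} (y : ℤ → Fin (k + 1))
    (h1 : ∀ i ∈ D₁, i ≤ m) (h2 : ∀ i ∈ D₂, m + 1 ≤ i) (hm1 : m ∈ D₁) (hm2 : m + 1 ∈ D₂) :
    A.pr (D₁ ∪ D₂) y * A.init (y (m + 1)) =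
      A.pr D₁ y * A.pr D₂ y * A.trans (y m) (y (m + 1)) := by
  have e1 := A.pr_markov (m := m) (D₁ := D₁) (D₂ := insert m D₂) y h1
    (by intro i hi; rcases Finset.mem_insert.1 hi with rfl | hi; · rfl
        · have := h2 i hi; omega) hm1 (Finset.mem_insert_self _ _)
  have e2 := A.pr_markov (m := m + 1) (D₁ := {m, m + 1}) (D₂ := D₂) y (by simp) h2 (by simp) hm2
  have s1 : D₁ ∪ insert m D₂ = D₁ ∪ D₂ := by ext j; simp; grind
  have s2 : ({m, m + 1} ∪ D₂ : Finset ℤ) = insert m D₂ := by ext j; simp; grind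
  rw [s1] at e1
  rw [s2, pr_pair] at e2
  have := A.init_pos (y m)
  have hne : A.init (y m) ≠ 0 := this.ne'
  apply mul_right_cancel₀ hne
  linear_combination A.init (y (m+1)) * e1 + A.pr D₁ y * e2

/-- A bilinear statement about the probabilities of `D₁` and `D₂` may be checked after fixing
the symbol of a free position on the left. -/
theorem quasi_independent {m : ℤ} {D₁ D₂ : Finset ℤ} (y : ℤ → Fin (k + 1))
    (h1 : ∀ i ∈ D₁, i ≤ m) (h2 : ∀ i ∈ D₂, m + 1 ≤ i) :
    A.bd * (A.pr D₁ y * A.pr D₂ y) ≤ A.pr (D₁ ∪ D₂) y ∧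
      A.bd * A.pr (D₁ ∪ D₂) y ≤ A.pr D₁ y * A.pr D₂ y := by
  -- If both sides of the cut are fixed, the correction `trans / init` of `pr_join` lies between
  -- `bd` and `1 / bd`. The other cases follow by summing over the free symbols at the cut, both
  -- inequalities being linear in each cylinder.
  have key : ∀ {D₁ D₂ : Finset ℤ} (y : ℤ → Fin (k + 1)), (∀ i ∈ D₁, i ≤ m) →
      (∀ i ∈ D₂, m + 1 ≤ i) → m ∈ D₁ → m + 1 ∈ D₂ →
      A.bd * (A.pr D₁ y * A.pr D₂ y) ≤ A.pr (D₁ ∪ D₂) y ∧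
      A.bd * A.pr (D₁ ∪ D₂) y ≤ A.pr D₁ y * A.pr D₂ y := by
    intro D₁ D₂ y h1 h2 hm1 hm2
    have e := A.pr_join y h1 h2 hm1 hm2
    have b1 := A.bd_le_trans (y m) (y (m + 1))
    have b2 := A.bd_le_init (y (m + 1))
    have b3 := A.init_le_one (y (m + 1))
    have b4 := (A.trans_lt_one (y m) (y (m + 1))).le
    have p := mul_pos (A.pr_pos D₁ y) (A.pr_pos D₂ y)
    have q := A.pr_pos (D₁ ∪ D₂) y
    constructor
    · calc _ ≤ A.pr D₁ y * A.pr D₂ y * A.trans (y m) (y (m + 1)) := by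
            rw [mul_comm]; gcongr
        _ = _ := e.symm
        _ ≤ _ := mul_le_of_le_one_right q.le b3
    · calc _ ≤ A.pr (D₁ ∪ D₂) y * A.init (y (m + 1)) := by rw [mul_comm]; gcongr
        _ = _ := e
        _ ≤ _ := mul_le_of_le_one_right p.le b4
  have key2 : ∀ {D₁ D₂ : Finset ℤ} (y : ℤ → Fin (k + 1)), (∀ i ∈ D₁, i ≤ m) →
      (∀ i ∈ D₂, m + 1 ≤ i) → m ∈ D₁ →
      A.bd * (A.pr D₁ y * A.pr D₂ y) ≤ A.pr (D₁ ∪ D₂) y ∧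
      A.bd * A.pr (D₁ ∪ D₂) y ≤ A.pr D₁ y * A.pr D₂ y := by
    intro D₁ D₂ y h1 h2 hm1
    by_cases hm2 : m + 1 ∈ D₂
    · exact key y h1 h2 hm1 hm2
    have hm3 : m + 1 ∉ D₁ := fun h => by have := h1 _ h; omega
    have hm4 : m + 1 ∉ D₁ ∪ D₂ := by simp [hm2, hm3]
    have := fun b => key (D₁ := D₁) (D₂ := insert (m + 1) D₂) (Function.update y (m + 1) b) h1
      (by simpa using h2) hm1 (Finset.mem_insert_self _ _)
    simp only [A.pr_update_of_notMem hm3, Finset.union_insert] at this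
    rw [A.pr_eq_sum hm2, A.pr_eq_sum hm4, Finset.mul_sum, Finset.mul_sum, Finset.mul_sum]
    exact ⟨Finset.sum_le_sum fun b _ => (this b).1, Finset.sum_le_sum fun b _ => (this b).2⟩
  by_cases hm1 : m ∈ D₁
  · exact key2 y h1 h2 hm1
  have hm3 : m ∉ D₂ := fun h => by have := h2 _ h; omega
  have hm4 : m ∉ D₁ ∪ D₂ := by simp [hm1, hm3]
  have := fun b => key2 (D₁ := insert m D₁) (D₂ := D₂) (Function.update y m b)
    (by simpa using h1) h2 (Finset.mem_insert_self _ _)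
  simp only [A.pr_update_of_notMem hm3, Finset.insert_union] at this
  rw [A.pr_eq_sum hm1, A.pr_eq_sum hm4, Finset.sum_mul, Finset.mul_sum, Finset.mul_sum]
  exact ⟨Finset.sum_le_sum fun b _ => (this b).1, Finset.sum_le_sum fun b _ => (this b).2⟩

/-- Fixing the symbols on an interval: the outside and the inside are quasi-independent. -/
theorem pr_interval {c d : ℤ} (D : Finset ℤ) (y : ℤ → Fin (k + 1)) (hcd : c ≤ d) :
    A.bd ^ 3 * (A.pr (D \ Finset.Icc c d) y * A.pr (D ∩ Finset.Icc c d) y) ≤ A.pr D y := by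
  set D₁ := D.filter (· < c)
  set D₂ := D.filter (d < ·)
  set D₃ := D ∩ Finset.Icc c d
  have e1 : D \ Finset.Icc c d = D₁ ∪ D₂ := by
    ext j; simp [D₁, D₂]; grind
  have e2 : D = (D₁ ∪ D₃) ∪ D₂ := by
    ext j; simp [D₁, D₂, D₃]; grind
  -- Three factors `bd`: one for separating the left from the right outer piece, and two for putting
  -- the three pieces together again.
  have q1 := (A.quasi_independent (m := c - 1) (D₁ := D₁) (D₂ := D₂) y
    (by simp [D₁]; try omega) (by simp [D₂]; try omega)).2
  have q2 := (A.quasi_independent (m := d) (D₁ := D₁ ∪ D₃) (D₂ := D₂) y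
    (by simp only [D₁, D₃, Finset.mem_union, Finset.mem_filter, Finset.mem_inter, Finset.mem_Icc]; omega) (by simp [D₂]; try omega)).1
  have q3 := (A.quasi_independent (m := c - 1) (D₁ := D₁) (D₂ := D₃) y
    (by simp [D₁]; try omega) (by simp only [D₃, Finset.mem_inter, Finset.mem_Icc]; omega)).1
  rw [e1]
  conv_rhs => rw [e2]
  have b := A.bd_pos
  have p2 := A.pr_pos D₂ y
  have p3 := A.pr_pos D₃ y
  calc A.bd ^ 3 * (A.pr (D₁ ∪ D₂) y * A.pr D₃ y)
      = A.bd ^ 2 * ((A.bd * A.pr (D₁ ∪ D₂) y) * A.pr D₃ y) := by ring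
    _ ≤ A.bd ^ 2 * ((A.pr D₁ y * A.pr D₂ y) * A.pr D₃ y) := by gcongr
    _ = A.bd * ((A.bd * (A.pr D₁ y * A.pr D₃ y)) * A.pr D₂ y) := by ring
    _ ≤ A.bd * (A.pr (D₁ ∪ D₃) y * A.pr D₂ y) := by gcongr
    _ ≤ _ := q2

/-- Three factors `bd` come from `pr_interval` for the one-point interval, the fourth from the
stationary probability of the symbol. -/
theorem pr_insert_ge (D : Finset ℤ) (i : ℤ) (y : ℤ → Fin (k + 1)) :
    A.bd ^ 4 * A.pr D y ≤ A.pr (insert i D) y := by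
  have h := A.pr_interval (c := i) (d := i) (insert i D) y le_rfl
  have e1 : insert i D ∩ Finset.Icc i i = {i} := by ext j; simp
  rw [e1, pr_singleton] at h
  have h2 : A.pr D y ≤ A.pr (insert i D \ Finset.Icc i i) y := A.pr_mono (by grind) y
  refine le_trans ?_ h
  have b := A.bd_pos
  have b2 := A.bd_le_init (y i)
  have p := A.pr_pos D y
  calc _ = A.bd ^ 3 * (A.pr D y * A.bd) := by ring
    _ ≤ _ := by
      have := (A.pr_pos (insert i D \ Finset.Icc i i) y).le
      gcongr

/-- Some symbol other than `y i` exists, and it takes at least the share `bd ^ 4` by `pr_insert_ge`.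
-/
theorem pr_insert_le {D : Finset ℤ} {i : ℤ} (hi : i ∉ D) (y : ℤ → Fin (k + 1)) :
    A.pr (insert i D) y ≤ (1 - A.bd ^ 4) * A.pr D y := by
  obtain ⟨b, hb⟩ := A.exists_ne (y i)
  have h1 := A.pr_eq_sum hi y
  have h2 : ∑ c ∈ ({y i, b} : Finset (Fin (k+1))),
      A.pr (insert i D) (Function.update y i c) ≤
      ∑ c, A.pr (insert i D) (Function.update y i c) :=
    Finset.sum_le_sum_of_subset_of_nonneg (Finset.subset_univ _) fun c _ _ => (A.pr_pos _ _).le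
  rw [Finset.sum_pair hb.symm, Function.update_eq_self] at h2
  have h3 := A.pr_insert_ge D i (Function.update y i b)
  rw [A.pr_update_of_notMem hi] at h3
  linarith

theorem pr_ge_pow (D : Finset ℤ) (y : ℤ → Fin (k + 1)) : (A.bd ^ 4) ^ D.card ≤ A.pr D y := by
  induction D using Finset.induction_on with
  | empty => simp [pr_empty]
  | insert i D hi ih =>
    rw [Finset.card_insert_of_notMem hi, pow_succ, mul_comm]
    refine le_trans ?_ (A.pr_insert_ge D i y)
    have := A.bd_pos
    gcongr

theorem pr_union_le {D X : Finset ℤ} (h : Disjoint D X) (y : ℤ → Fin (k + 1)) :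
    A.pr (D ∪ X) y ≤ (1 - A.bd ^ 4) ^ X.card * A.pr D y := by
  induction X using Finset.induction_on with
  | empty => simp
  | insert i X hi ih =>
    have h' := Finset.disjoint_insert_right.1 h
    rw [Finset.card_insert_of_notMem hi, Finset.union_insert]
    refine (A.pr_insert_le (by simp [hi, h'.1]) y).trans ?_
    rw [pow_succ (1 - A.bd ^ 4), mul_comm _ (1 - A.bd ^ 4), mul_assoc]
    have : A.bd ^ 4 ≤ 1 := pow_le_one₀ A.bd_pos.le A.bd_lt_one.le
    have := ih h'.2
    gcongr

/-- A cylinder is at least as probable as the product of its parts on disjoint intervals, up to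
constants. -/
theorem pr_ge_prod {ι : Type*} (Q : Finset ι) (c d : ι → ℤ) (hcd : ∀ q ∈ Q, c q ≤ d q)
    (hdis : ∀ q ∈ Q, ∀ q' ∈ Q, q ≠ q' → Disjoint (Finset.Icc (c q) (d q)) (Finset.Icc (c q') (d q')))
    (y : ℤ → Fin (k + 1)) : ∀ D : Finset ℤ,
    (A.bd ^ 4) ^ (D \ Q.biUnion fun q => Finset.Icc (c q) (d q)).card *
      ∏ q ∈ Q, (A.bd ^ 3 * A.pr (D ∩ Finset.Icc (c q) (d q)) y) ≤ A.pr D y := by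
  classical
  induction Q using Finset.induction_on with
  | empty => intro D; simpa using A.pr_ge_pow D y
  | insert q Q hq ih =>
    intro D
    refine le_trans ?_ (A.pr_interval D y (hcd q (Finset.mem_insert_self _ _)))
    have := ih (fun r hr => hcd r (Finset.mem_insert_of_mem hr))
      (fun r hr r' hr' => hdis r (Finset.mem_insert_of_mem hr) r' (Finset.mem_insert_of_mem hr'))
      (D \ Finset.Icc (c q) (d q))
    have e : ∏ r ∈ Q, (A.bd ^ 3 * A.pr ((D \ Finset.Icc (c q) (d q)) ∩ Finset.Icc (c r) (d r)) y)
        = ∏ r ∈ Q, (A.bd ^ 3 * A.pr (D ∩ Finset.Icc (c r) (d r)) y) := by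
      refine Finset.prod_congr rfl fun r hr => ?_
      have hd := hdis q (Finset.mem_insert_self _ _) r (Finset.mem_insert_of_mem hr)
        (fun h => hq (h ▸ hr))
      congr 2
      ext j
      have : j ∈ Finset.Icc (c q) (d q) → j ∉ Finset.Icc (c r) (d r) :=
        fun h => Finset.disjoint_left.1 hd h
      simp only [Finset.mem_inter, Finset.mem_sdiff]
      tauto
    rw [e] at this
    rw [Finset.prod_insert hq, Finset.biUnion_insert, show D \ (Finset.Icc (c q) (d q) ∪ Q.biUnion fun q => Finset.Icc (c q) (d q)) =
      (D \ Finset.Icc (c q) (d q)) \ Q.biUnion fun q => Finset.Icc (c q) (d q) from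
      (sdiff_sdiff_left ..).symm, ← mul_assoc, mul_comm _ (A.bd ^ 3 * _), mul_assoc]
    rw [mul_assoc, mul_comm (A.pr (D \ _) y)]
    have b := A.bd_pos
    have p := A.pr_pos (D ∩ Finset.Icc (c q) (d q)) y
    gcongr

end MarkovSystem

end

noncomputable section

namespace MarkovSystem

variable {k : ℕ} (A : MarkovSystem k)

/-! ### Exponential mixing -/

/-- Doeblin's argument: `trans a b ≥ bd * init b`, so subtracting `bd * init` from a row of the
transition matrix leaves a nonnegative kernel of mass `1 - bd`. It contracts functions of mean zero
by this factor at each step of the gap. The base case is quasi-independence. -/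
theorem mixing_point (g : ℕ) : ∀ {m : ℤ} {D : Finset ℤ} (y : ℤ → Fin (k + 1)) (a : Fin (k + 1)),
    (∀ i ∈ D, m + 1 + g ≤ i) →
    |A.pr (insert m D) (Function.update y m a) - A.init a * A.pr D y| ≤
      (1 - A.bd) ^ g * A.bd⁻¹ * (A.init a * A.pr D y) := by
  have hb := A.bd_pos
  have hb1 := A.bd_lt_one
  induction g with
  | zero =>
    intro m D y a h
    have hm : m ∉ D := fun hm => by have := h m hm; omega
    have q := A.quasi_independent (m := m) (D₁ := {m}) (D₂ := D) (Function.update y m a)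
      (by simp) (by intro i hi; have := h i hi; omega)
    rw [pr_singleton, Function.update_self, A.pr_update_of_notMem hm, ← Finset.insert_eq] at q
    have p := mul_pos (A.init_pos a) (A.pr_pos D y)
    set P := A.init a * A.pr D y
    set R := A.pr (insert m D) (Function.update y m a)
    have h1 : R ≤ A.bd⁻¹ * P := by
      rw [inv_mul_eq_div, le_div_iff₀ hb]; linarith [q.2]
    have h2 : 1 ≤ A.bd⁻¹ := (one_le_inv₀ hb).2 hb1.le
    rw [pow_zero, one_mul, abs_le]
    constructor <;> nlinarith [q.1]
  | succ g ih =>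
    intro m D y a h
    have hm : m ∉ D := fun hm => by have := h m hm; push_cast at this; omega
    have hm1 : m + 1 ∉ D := fun hm => by have := h _ hm; push_cast at this; omega
    set P := A.pr D y
    -- The deviation of the conditional probability of `D`, given the symbol at `m + 1`, from its
    -- mean. Its mean under `init` vanishes, so `bd * init` may be subtracted from the kernel
    -- without changing the sum.
    set f : Fin (k + 1) → ℝ := fun b =>
      A.pr (insert (m + 1) D) (Function.update y (m + 1) b) / A.init b - P with hf
    have hP : 0 < P := A.pr_pos D y
    have hfb : ∀ b, |f b| ≤ (1 - A.bd) ^ g * A.bd⁻¹ * P := by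
      intro b
      have hib := A.init_pos b
      have := ih (m := m + 1) (D := D) y b (by intro i hi; have := h i hi; push_cast at this; omega)
      have e : f b = (A.pr (insert (m + 1) D) (Function.update y (m + 1) b) - A.init b * P)
          / A.init b := by
        simp only [hf]; field_simp
      rw [e, abs_div, abs_of_pos hib, div_le_iff₀ hib]
      calc _ ≤ _ := this
        _ = _ := by ring
    have e1 : A.pr (insert m D) (Function.update y m a) =
        ∑ b, A.init a * A.trans a b * (f b + P) := by
      rw [A.pr_eq_sum (i := m + 1) (by simp [hm1])]
      refine Finset.sum_congr rfl fun b _ => ?_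
      have e := A.pr_markov (m := m + 1) (D₁ := {m, m + 1}) (D₂ := insert (m + 1) D)
        (Function.update (Function.update y m a) (m + 1) b) (by simp)
        (by intro i hi
            rcases Finset.mem_insert.1 hi with rfl | hi
            · exact le_rfl
            · have := h i hi; push_cast at this; omega) (by simp) (by simp)
      rw [pr_pair, Function.update_self, Function.update_of_ne (by omega), Function.update_self,
        Function.update_comm (by omega), A.pr_update_of_notMem (i := m) (D := insert (m + 1) D)
          (by simp [hm])] at e
      have s : ({m, m + 1} ∪ insert (m + 1) D : Finset ℤ) = insert (m + 1) (insert m D) := by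
        ext j; simp; tauto
      rw [s, Function.update_comm (by omega)] at e
      have hib := (A.init_pos b).ne'
      simp only [hf]
      rw [sub_add_cancel, mul_div_assoc', eq_div_iff hib]
      exact e
    have e2 : ∑ b, A.init b * f b = 0 := by
      have : ∀ b, A.init b * f b =
          A.pr (insert (m + 1) D) (Function.update y (m + 1) b) - A.init b * P := by
        intro b
        have hib := (A.init_pos b).ne'
        simp only [hf]; field_simp
      simp only [this, Finset.sum_sub_distrib]
      rw [← A.pr_eq_sum hm1, ← Finset.sum_mul, A.init_sum]; ring
    have e3 : A.pr (insert m D) (Function.update y m a) - A.init a * P =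
        A.init a * ∑ b, (A.trans a b - A.bd * A.init b) * f b := by
      rw [e1]
      have t1 : ∑ b, A.init a * A.trans a b * (f b + P) =
          A.init a * ∑ b, A.trans a b * f b + A.init a * P * ∑ b, A.trans a b := by
        rw [Finset.mul_sum, Finset.mul_sum, ← Finset.sum_add_distrib]
        exact Finset.sum_congr rfl fun b _ => by ring
      have t2 : ∑ b, (A.trans a b - A.bd * A.init b) * f b =
          ∑ b, A.trans a b * f b - A.bd * ∑ b, A.init b * f b := by
        rw [Finset.mul_sum, ← Finset.sum_sub_distrib]
        exact Finset.sum_congr rfl fun b _ => by ring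
      rw [t1, t2, e2, A.trans_sum]; ring
    rw [e3, abs_mul, abs_of_pos (A.init_pos a)]
    have hw : ∀ b, 0 ≤ A.trans a b - A.bd * A.init b := fun b => by
      have := A.bd_le_trans a b
      have := A.init_le_one b
      nlinarith
    have e4 : |∑ b, (A.trans a b - A.bd * A.init b) * f b| ≤
        (1 - A.bd) * ((1 - A.bd) ^ g * A.bd⁻¹ * P) := by
      calc _ ≤ ∑ b, |(A.trans a b - A.bd * A.init b) * f b| := Finset.abs_sum_le_sum_abs _ _
        _ ≤ ∑ b, (A.trans a b - A.bd * A.init b) * ((1 - A.bd) ^ g * A.bd⁻¹ * P) := by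
            refine Finset.sum_le_sum fun b _ => ?_
            rw [abs_mul, abs_of_nonneg (hw b)]
            exact mul_le_mul_of_nonneg_left (hfb b) (hw b)
        _ = _ := by
            rw [← Finset.sum_mul, Finset.sum_sub_distrib, ← Finset.mul_sum, A.init_sum, A.trans_sum,
              mul_one]
    calc _ ≤ A.init a * ((1 - A.bd) * ((1 - A.bd) ^ g * A.bd⁻¹ * P)) :=
          mul_le_mul_of_nonneg_left e4 (A.init_pos a).le
      _ = _ := by ring

/-- If `m` is fixed on the left, the Markov property reduces the past to the single symbol at `m`,
and `mixing_point` applies. Otherwise the estimate is summed over that symbol. -/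
theorem mixing (g : ℕ) {m : ℤ} {D₁ D₂ : Finset ℤ} (y : ℤ → Fin (k + 1))
    (h1 : ∀ i ∈ D₁, i ≤ m) (h2 : ∀ i ∈ D₂, m + 1 + g ≤ i) :
    |A.pr (D₁ ∪ D₂) y - A.pr D₁ y * A.pr D₂ y| ≤
      (1 - A.bd) ^ g * A.bd⁻¹ * (A.pr D₁ y * A.pr D₂ y) := by
  have key : ∀ {D₁ : Finset ℤ} (y : ℤ → Fin (k + 1)), (∀ i ∈ D₁, i ≤ m) → m ∈ D₁ →
      |A.pr (D₁ ∪ D₂) y - A.pr D₁ y * A.pr D₂ y| ≤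
      (1 - A.bd) ^ g * A.bd⁻¹ * (A.pr D₁ y * A.pr D₂ y) := by
    intro D₁ y h1 hm
    have e := A.pr_markov (m := m) (D₁ := D₁) (D₂ := insert m D₂) y h1
      (by intro i hi
          rcases Finset.mem_insert.1 hi with rfl | hi
          · exact le_rfl
          · have := h2 i hi; omega) hm (by simp)
    have s : D₁ ∪ insert m D₂ = D₁ ∪ D₂ := by ext j; simp; grind
    have q := A.mixing_point g (m := m) y (y m) h2
    rw [Function.update_eq_self] at q
    rw [s] at e
    have hi := A.init_pos (y m)
    have hp := A.pr_pos D₁ y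
    rw [← mul_le_mul_iff_left₀ hi, ← abs_of_pos hi, ← abs_mul, abs_of_pos hi]
    have : (A.pr (D₁ ∪ D₂) y - A.pr D₁ y * A.pr D₂ y) * A.init (y m) =
        A.pr D₁ y * (A.pr (insert m D₂) y - A.init (y m) * A.pr D₂ y) := by
      linear_combination e
    rw [this, abs_mul, abs_of_pos hp]
    calc _ ≤ A.pr D₁ y * _ := mul_le_mul_of_nonneg_left q hp.le
      _ = _ := by ring
  by_cases hm : m ∈ D₁
  · exact key y h1 hm
  have hm3 : m ∉ D₂ := fun h => by have := h2 _ h; omega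
  have hm4 : m ∉ D₁ ∪ D₂ := by simp [hm, hm3]
  have := fun b => key (D₁ := insert m D₁) (Function.update y m b)
    (by simpa using h1) (Finset.mem_insert_self _ _)
  simp only [A.pr_update_of_notMem hm3, Finset.insert_union] at this
  rw [A.pr_eq_sum hm, A.pr_eq_sum hm4, Finset.sum_mul, ← Finset.sum_sub_distrib, Finset.mul_sum]
  exact (Finset.abs_sum_le_sum_abs _ _).trans (Finset.sum_le_sum fun b _ => this b)

/-! ### Events that depend on a word -/

theorem measurable_window (u : ℤ) (n : ℕ) :
    Measurable fun (x : ℤ → Fin (k + 1)) (j : Fin n) => x (u + (j : ℕ)) :=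
  measurable_pi_lambda _ fun _ => measurable_pi_apply _

theorem measurableSet_wordFrom (p : List (Fin (k + 1)) → Prop) (u : ℤ) (n : ℕ) :
    MeasurableSet {x : ℤ → Fin (k + 1) | p (wordFrom x u n)} :=
  measurable_window u n (MeasurableSet.of_discrete (s := {w : Fin n → Fin (k + 1) | p (List.ofFn w)}))

/-- A sequence that carries the word `w` at the position `u`. -/
def extendWord (w : List (Fin (k + 1))) (u : ℤ) : ℤ → Fin (k + 1) :=
  fun i => w.getD (i - u).toNat 0

theorem wordFrom_extendWord (w : List (Fin (k + 1))) (u : ℤ) :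
    wordFrom (extendWord w u) u w.length = w := by
  refine List.ext_getElem (by simp) fun j h1 h2 => ?_
  rw [getElem_wordFrom, extendWord, show (u + j - u).toNat = j by omega]
  simp [h2]

theorem cylinderAt_eq_wordFrom (w : List (Fin (k + 1))) (u : ℤ) :
    cylinderAt u w = {x | wordFrom x u w.length = w} := by
  ext x
  rw [← wordFrom_extendWord w u, mem_cylinderAt_wordFrom, wordFrom_extendWord, Set.mem_ofPred_eq]
  constructor
  · intro h
    conv_rhs => rw [← wordFrom_extendWord w u]
    refine List.ext_getElem (by simp) fun j h1 h2 => ?_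
    rw [getElem_wordFrom, getElem_wordFrom, h j (by simpa using h1)]
  · intro h j hj
    rw [← getElem_wordFrom x u w.length j (by simpa using hj),
      ← getElem_wordFrom (extendWord w u) u w.length j (by simpa using hj)]
    simp only [h, wordFrom_extendWord]

open Classical in
theorem measure_wordFrom_inter (p : List (Fin (k + 1)) → Prop) (u : ℤ) (n : ℕ)
    (S : Set (ℤ → Fin (k + 1))) :
    A.measure.real ({x | p (wordFrom x u n)} ∩ S) =
      ∑ w : Fin n → Fin (k + 1) with p (List.ofFn w),
        A.measure.real (cylinderAt u (List.ofFn w) ∩ S) := by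
  have hf := measurable_window (k := k) u n
  have h := sum_measureReal_preimage_singleton (μ := A.measure.restrict S)
    (Finset.univ.filter fun w : Fin n → Fin (k + 1) => p (List.ofFn w))
    (f := fun (x : ℤ → Fin (k + 1)) (j : Fin n) => x (u + (j : ℕ)))
    (fun w _ => hf (measurableSet_singleton w))
  rw [measureReal_restrict_apply (hf (Finset.measurableSet _))] at h
  convert h.symm using 2
  · ext x
    simp only [Set.mem_inter_iff, Set.mem_ofPred_eq, Set.mem_preimage, Finset.coe_filter,
      Finset.mem_univ, true_and, wordFrom]
  · rename_i w _
    rw [measureReal_restrict_apply (hf (measurableSet_singleton w))]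
    congr 2
    rw [cylinderAt_eq_wordFrom]
    ext x
    simp only [wordFrom, Set.mem_ofPred_eq, Set.mem_preimage, Set.mem_singleton_iff]
    rw [← List.ofFn_inj]
    simp [List.ofFn_congr]

open Classical in
/-- The probability that a word of length `n` has the property `p`. -/
def wordFreq (n : ℕ) (p : List (Fin (k + 1)) → Prop) : ℝ :=
  ∑ w : Fin n → Fin (k + 1) with p (List.ofFn w), A.wordProb (List.ofFn w)

theorem measure_wordFrom (p : List (Fin (k + 1)) → Prop) (u : ℤ) (n : ℕ) :
    A.measure.real {x | p (wordFrom x u n)} = A.wordFreq n p := by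
  have := A.measure_wordFrom_inter p u n Set.univ
  simpa only [Set.inter_univ, measureReal_cylinderAt, wordFreq] using this

theorem measure_cylinderAt_inter (w w' : List (Fin (k + 1))) (u : ℤ) (g : ℕ) :
    |A.measure.real (cylinderAt u w ∩ cylinderAt (u + w.length + g) w') -
      A.wordProb w * A.wordProb w'| ≤
      (1 - A.bd) ^ g * A.bd⁻¹ * (A.wordProb w * A.wordProb w') := by
  set v : ℤ := u + w.length + g with hv
  let y : ℤ → Fin (k + 1) := fun i =>
    if i < u + w.length then extendWord w u i else extendWord w' v i
  have e1 : wordFrom y u w.length = w := by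
    conv_rhs => rw [← wordFrom_extendWord w u]
    refine List.ext_getElem (by simp) fun j h1 h2 => ?_
    rw [getElem_wordFrom, getElem_wordFrom]
    have : (j : ℤ) < w.length := by simpa using h1
    simp [y, this]
  have e2 : wordFrom y v w'.length = w' := by
    conv_rhs => rw [← wordFrom_extendWord w' v]
    refine List.ext_getElem (by simp) fun j h1 h2 => ?_
    rw [getElem_wordFrom, getElem_wordFrom]
    have : ¬ v + j < u + w.length := by omega
    simp [y, this]
  have h := A.mixing g (m := u + w.length - 1) (D₁ := Finset.Ico u (u + w.length))
    (D₂ := Finset.Ico v (v + w'.length)) y (by simp) (by simp; omega)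
  rw [pr_Ico, pr_Ico, e1, e2] at h
  have s : agreeOn (Finset.Ico u (u + w.length) ∪ Finset.Ico v (v + w'.length)) y =
      cylinderAt u w ∩ cylinderAt v w' := by
    conv_rhs => rw [← e1, ← e2, ← agreeOn_Icc, ← agreeOn_Icc]
    ext x
    simp [agreeOn, or_imp, forall_and]
  rwa [pr, s] at h

theorem wordFreq_nonneg (n : ℕ) (p) : 0 ≤ A.wordFreq n p :=
  Finset.sum_nonneg fun _ _ => (A.wordProb_pos _).le

theorem wordFreq_le_one (n : ℕ) (p) : A.wordFreq n p ≤ 1 := by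
  rw [← A.measure_wordFrom p 0 n]; exact measureReal_le_one

theorem cov_wordFrom (p : List (Fin (k + 1)) → Prop) (n : ℕ) (u : ℤ) (g : ℕ) :
    |A.measure.real ({x | p (wordFrom x u n)} ∩ {x | p (wordFrom x (u + n + g) n)}) -
      A.wordFreq n p ^ 2| ≤ (1 - A.bd) ^ g * A.bd⁻¹ := by
  classical
  have hb := A.bd_pos
  have hb1 := A.bd_lt_one
  rw [measure_wordFrom_inter, Finset.sum_congr rfl fun w _ => by
    rw [Set.inter_comm (cylinderAt _ _), measure_wordFrom_inter]]
  have e : A.wordFreq n p ^ 2 = ∑ w : Fin n → Fin (k + 1) with p (List.ofFn w),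
      ∑ w' : Fin n → Fin (k + 1) with p (List.ofFn w'),
        A.wordProb (List.ofFn w) * A.wordProb (List.ofFn w') := by
    rw [sq, wordFreq, Finset.sum_mul_sum]
  have hle : A.wordFreq n p ^ 2 ≤ 1 := pow_le_one₀ (A.wordFreq_nonneg n p) (A.wordFreq_le_one n p)
  calc _ ≤ ∑ w : Fin n → Fin (k + 1) with p (List.ofFn w),
      ∑ w' : Fin n → Fin (k + 1) with p (List.ofFn w'), (1 - A.bd) ^ g * A.bd⁻¹ *
        (A.wordProb (List.ofFn w) * A.wordProb (List.ofFn w')) := by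
        rw [e, ← Finset.sum_sub_distrib]
        simp only [← Finset.sum_sub_distrib]
        refine (Finset.abs_sum_le_sum_abs _ _).trans (Finset.sum_le_sum fun w _ => ?_)
        refine (Finset.abs_sum_le_sum_abs _ _).trans (Finset.sum_le_sum fun w' _ => ?_)
        have := A.measure_cylinderAt_inter (List.ofFn w) (List.ofFn w') u g
        rw [List.length_ofFn] at this
        rwa [Set.inter_comm]
    _ = (1 - A.bd) ^ g * A.bd⁻¹ * A.wordFreq n p ^ 2 := by
        rw [e, Finset.mul_sum]; simp only [Finset.mul_sum]
    _ ≤ _ := mul_le_of_le_one_right (by have := sub_pos.2 hb1; positivity) hle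

end MarkovSystem

end

noncomputable section

/-! ### A law of large numbers for weakly correlated events -/



/-- The deviation of the number of occurrences of the events `E t`, `t < j`, from `j p`. -/
def deviation {Ω : Type*} (E : ℕ → Set Ω) (p : ℝ) (j : ℕ) (x : Ω) : ℝ :=
  ∑ t ∈ Finset.range j, ((E t).indicator (fun _ => (1 : ℝ)) x - p)

theorem integral_indicator_mul {Ω : Type*} [MeasurableSpace Ω] {μ : Measure Ω} [IsProbabilityMeasure μ] 
    {E F : Set Ω} (hE : MeasurableSet E) (hF : MeasurableSet F) {p : ℝ}
    (hp : μ.real E = p) (hp' : μ.real F = p) :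
    Integrable (fun x => (E.indicator (fun _ => (1 : ℝ)) x - p) *
      (F.indicator (fun _ => (1 : ℝ)) x - p)) μ ∧
    ∫ x, (E.indicator (fun _ => (1 : ℝ)) x - p) * (F.indicator (fun _ => (1 : ℝ)) x - p) ∂μ =
      μ.real (E ∩ F) - p ^ 2 := by
  have e : (fun x => (E.indicator (fun _ => (1 : ℝ)) x - p) *
      (F.indicator (fun _ => (1 : ℝ)) x - p)) = fun x => (E ∩ F).indicator (fun _ => (1 : ℝ)) x
        - p * E.indicator (fun _ => (1 : ℝ)) x - p * F.indicator (fun _ => (1 : ℝ)) x + p ^ 2 := by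
    ext x
    by_cases h1 : x ∈ E <;> by_cases h2 : x ∈ F <;> simp [h1, h2] <;> ring
  have i1 := (integrable_const (μ := μ) (1 : ℝ)).indicator (hE.inter hF)
  have i2 := ((integrable_const (μ := μ) (1 : ℝ)).indicator hE).const_mul p
  have i3 := ((integrable_const (μ := μ) (1 : ℝ)).indicator hF).const_mul p
  rw [e]
  refine ⟨((i1.sub i2).sub i3).add (integrable_const _), ?_⟩
  refine (integral_add ((i1.sub i2).sub i3) (integrable_const _)).trans ?_
  rw [integral_sub' (i1.sub i2) i3, integral_sub' i1 i2, integral_const_mul, integral_const_mul,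
    integral_indicator_const _ (hE.inter hF), integral_indicator_const _ hE,
    integral_indicator_const _ hF, hp, hp']
  simp
  ring

theorem sq_deviation {Ω : Type*} (E : ℕ → Set Ω) (p : ℝ) (j : ℕ) (x : Ω) :
    deviation E p j x ^ 2 = ∑ s ∈ Finset.range j, ∑ t ∈ Finset.range j,
      ((E s).indicator (fun _ => (1 : ℝ)) x - p) * ((E t).indicator (fun _ => (1 : ℝ)) x - p) := by
  rw [sq, deviation, Finset.sum_mul_sum]

theorem integrable_sq_deviation {Ω : Type*} [MeasurableSpace Ω] {μ : Measure Ω} [IsProbabilityMeasure μ] 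
    {E : ℕ → Set Ω} (hE : ∀ t, MeasurableSet (E t)) {p : ℝ}
    (hp : ∀ t, μ.real (E t) = p) (j : ℕ) : Integrable (fun x => deviation E p j x ^ 2) μ := by
  simp only [sq_deviation]
  exact integrable_finsetSum _ fun s _ => integrable_finsetSum _ fun t _ =>
    (integral_indicator_mul (hE s) (hE t) (hp s) (hp t)).1

/-- The square is expanded into covariances. For fixed `s`, those with `t ≤ s` and those with `t >
s` each sum to at most `C`, whence the variance grows only linearly. -/
theorem integral_sq_deviation_le {Ω : Type*} [MeasurableSpace Ω] {μ : Measure Ω} [IsProbabilityMeasure μ] 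
    {E : ℕ → Set Ω} (hE : ∀ t, MeasurableSet (E t)) {p : ℝ}
    (hp : ∀ t, μ.real (E t) = p) {c : ℕ → ℝ} (hc : ∀ d, 0 ≤ c d)
    (hcov : ∀ s d, |μ.real (E s ∩ E (s + d)) - p ^ 2| ≤ c d) {C : ℝ}
    (hC : ∀ j, ∑ d ∈ Finset.range j, c d ≤ C) (j : ℕ) :
    ∫ x, deviation E p j x ^ 2 ∂μ ≤ 2 * C * j := by
  simp only [sq_deviation]
  rw [integral_finsetSum _ fun s _ => integrable_finsetSum _ fun t _ =>
    (integral_indicator_mul (hE s) (hE t) (hp s) (hp t)).1]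
  have : ∀ s ∈ Finset.range j, ∫ x, ∑ t ∈ Finset.range j,
      ((E s).indicator (fun _ => (1 : ℝ)) x - p) * ((E t).indicator (fun _ => (1 : ℝ)) x - p) ∂μ
      ≤ 2 * C := by
    intro s hs
    rw [integral_finsetSum _ fun t _ => (integral_indicator_mul (hE s) (hE t) (hp s) (hp t)).1]
    simp only [(integral_indicator_mul (hE s) (hE _) (hp s) (hp _)).2]
    have hs' : s + 1 ≤ j := Finset.mem_range.1 hs
    rw [← Finset.sum_range_add_sum_Ico _ hs']
    have h1 : ∑ t ∈ Finset.range (s + 1), (μ.real (E s ∩ E t) - p ^ 2) ≤ C := by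
      rw [← Finset.sum_range_reflect]
      refine le_trans (Finset.sum_le_sum fun i hi => ?_) (hC (s + 1))
      have hi := Finset.mem_range.1 hi
      have := hcov (s + 1 - 1 - i) i
      rw [Set.inter_comm]
      rw [show s + 1 - 1 - i + i = s by omega] at this
      exact (le_abs_self _).trans this
    have h2 : ∑ t ∈ Finset.Ico (s + 1) j, (μ.real (E s ∩ E t) - p ^ 2) ≤ C := by
      rw [Finset.sum_Ico_eq_sum_range]
      have : ∑ i ∈ Finset.range (j - (s + 1)), (μ.real (E s ∩ E (s + 1 + i)) - p ^ 2) ≤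
          ∑ i ∈ Finset.range (j - (s + 1)), c (i + 1) := by
        refine Finset.sum_le_sum fun i _ => ?_
        have := hcov s (i + 1)
        rw [show s + (i + 1) = s + 1 + i by ring] at this
        exact (le_abs_self _).trans this
      refine this.trans ?_
      have h := hC (j - (s + 1) + 1)
      rw [Finset.sum_range_succ'] at h
      linarith [hc 0]
    linarith
  refine (Finset.sum_le_sum this).trans ?_
  simp [mul_comm]

theorem deviation_add_le {Ω : Type*} (E : ℕ → Set Ω) {p : ℝ} (hp0 : 0 ≤ p) (hp1 : p ≤ 1) (i d : ℕ) (x : Ω) :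
    |deviation E p (i + d) x| ≤ |deviation E p i x| + d := by
  have : deviation E p (i + d) x = deviation E p i x + ∑ t ∈ Finset.range d,
      ((E (i + t)).indicator (fun _ => (1 : ℝ)) x - p) := by
    rw [deviation, Finset.sum_range_add]; rfl
  rw [this]
  refine (abs_add_le _ _).trans (add_le_add_right ?_ _)
  refine (Finset.abs_sum_le_sum_abs _ _).trans ?_
  refine (Finset.sum_le_card_nsmul _ _ 1 fun t _ => ?_).trans (by simp)
  by_cases h : x ∈ E (i + t) <;> simp [h] <;> rw [abs_le] <;> constructor <;> linarith

/-- Chebyshev's inequality is used only at the squares `j = m ^ 2`, where the bounds, of order `1 /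
m ^ 2`, are summable. Between consecutive squares the deviation changes by at most `2 m`. This
controls all `j ≥ K'` at once. -/
theorem law_of_large_numbers {Ω : Type*} [MeasurableSpace Ω] {μ : Measure Ω} [IsProbabilityMeasure μ] 
    {E : ℕ → Set Ω} (hE : ∀ t, MeasurableSet (E t)) {p : ℝ}
    (hp : ∀ t, μ.real (E t) = p) {c : ℕ → ℝ} (hc : ∀ d, 0 ≤ c d)
    (hcov : ∀ s d, |μ.real (E s ∩ E (s + d)) - p ^ 2| ≤ c d) {C : ℝ}
    (hC : ∀ j, ∑ d ∈ Finset.range j, c d ≤ C) {δ ρ : ℝ} (hδ : 0 < δ) (hρ : 0 < ρ) :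
    ∃ K : ℕ, ∀ K' ≥ K, μ.real {x | ∃ j ≥ K', δ * j < |deviation E p j x|} ≤ ρ := by
  have hp0 : 0 ≤ p := by rw [← hp 0]; exact measureReal_nonneg
  have hp1 : p ≤ 1 := by rw [← hp 0]; exact measureReal_le_one
  have hC0 : 0 ≤ C := by simpa using hC 0
  let B : ℕ → Set Ω := fun m => {x | (δ / 2 * (m ^ 2 : ℕ)) ^ 2 ≤ deviation E p (m ^ 2) x ^ 2}
  let f : ℕ → ℝ := fun m => 8 * C / δ ^ 2 * (1 / (m : ℝ) ^ 2)
  have hf0 : ∀ m, 0 ≤ f m := fun m => by positivity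
  have hfs : Summable f := (Real.summable_one_div_nat_pow.2 one_lt_two).mul_left _
  have hB : ∀ m ≥ 1, μ.real (B m) ≤ f m := by
    intro m hm
    have hm' : (0 : ℝ) < m := by exact_mod_cast hm
    have ha : 0 < (δ / 2 * (m ^ 2 : ℕ)) ^ 2 := by positivity
    have h1 := mul_meas_ge_le_integral_of_nonneg (μ := μ) (ae_of_all _ fun x => sq_nonneg _)
      (integrable_sq_deviation hE hp (m ^ 2)) ((δ / 2 * (m ^ 2 : ℕ)) ^ 2)
    have h2 := h1.trans (integral_sq_deviation_le hE hp hc hcov hC (m ^ 2))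
    rw [mul_comm, ← le_div_iff₀ ha] at h2
    refine h2.trans (le_of_eq ?_)
    simp only [f]; push_cast
    field_simp
    ring
  have htail := tendsto_sum_nat_add f
  obtain ⟨M₁, hM₁⟩ := eventually_atTop.1 (htail.eventually_lt_const hρ)
  obtain ⟨M₀, hM₀⟩ := exists_nat_gt (8 / δ)
  -- `M₀ > 8 / δ` makes the change `2 m` between squares smaller than half of `δ m ^ 2`; `M₁` makes
  -- the tail of the series smaller than `ρ`.
  set M := max (max M₀ M₁) 1 with hM
  refine ⟨M ^ 2, fun K hK => ?_⟩
  have hsub : {x | ∃ j ≥ K, δ * j < |deviation E p j x|} ⊆ ⋃ i, B (i + M) := by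
    rintro x ⟨j, hj, hx⟩
    set m := Nat.sqrt j with hm
    have hmj : m ^ 2 ≤ j := by rw [sq]; exact Nat.sqrt_le j
    have hjm : j < (m + 1) ^ 2 := by rw [sq]; exact Nat.lt_succ_sqrt j
    have hmM : M ≤ m := Nat.le_sqrt'.2 (hK.trans hj)
    rw [Set.mem_iUnion]
    refine ⟨m - M, ?_⟩
    rw [Nat.sub_add_cancel hmM]
    have hd := deviation_add_le E hp0 hp1 (m ^ 2) (j - m ^ 2) x
    rw [Nat.add_sub_cancel' hmj] at hd
    have hd2 : ((j - m ^ 2 : ℕ) : ℝ) ≤ 2 * m := by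
      have : j - m ^ 2 ≤ 2 * m := by
        have : (m + 1) ^ 2 = m ^ 2 + 2 * m + 1 := by ring
        omega
      exact_mod_cast this
    have hM₀m : M₀ ≤ m := by omega
    have hm8 : 8 / δ ≤ m := hM₀.le.trans (Nat.cast_le.2 hM₀m)
    rw [div_le_iff₀ hδ] at hm8
    have hmj' : (m : ℝ) ^ 2 ≤ j := by exact_mod_cast hmj
    have hm0 : (0 : ℝ) ≤ m := by positivity
    show (δ / 2 * (m ^ 2 : ℕ)) ^ 2 ≤ deviation E p (m ^ 2) x ^ 2
    rw [← sq_abs (deviation E p (m ^ 2) x)]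
    refine pow_le_pow_left₀ (by positivity) ?_ 2
    push_cast
    nlinarith
  have h1 : μ.real (⋃ i, B (i + M)) ≤ ∑' i, f (i + M) := by
    have hs : Summable fun i => f (i + M) := (summable_nat_add_iff M).2 hfs
    rw [measureReal_def]
    refine ENNReal.toReal_le_of_le_ofReal (tsum_nonneg fun i => hf0 _) ?_
    refine (measure_iUnion_le _).trans ?_
    rw [ENNReal.ofReal_tsum_of_nonneg (fun i => hf0 _) hs]
    refine ENNReal.tsum_le_tsum fun i => ?_
    rw [← ofReal_measureReal]
    exact ENNReal.ofReal_le_ofReal (hB _ (by omega))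
  exact (measureReal_mono hsub).trans (h1.trans (hM₁ M ((le_max_right _ _).trans (le_max_left _ _))).le)


/-! ### Frequencies of words -/

namespace MarkovSystem

variable {k : ℕ} (A : MarkovSystem k)

open Classical in
/-- The number of positions `u + t`, `t < j`, at which a word with the property `p` starts. -/
def occurrences (p : List (Fin (k + 1)) → Prop) (n : ℕ) (x : ℤ → Fin (k + 1)) (u : ℤ) (j : ℕ) : ℕ :=
  ((Finset.range j).filter fun t => p (wordFrom x (u + (t : ℕ)) n)).card

/-- Frequencies of words in all long intervals that end at the origin. -/
theorem frequencies (p : List (Fin (k + 1)) → Prop) (n : ℕ) {δ ρ : ℝ} (hδ : 0 < δ) (hρ : 0 < ρ) :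
    ∃ K : ℕ, ∀ K' ≥ K, A.measure.real {x | ∃ j ≥ K',
      δ * j < |(occurrences p n x 0 j : ℝ) - j * A.wordFreq n p| ∨
      δ * j < |(occurrences p n x (-j) j : ℝ) - j * A.wordFreq n p|} ≤ ρ := by
  classical
  have hb := A.bd_pos
  have hb1 := sub_pos.2 A.bd_lt_one
  -- Occurrences at distance less than `n` overlap, and there the trivial bound `1` is used; beyond,
  -- the covariance decays exponentially in the gap `d - n`.
  let c : ℕ → ℝ := fun d => if d < n then 1 else (1 - A.bd) ^ (d - n) * A.bd⁻¹
  have hc : ∀ d, 0 ≤ c d := fun d => by simp only [c]; split_ifs <;> positivity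
  have hC : ∀ j, ∑ d ∈ Finset.range j, c d ≤ n + A.bd⁻¹ * A.bd⁻¹ := by
    intro j
    have h1 : ∑ d ∈ Finset.range j, c d ≤ ∑ d ∈ Finset.range (n + j), c d :=
      Finset.sum_le_sum_of_subset_of_nonneg (Finset.range_mono (by omega)) fun d _ _ => hc d
    refine h1.trans ?_
    rw [Finset.sum_range_add]
    refine add_le_add ?_ ?_
    · rw [Finset.sum_congr rfl (g := fun _ => (1 : ℝ)) fun d hd => by
        simp only [c, if_pos (Finset.mem_range.1 hd)]]
      simp
    · rw [Finset.sum_congr rfl (g := fun i => (1 - A.bd) ^ i * A.bd⁻¹) fun d hd => by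
        simp [c], ← Finset.sum_mul]
      refine mul_le_mul_of_nonneg_right ?_ (by positivity)
      have := geom_sum_eq (x := 1 - A.bd) (by linarith) j
      rw [this, show (1 - A.bd) - 1 = -A.bd by ring, div_neg, ← neg_div, neg_sub, inv_eq_one_div]
      gcongr
      have := pow_pos hb1 j
      linarith
  have hmain : ∀ e : ℕ → ℤ, (∀ s d, e (s + d) = e s + d ∨ e s = e (s + d) + d) →
      ∃ K : ℕ, ∀ K' ≥ K, A.measure.real {x | ∃ j ≥ K', δ * j <
        |deviation (fun t => {x | p (wordFrom x (e t) n)}) (A.wordFreq n p) j x|} ≤ ρ / 2 := by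
    intro e he
    refine law_of_large_numbers (fun t => measurableSet_wordFrom p _ n)
      (fun t => A.measure_wordFrom p _ n) hc ?_ hC hδ (by positivity)
    intro s d
    simp only [c]
    split_ifs with hd
    · have h1 := A.wordFreq_nonneg n p
      have h2 := A.wordFreq_le_one n p
      have h3 : A.measure.real ({x | p (wordFrom x (e s) n)} ∩ {x | p (wordFrom x (e (s + d)) n)}) ≤ 1 :=
        measureReal_le_one
      have h4 : 0 ≤ A.measure.real ({x | p (wordFrom x (e s) n)} ∩ {x | p (wordFrom x (e (s + d)) n)}) :=
        measureReal_nonneg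
      rw [abs_le]; constructor <;> nlinarith
    · rcases he s d with h | h
      · have := A.cov_wordFrom p n (e s) (d - n)
        rwa [show e s + n + ((d - n : ℕ) : ℤ) = e (s + d) by rw [h]; omega] at this
      · have := A.cov_wordFrom p n (e (s + d)) (d - n)
        rwa [show e (s + d) + n + ((d - n : ℕ) : ℤ) = e s by rw [h]; omega, Set.inter_comm] at this
  obtain ⟨K₁, h1⟩ := hmain (fun t => t) (fun s d => Or.inl (by push_cast; ring))
  -- To the left of the origin the positions are enumerated backwards from `-1`, so that the first
  -- `j` of them form the interval `[-j, -1]`.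
  obtain ⟨K₂, h2⟩ := hmain (fun t => -t - 1) (fun s d => Or.inr (by push_cast; ring))
  refine ⟨max K₁ K₂, fun K' hK' => ?_⟩
  have hd1 : ∀ x j, deviation (fun t : ℕ => {x | p (wordFrom x (t : ℤ) n)}) (A.wordFreq n p) j x =
      (occurrences p n x 0 j : ℝ) - j * A.wordFreq n p := by
    intro x j
    simp only [deviation, Finset.sum_sub_distrib, occurrences, Finset.card_filter, zero_add,
      Set.indicator_apply, Set.mem_ofPred_eq]
    simp
  have hd2 : ∀ x j, deviation (fun t : ℕ => {x | p (wordFrom x (-(t : ℤ) - 1) n)}) (A.wordFreq n p) j x =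
      (occurrences p n x (-j) j : ℝ) - j * A.wordFreq n p := by
    intro x j
    simp only [deviation, Finset.sum_sub_distrib, occurrences, Finset.card_filter,
      Set.indicator_apply, Set.mem_ofPred_eq]
    rw [← Finset.sum_range_reflect]
    simp only [Finset.sum_const, Finset.card_range, nsmul_eq_mul, Nat.cast_sum, Nat.cast_ite,
      Nat.cast_one, Nat.cast_zero]
    congr 1
    refine Finset.sum_congr rfl fun t ht => ?_
    have := Finset.mem_range.1 ht
    rw [show -((j - 1 - t : ℕ) : ℤ) - 1 = -(j : ℤ) + t by omega]
  have hsub : {x | ∃ j ≥ K',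
      δ * j < |(occurrences p n x 0 j : ℝ) - j * A.wordFreq n p| ∨
      δ * j < |(occurrences p n x (-j) j : ℝ) - j * A.wordFreq n p|} ⊆
      {x | ∃ j ≥ K', δ * j <
        |deviation (fun t : ℕ => {x | p (wordFrom x (t : ℤ) n)}) (A.wordFreq n p) j x|} ∪
      {x | ∃ j ≥ K', δ * j <
        |deviation (fun t : ℕ => {x | p (wordFrom x (-(t : ℤ) - 1) n)}) (A.wordFreq n p) j x|} := by
    rintro x ⟨j, hj, h | h⟩
    · exact Or.inl ⟨j, hj, by rwa [hd1]⟩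
    · exact Or.inr ⟨j, hj, by rwa [hd2]⟩
  refine (measureReal_mono hsub).trans ((measureReal_union_le _ _).trans ?_)
  have := h1 K' ((le_max_left _ _).trans hK')
  have := h2 K' ((le_max_right _ _).trans hK')
  linarith

end MarkovSystem

end

noncomputable section

/-! ### Parts of a pattern of zeros -/

/-- The interval `[lo, hi]` is delimited by maximal blocks of at least `m` zeros of the pattern
`z`; its core `[c, d]` begins and ends outside `z` and has no `m` consecutive zeros. -/
structure IsPart (m : ℕ) (z : ℤ → Prop) (lo c d hi : ℤ) : Prop where
  lo_le : lo + m ≤ c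
  c_le : c ≤ d
  le_hi : d + m ≤ hi
  left : ∀ i, lo ≤ i → i < c → z i
  not_c : ¬ z c
  right : ∀ i, d < i → i ≤ hi → z i
  not_d : ¬ z d
  not_lo : ¬ z (lo - 1)
  not_hi : ¬ z (hi + 1)
  no_run : ∀ i, c ≤ i → i + m ≤ d + 1 → ∃ j, i ≤ j ∧ j < i + m ∧ ¬ z j

namespace IsPart

variable {m : ℕ} {z : ℤ → Prop} {lo c d hi lo' c' d' hi' : ℤ}

/-- A run of at least `m` zeros that meets the core cannot contain its end points, which are not
zeros. It would therefore lie inside the core, where no such run exists. -/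
theorem le_core (h : IsPart m z lo c d hi) {s e : ℤ} (hse : s + m ≤ e)
    (hz : ∀ i, s ≤ i → i < e → z i) {t : ℤ} (h1 : s ≤ t) (h2 : t < e) : t < c ∨ d < t := by
  by_contra! hc
  have hcs : c < s := by
    by_contra! hcs
    exact h.not_c (hz c hcs (by omega))
  have hde : e ≤ d := by
    by_contra! hde
    exact h.not_d (hz d (by omega) hde)
  obtain ⟨j, hj1, hj2, hj3⟩ := h.no_run s hcs.le (by omega)
  exact hj3 (hz j hj1 (by omega))

theorem mem_core (h : IsPart m z lo c d hi) (h' : IsPart m z lo' c' d' hi') {t : ℤ}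
    (h1 : c ≤ t) (h2 : t ≤ d) (h3 : lo' ≤ t) (h4 : t ≤ hi') : c' ≤ t ∧ t ≤ d' := by
  constructor
  · by_contra! hc
    have := h.le_core h'.lo_le h'.left h3 hc
    omega
  · by_contra! hc
    have := h.le_core (s := d' + 1) (e := hi' + 1) (by have := h'.le_hi; omega)
      (fun i h1 h2 => h'.right i (by omega) (by omega)) (t := t) (by omega) (by omega)
    omega

theorem pos (h : IsPart m z lo c d hi) : 1 ≤ m := by
  by_contra! hm
  obtain ⟨j, h1, h2, -⟩ := h.no_run c le_rfl (by have := h.c_le; omega)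
  omega

theorem core_le (h : IsPart m z lo c d hi) (h' : IsPart m z lo' c' d' hi') {t : ℤ}
    (h1 : c ≤ t) (h2 : t ≤ d) (h3 : c' ≤ t) (h4 : t ≤ d') : c' ≤ c ∧ d ≤ d' := by
  constructor
  · by_contra! hc
    have := h'.lo_le
    have := h.pos
    have := h.le_core h'.lo_le h'.left (t := c' - 1) (by omega) (by omega)
    omega
  · by_contra! hc
    have := h'.le_hi
    have := h.pos
    have := h.le_core (s := d' + 1) (e := hi' + 1) (by have := h'.le_hi; omega)
      (fun i h1 h2 => h'.right i (by omega) (by omega)) (t := d' + 1) (by omega) (by omega)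
    omega

/-- A part is determined by any point of its core. -/
theorem unique (h : IsPart m z lo c d hi) (h' : IsPart m z lo' c' d' hi') {t : ℤ}
    (h1 : c ≤ t) (h2 : t ≤ d) (h3 : lo' ≤ t) (h4 : t ≤ hi') :
    lo = lo' ∧ c = c' ∧ d = d' ∧ hi = hi' := by
  have hm := h.pos
  obtain ⟨h5, h6⟩ := h.mem_core h' h1 h2 h3 h4
  have a := h.core_le h' h1 h2 h5 h6
  have b := h'.core_le h h5 h6 h1 h2
  have hc : c = c' := by omega
  have hd : d = d' := by omega
  refine ⟨?_, hc, hd, ?_⟩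
  · rcases lt_trichotomy lo lo' with hl | hl | hl
    · exact absurd (h.left (lo' - 1) (by omega) (by have := h'.lo_le; omega)) h'.not_lo
    · exact hl
    · exact absurd (h'.left (lo - 1) (by omega) (by have := h.lo_le; omega)) h.not_lo
  · rcases lt_trichotomy hi hi' with hl | hl | hl
    · exact absurd (h'.right (hi + 1) (by have := h.le_hi; omega) (by omega)) h.not_hi
    · exact hl
    · exact absurd (h.right (hi' + 1) (by have := h'.le_hi; omega) (by omega)) h'.not_hi

theorem congr {z' : ℤ → Prop} (hz : ∀ i, lo - 1 ≤ i → i ≤ hi + 1 → (z i ↔ z' i))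
    (h : IsPart m z lo c d hi) : IsPart m z' lo c d hi := by
  have h1 := h.lo_le
  have h2 := h.c_le
  have h3 := h.le_hi
  refine ⟨h1, h2, h3, fun i a b => ?_, ?_, fun i a b => ?_, ?_, ?_, ?_, fun i a b => ?_⟩
  · exact (hz i (by omega) (by omega)).1 (h.left i a b)
  · exact mt (hz _ (by omega) (by omega)).2 h.not_c
  · exact (hz i (by omega) (by omega)).1 (h.right i a b)
  · exact mt (hz _ (by omega) (by omega)).2 h.not_d
  · exact mt (hz _ (by omega) (by omega)).2 h.not_lo
  · exact mt (hz _ (by omega) (by omega)).2 h.not_hi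
  · obtain ⟨j, e1, e2, e3⟩ := h.no_run i a b
    exact ⟨j, e1, e2, mt (hz _ (by omega) (by omega)).2 e3⟩

theorem shift (s : ℤ) (h : IsPart m (fun i => z (i + s)) lo c d hi) :
    IsPart m z (lo + s) (c + s) (d + s) (hi + s) := by
  refine ⟨by linarith [h.lo_le], by linarith [h.c_le], by linarith [h.le_hi], fun i a b => ?_,
    h.not_c, fun i a b => ?_, h.not_d, ?_, ?_, fun i a b => ?_⟩
  · simpa using h.left (i - s) (by omega) (by omega)
  · simpa using h.right (i - s) (by omega) (by omega)
  · have := h.not_lo; rwa [show lo - 1 + s = lo + s - 1 by ring] at this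
  · have := h.not_hi; rwa [show hi + 1 + s = hi + s + 1 by ring] at this
  · obtain ⟨j, e1, e2, e3⟩ := h.no_run (i - s) (by omega) (by omega)
    exact ⟨j + s, by omega, by omega, e3⟩

end IsPart

/-- The position `i` carries a `0` of `x` that is not isolated. -/
def IsBlockZero {k : ℕ} (x : ℤ → Fin (k + 1)) (i : ℤ) : Prop :=
  x i = 0 ∧ (x (i - 1) = 0 ∨ x (i + 1) = 0)

theorem mem_blockZeros {k : ℕ} {x : ℤ → Fin (k + 1)} {lo hi i : ℤ} :
    i ∈ blockZeros x lo hi ↔ (lo ≤ i ∧ i ≤ hi) ∧ IsBlockZero x i := by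
  simp [blockZeros, IsBlockZero]

/-- For `m ≥ 2` the zeros of a block of length `m` are not isolated, so the blanking of isolated
zeros neither destroys nor creates a run that matters. -/
theorem isPart_blockZero_iff {k m : ℕ} (hm : 2 ≤ m) {x : ℤ → Fin (k + 1)} {lo c d hi : ℤ} :
    IsPart m (IsBlockZero x) lo c d hi ↔ IsPart m (fun i => x i = 0) lo c d hi := by
  constructor
  · intro h
    have hl := h.lo_le
    have hh := h.le_hi
    have nb : ∀ i, ¬ IsBlockZero x i → (x (i - 1) = 0 ∨ x (i + 1) = 0) → x i ≠ 0 :=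
      fun i h1 h2 h3 => h1 ⟨h3, h2⟩
    refine ⟨h.lo_le, h.c_le, h.le_hi, fun i a b => (h.left i a b).1, ?_,
      fun i a b => (h.right i a b).1, ?_, ?_, ?_, fun i a b => ?_⟩
    · exact nb _ h.not_c (Or.inl (h.left _ (by omega) (by omega)).1)
    · exact nb _ h.not_d (Or.inr (h.right _ (by omega) (by omega)).1)
    · exact nb _ h.not_lo (Or.inr (by simpa using (h.left lo (by omega) (by omega)).1))
    · exact nb _ h.not_hi (Or.inl (by simpa using (h.right hi (by omega) (by omega)).1))
    · by_contra! hc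
      obtain ⟨j, e1, e2, e3⟩ := h.no_run i a b
      refine e3 ⟨hc j e1 e2, ?_⟩
      by_cases hj : j = i
      · exact Or.inr (hc _ (by omega) (by omega))
      · exact Or.inl (hc _ (by omega) (by omega))
  · intro h
    have hl := h.lo_le
    have hh := h.le_hi
    refine ⟨h.lo_le, h.c_le, h.le_hi, fun i a b => ⟨h.left i a b, ?_⟩, fun e => h.not_c e.1,
      fun i a b => ⟨h.right i a b, ?_⟩, fun e => h.not_d e.1, fun e => h.not_lo e.1,
      fun e => h.not_hi e.1, fun i a b => ?_⟩
    · by_cases hi' : i = lo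
      · exact Or.inr (h.left _ (by omega) (by omega))
      · exact Or.inl (h.left _ (by omega) (by omega))
    · by_cases hi' : i = hi
      · exact Or.inl (h.right _ (by omega) (by omega))
      · exact Or.inr (h.right _ (by omega) (by omega))
    · obtain ⟨j, e1, e2, e3⟩ := h.no_run i a b
      exact ⟨j, e1, e2, fun e => e3 e.1⟩

namespace Skeleton

theorem hasForm_iff {m : ℕ} {S : Skeleton} (hS : S.zeros ⊆ S.window) :
    S.HasForm m ↔ ∃ c d, IsPart m (· ∈ S.zeros) S.lo c d S.hi := by
  have hlo : S.lo - 1 ∉ S.zeros := fun h => by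
    have := Finset.mem_Icc.1 (hS h); omega
  have hhi : S.hi + 1 ∉ S.zeros := fun h => by
    have := Finset.mem_Icc.1 (hS h); omega
  constructor
  · rintro ⟨-, c, d, h1, h2, h3, h4, h5, h6, h7, h8⟩
    refine ⟨c, d, h2, h1, h3, fun i a b => h4 (by simp [a, b]), h5, fun i a b => h6 (by simp [a, b]),
      h7, hlo, hhi, fun i a b => ?_⟩
    have := h8 i a b
    rw [Finset.not_subset] at this
    obtain ⟨j, e1, e2⟩ := this
    rw [Finset.mem_Ico] at e1
    exact ⟨j, e1.1, e1.2, e2⟩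
  · rintro ⟨c, d, h⟩
    refine ⟨hS, c, d, h.c_le, h.lo_le, h.le_hi, fun i hi => ?_, h.not_c, fun i hi => ?_, h.not_d,
      fun i a b => ?_⟩
    · rw [Finset.mem_Ico] at hi; exact h.left i hi.1 hi.2
    · rw [Finset.mem_Ioc] at hi; exact h.right i hi.1 hi.2
    · rw [Finset.not_subset]
      obtain ⟨j, e1, e2, e3⟩ := h.no_run i a b
      exact ⟨j, by simp [e1, e2], e3⟩

theorem restrict_zeros_subset (S : Skeleton) (u v : ℤ) :
    (S.restrict u v).zeros ⊆ (S.restrict u v).window := Finset.inter_subset_right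

/-- Passing to the restricted pattern removes the zeros outside the interval; the two maximality
conditions in `parts` restore the information at its neighbours. -/
theorem mem_parts_iff {m : ℕ} {S : Skeleton} {p : ℤ × ℤ} :
    p ∈ S.parts m ↔ (p.1 ∈ S.window ∧ p.2 ∈ S.window) ∧
      ∃ c d, IsPart m (· ∈ S.zeros) p.1 c d p.2 := by
  simp only [parts, Finset.mem_filter, Finset.mem_product,
    hasForm_iff (restrict_zeros_subset _ _ _)]
  refine and_congr_right fun _ => ?_
  constructor
  · rintro ⟨⟨c, d, h⟩, h1, h2⟩
    refine ⟨c, d, ?_⟩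
    have hl := h.lo_le
    have hc := h.c_le
    have hh := h.le_hi
    have hmem : ∀ i, p.1 ≤ i → i ≤ p.2 → (i ∈ (S.restrict p.1 p.2).zeros ↔ i ∈ S.zeros) := by
      intro i a b; simp [restrict, a, b]
    simp only [restrict] at hl hc hh
    refine ⟨hl, hc, hh, fun i a b => ?_, ?_, fun i a b => ?_, ?_, h1, h2, fun i a b => ?_⟩
    · exact (hmem i (by omega) (by omega)).1 (h.left i a b)
    · exact mt (hmem _ (by omega) (by omega)).2 h.not_c
    · exact (hmem i (by omega) (by omega)).1 (h.right i a b)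
    · exact mt (hmem _ (by omega) (by omega)).2 h.not_d
    · obtain ⟨j, e1, e2, e3⟩ := h.no_run i a b
      exact ⟨j, e1, e2, mt (hmem _ (by omega) (by omega)).2 e3⟩
  · rintro ⟨c, d, h⟩
    refine ⟨⟨c, d, ?_⟩, h.not_lo, h.not_hi⟩
    refine h.congr fun i a b => ?_
    change p.1 - 1 ≤ i at a
    change i ≤ p.2 + 1 at b
    simp only [restrict, Finset.mem_inter, Finset.mem_Icc]
    constructor
    · intro hi
      refine ⟨hi, ?_, ?_⟩
      · rcases a.eq_or_lt with e | e
        · exact absurd (e ▸ hi) h.not_lo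
        · omega
      · rcases b.eq_or_lt with e | e
        · exact absurd (e ▸ hi) h.not_hi
        · omega
    · exact fun h => h.1

theorem size_eq {S : Skeleton} (hS : S.zeros ⊆ S.window) : S.size = S.window.card := by
  rw [size, length, blanks]
  exact Finset.card_sdiff_add_card_eq_card hS

theorem card_window (S : Skeleton) (h : S.lo ≤ S.hi + 1) :
    (S.window.card : ℤ) = S.hi + 1 - S.lo := by
  rw [window, Int.card_Icc]; omega

end Skeleton

theorem blockZeros_subset {k : ℕ} (x : ℤ → Fin (k + 1)) (lo hi : ℤ) :
    blockZeros x lo hi ⊆ Finset.Icc lo hi := Finset.filter_subset _ _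

/-- The pattern on `[lo, hi]` has no zeros outside. That is harmless at the outer neighbours `lo -
1` and `hi + 1`, because they carry nonzero symbols. -/
theorem isPart_blockZeros_iff {k m : ℕ} (hm : 2 ≤ m) {x : ℤ → Fin (k + 1)} {lo hi lo' c d hi' : ℤ}
    (h1 : lo ≤ lo') (h2 : hi' ≤ hi) (h3 : x (lo - 1) ≠ 0) (h4 : x (hi + 1) ≠ 0) :
    IsPart m (· ∈ blockZeros x lo hi) lo' c d hi' ↔ IsPart m (fun i => x i = 0) lo' c d hi' := by
  rw [← isPart_blockZero_iff hm]
  have : ∀ i, lo' - 1 ≤ i → i ≤ hi' + 1 → (i ∈ blockZeros x lo hi ↔ IsBlockZero x i) := by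
    intro i a b
    rw [mem_blockZeros]
    refine ⟨fun h => h.2, fun h => ⟨⟨?_, ?_⟩, h⟩⟩
    · by_contra! hc
      exact h3 (by rw [show lo - 1 = i by omega]; exact h.1)
    · by_contra! hc
      exact h4 (by rw [show hi + 1 = i by omega]; exact h.1)
  exact ⟨fun h => h.congr this, fun h => h.congr fun i a b => (this i a b).symm⟩

theorem isSkeletonAt_iff {k m : ℕ} (hm : 2 ≤ m) {x : ℤ → Fin (k + 1)} {i : ℤ} {S : Skeleton} :
    IsSkeletonAt m x i S ↔ S.lo ≤ i ∧ i ≤ S.hi ∧ S.zeros = blockZeros x S.lo S.hi ∧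
      ∃ c d, IsPart m (fun i => x i = 0) S.lo c d S.hi := by
  unfold IsSkeletonAt
  refine and_congr_right fun _ => and_congr_right fun _ => and_congr_right fun hz => ?_
  have hs : S.zeros ⊆ S.window := by rw [hz]; exact blockZeros_subset _ _ _
  rw [Skeleton.hasForm_iff hs, hz]
  constructor
  · rintro ⟨⟨c, d, h⟩, h1, h2⟩
    exact ⟨c, d, (isPart_blockZeros_iff hm le_rfl le_rfl h1 h2).1 h⟩
  · rintro ⟨c, d, h⟩
    exact ⟨⟨c, d, (isPart_blockZeros_iff hm le_rfl le_rfl h.not_lo h.not_hi).2 h⟩, h.not_lo,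
      h.not_hi⟩

end

noncomputable section

/-! ### Initial segments and approximate probabilities -/

theorem firstElems_subset (T : Finset ℤ) (j : ℕ) : firstElems T j ⊆ T := Finset.filter_subset _ _

theorem firstElems_zero (T : Finset ℤ) : firstElems T 0 = ∅ := by simp [firstElems]

theorem firstElems_card (T : Finset ℤ) : firstElems T T.card = T := by
  refine Finset.filter_true_of_mem fun i hi => Finset.card_lt_card ?_
  exact Finset.filter_ssubset.2 ⟨i, hi, lt_irrefl i⟩

theorem firstElems_succ_subset (T : Finset ℤ) (j : ℕ) :
    ∃ i, firstElems T (j + 1) ⊆ insert i (firstElems T j) := by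
  by_cases h : ∃ i ∈ T, (T.filter (· < i)).card = j
  · obtain ⟨i, hi, hj⟩ := h
    refine ⟨i, fun l hl => ?_⟩
    obtain ⟨h1, h2⟩ := Finset.mem_filter.1 hl
    rw [Finset.mem_insert]
    by_contra! hc
    have h3 : (T.filter (· < l)).card = j := by
      have : ¬ (T.filter (· < l)).card < j := fun h => hc.2 (Finset.mem_filter.2 ⟨h1, h⟩)
      omega
    rcases lt_or_gt_of_ne hc.1 with hlt | hlt
    · have : (T.filter (· < l)).card < (T.filter (· < i)).card := by
        refine Finset.card_lt_card ⟨fun a ha => ?_, fun hs => ?_⟩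
        · rw [Finset.mem_filter] at ha ⊢; exact ⟨ha.1, ha.2.trans hlt⟩
        · have := hs (Finset.mem_filter.2 ⟨h1, hlt⟩)
          exact lt_irrefl _ (Finset.mem_filter.1 this).2
      omega
    · have : (T.filter (· < i)).card < (T.filter (· < l)).card := by
        refine Finset.card_lt_card ⟨fun a ha => ?_, fun hs => ?_⟩
        · rw [Finset.mem_filter] at ha ⊢; exact ⟨ha.1, ha.2.trans hlt⟩
        · have := hs (Finset.mem_filter.2 ⟨hi, hlt⟩)
          exact lt_irrefl _ (Finset.mem_filter.1 this).2
      omega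
  · push Not at h
    refine ⟨0, fun l hl => Finset.mem_insert_of_mem ?_⟩
    obtain ⟨h1, h2⟩ := Finset.mem_filter.1 hl
    exact Finset.mem_filter.2 ⟨h1, by have := h l h1; omega⟩

theorem eps_pos (n : ℕ) : 0 < eps n := by unfold eps; positivity

theorem eps_anti {m n : ℕ} (h : m ≤ n) : eps n ≤ eps m := by
  unfold eps
  exact one_div_le_one_div_of_le (by positivity) (pow_le_pow_right₀ (by norm_num) h)

theorem eps_succ (n : ℕ) : eps (n + 1) = eps n / 2 := by unfold eps; rw [pow_succ]; field_simp

theorem eps_zero : eps 0 = 1 := by simp [eps]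

theorem eps_one : eps 1 = 1 / 2 := by simp [eps]

namespace MarkovSystem

variable {k : ℕ} {A : MarkovSystem k}

open Classical in
theorem sum_wordProb_eq_pr (S : Skeleton) (D : Finset ℤ) (y : ℤ → Fin (k + 1)) :
    ∑ w : Fin (S.hi + 1 - S.lo).toNat → Fin (k + 1) with
      ∀ j : Fin (S.hi + 1 - S.lo).toNat, S.lo + (j : ℕ) ∈ D → w j = y (S.lo + (j : ℕ)),
      A.wordProb (List.ofFn w) = A.pr (D ∩ S.window) y := by
  set n := (S.hi + 1 - S.lo).toNat with hn
  have h := sum_measureReal_preimage_singleton (μ := A.measure)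
    (Finset.univ.filter fun w : Fin n → Fin (k + 1) =>
      ∀ j : Fin n, S.lo + (j : ℕ) ∈ D → w j = y (S.lo + (j : ℕ)))
    (f := fun (x : ℤ → Fin (k + 1)) (j : Fin n) => x (S.lo + (j : ℕ)))
    (fun w _ => measurable_window (k := k) S.lo n (measurableSet_singleton w))
  rw [pr, show agreeOn (D ∩ S.window) y = _ from ?_, ← h]
  · refine Finset.sum_congr rfl fun w _ => ?_
    rw [← A.measureReal_cylinderAt S.lo]
    congr 1
    rw [cylinderAt_eq_wordFrom]
    ext x
    simp only [wordFrom, Set.mem_ofPred_eq, Set.mem_preimage, Set.mem_singleton_iff]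
    rw [← List.ofFn_inj]
    simp [List.ofFn_congr]
  · ext x
    simp only [agreeOn, Set.mem_ofPred_eq, Finset.mem_inter, Skeleton.window, Finset.mem_Icc,
      Set.mem_preimage, Finset.coe_filter, Finset.mem_univ, true_and]
    constructor
    · intro h j hj
      exact h _ ⟨hj, by omega, by have := j.2; omega⟩
    · rintro h i ⟨h1, h2, h3⟩
      have := h ⟨(i - S.lo).toNat, by omega⟩
      rw [show S.lo + ((i - S.lo).toNat : ℤ) = i by omega] at this
      exact this h1

theorem cylApprox_bounds {M : List (Fin (k + 1)) → ℕ → ℚ} (hM : A.IsMachine M) (S : Skeleton)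
    {D : Finset ℤ} (hD : D ⊆ S.window) (y : ℤ → Fin (k + 1)) (n : ℕ) :
    (1 - eps n) * A.pr D y ≤ cylApprox M S D y n ∧
      cylApprox M S D y n ≤ (1 + eps n) * A.pr D y := by
  rw [← Finset.inter_eq_left.2 hD, ← sum_wordProb_eq_pr, Finset.inter_eq_left.2 hD, cylApprox,
    Finset.mul_sum, Finset.mul_sum]
  constructor <;> refine Finset.sum_le_sum fun w _ => ?_
  · have := (abs_le.1 (hM.2 (List.ofFn w) n)).1; linarith
  · have := (abs_le.1 (hM.2 (List.ofFn w) n)).2; linarith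

end MarkovSystem

/-! ### Determined positions -/

section Determined

variable {k : ℕ} {A : MarkovSystem k} {N : ℕ → ℕ} {M : List (Fin (k + 1)) → ℕ → ℚ} {H : ℝ}
  {η : ℕ → ℝ}

/-- The value `j = 0` occurs also when no segment reaches the threshold, so the threshold is known
to be reached only for `j ≠ 0`. -/
theorem determined_one (S : Skeleton) (y : ℤ → Fin (k + 1)) (n : ℕ) :
    ∃ j, determined N M H η 1 S y n = S.zeros ∪ firstElems S.blanks j ∧
      (j ≠ 0 → fillBound H η 1 S.size ≤ cylApprox M S (S.zeros ∪ firstElems S.blanks j) y n) := by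
  classical
  refine ⟨_, rfl, fun h => ?_⟩
  exact Nat.findGreatest_of_ne_zero (P := fun j => fillBound H η 1 S.size ≤
    cylApprox M S (S.zeros ∪ firstElems S.blanks j) y n) rfl h

open Classical in
/-- The positions determined by the parts of the skeleton. -/
def determinedParts (N : ℕ → ℕ) (M : List (Fin (k + 1)) → ℕ → ℚ) (H : ℝ) (η : ℕ → ℝ) (m : ℕ)
    (S : Skeleton) (y : ℤ → Fin (k + 1)) (n : ℕ) : Finset ℤ :=
  (S.parts (N m)).biUnion fun p =>
    determined N M H η m (S.restrict p.1 p.2) y (Nat.clog 2 ((3 * (S.parts (N m)).card) ^ n))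

theorem determined_add_two (m : ℕ) (S : Skeleton) (y : ℤ → Fin (k + 1)) (n : ℕ) :
    ∃ j, determined N M H η (m + 2) S y n = S.zeros ∪ determinedParts N M H η (m + 1) S y n ∪
        firstElems (S.blanks \ determinedParts N M H η (m + 1) S y n) j ∧
      (j ≠ 0 → fillBound H η (m + 2) S.size < cylApprox M S
        (S.zeros ∪ determinedParts N M H η (m + 1) S y n ∪
          firstElems (S.blanks \ determinedParts N M H η (m + 1) S y n) j) y n) ∧
      (j = (S.blanks \ determinedParts N M H η (m + 1) S y n).card ∨
        cylApprox M S (S.zeros ∪ determinedParts N M H η (m + 1) S y n ∪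
          firstElems (S.blanks \ determinedParts N M H η (m + 1) S y n) (j + 1)) y n ≤
          fillBound H η (m + 2) S.size) := by
  classical
  refine ⟨_, rfl, fun h => ?_, ?_⟩
  · exact Nat.findGreatest_of_ne_zero (P := fun j => fillBound H η (m + 2) S.size < cylApprox M S
        (S.zeros ∪ determinedParts N M H η (m + 1) S y n ∪
          firstElems (S.blanks \ determinedParts N M H η (m + 1) S y n) j) y n) rfl h
  · rw [or_iff_not_imp_left]
    intro h
    exact not_lt.1 (Nat.findGreatest_is_greatest (P := fun j => fillBound H η (m + 2) S.size <
      cylApprox M S (S.zeros ∪ determinedParts N M H η (m + 1) S y n ∪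
        firstElems (S.blanks \ determinedParts N M H η (m + 1) S y n) j) y n) (lt_add_one _)
      (lt_of_le_of_ne (Nat.findGreatest_le _) h))

theorem determined_subset_window (m : ℕ) : ∀ {S : Skeleton}, S.zeros ⊆ S.window →
    ∀ (y : ℤ → Fin (k + 1)) (n : ℕ), determined N M H η m S y n ⊆ S.window := by
  induction m with
  | zero => intro S hS y n; exact hS
  | succ m ih =>
    cases m with
    | zero =>
      intro S hS y n
      obtain ⟨j, h, -⟩ := determined_one (N := N) (M := M) (H := H) (η := η) S y n
      rw [h]
      exact Finset.union_subset hS ((firstElems_subset _ _).trans Finset.sdiff_subset)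
    | succ m =>
      intro S hS y n
      obtain ⟨j, h, -⟩ := determined_add_two (N := N) (M := M) (H := H) (η := η) m S y n
      rw [h]
      refine Finset.union_subset (Finset.union_subset hS ?_)
        ((firstElems_subset _ _).trans (Finset.sdiff_subset.trans Finset.sdiff_subset))
      refine Finset.biUnion_subset.2 fun p hp => ?_
      refine (ih (S.restrict_zeros_subset _ _) y _).trans ?_
      have := (Skeleton.mem_parts_iff.1 hp).1
      simp only [Skeleton.window, Skeleton.restrict, Finset.mem_Icc] at this ⊢
      exact Finset.Icc_subset_Icc this.1.1 this.2.2

theorem determinedParts_subset_window (m : ℕ) {S : Skeleton}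
    (y : ℤ → Fin (k + 1)) (n : ℕ) : determinedParts N M H η m S y n ⊆ S.window := by
  refine Finset.biUnion_subset.2 fun p hp => ?_
  refine (determined_subset_window m (S.restrict_zeros_subset _ _) y _).trans ?_
  have := (Skeleton.mem_parts_iff.1 hp).1
  simp only [Skeleton.window, Skeleton.restrict, Finset.mem_Icc] at this ⊢
  exact Finset.Icc_subset_Icc this.1.1 this.2.2

theorem zeros_subset_determined (m : ℕ) (S : Skeleton) (y : ℤ → Fin (k + 1)) (n : ℕ) :
    S.zeros ⊆ determined N M H η m S y n := by
  match m with
  | 0 => exact subset_rfl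
  | 1 =>
    obtain ⟨j, h, -⟩ := determined_one (N := N) (M := M) (H := H) (η := η) S y n
    rw [h]; exact Finset.subset_union_left
  | m + 2 =>
    obtain ⟨j, h, -⟩ := determined_add_two (N := N) (M := M) (H := H) (η := η) m S y n
    rw [h, Finset.union_assoc]; exact Finset.subset_union_left

/-- If the threshold is reached, the probability has the exponential lower bound. -/
theorem le_logb_of_fillBound_le (hM : A.IsMachine M) {S : Skeleton} {D : Finset ℤ}
    (hD : D ⊆ S.window) {y : ℤ → Fin (k + 1)} {m n : ℕ} (hmn : m ≤ n) (hη0 : 0 < η m)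
    (hη1 : η m ≤ 1) (h : fillBound H η m S.size ≤ cylApprox M S D y n) :
    S.size * (eps m - H) ≤ Real.logb 2 (A.pr D y) := by
  rw [Real.le_logb_iff_rpow_le one_lt_two (A.pr_pos D y)]
  have h1 := h.trans (A.cylApprox_bounds hM S hD y n).2
  have hp := A.pr_pos D y
  have e := eps_anti hmn
  have e1 := eps_pos n
  set R : ℝ := 2 ^ ((S.size : ℝ) * (eps m - H)) with hR
  have hR0 : 0 < R := by positivity
  have h2 : (1 + eps n) * R ≤ (1 + eps n) * A.pr D y := by
    refine le_trans ?_ h1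
    rw [fillBound, show -(S.size : ℝ) * (H - eps m) = S.size * (eps m - H) by ring, ← hR]
    gcongr
    rw [le_div_iff₀ hη0]
    nlinarith
  exact le_of_mul_le_mul_left h2 (by linarith)

/-- A skeleton of rank `1` is good if it is in `base`; a skeleton of higher rank is good if all
but a small part of its positions lie in the cores of good skeletons of the preceding rank. -/
def GoodSkeleton (N : ℕ → ℕ) (base : Skeleton → Prop) (e : ℕ → ℕ) : ℕ → Skeleton → Prop
  | 0, _ => True
  | 1, S => base S
  | m + 2, S => ∃ Q : Finset (ℤ × ℤ × ℤ × ℤ),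
      (∀ q ∈ Q, S.lo ≤ q.1 ∧ q.2.2.2 ≤ S.hi ∧
        IsPart (N (m + 1)) (· ∈ S.zeros) q.1 q.2.1 q.2.2.1 q.2.2.2 ∧
        GoodSkeleton N base e (m + 1) (S.restrict q.1 q.2.2.2)) ∧
      (S.window \ Q.biUnion fun q => Finset.Icc q.2.1 q.2.2.1).card * 2 ^ e (m + 2) ≤ S.size

/-- The loss per position outside the good parts. -/
def MarkovSystem.loss (A : MarkovSystem k) (H : ℝ) : ℝ := H - 7 * Real.logb 2 A.bd

/-- By `pr_ge_prod` the bounds for the parts multiply, at the cost of `bd ^ 3` for each part and `bd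
^ 4` for each fixed position outside the cores. Let `o` be the number of all positions outside the
cores. There are at most `o` parts, since their right blocks are non-empty, disjoint and outside all
cores. Neighbouring parts share a block, so their lengths add up to at most `size + o`. Hence each
outside position costs at most `H` bits for the overlap and `7` times `-logb 2 bd`, which is `loss`.
-/
theorem le_logb_pr_of_parts {S : Skeleton} (hS : S.zeros ⊆ S.window)
    {m : ℕ} {Q : Finset (ℤ × ℤ × ℤ × ℤ)}
    (hQ : ∀ q ∈ Q, S.lo ≤ q.1 ∧ q.2.2.2 ≤ S.hi ∧
      IsPart m (· ∈ S.zeros) q.1 q.2.1 q.2.2.1 q.2.2.2)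
    {κ : ℝ} (hκ0 : 0 ≤ κ) (hκ : κ ≤ H) {y : ℤ → Fin (k + 1)} {D : Finset ℤ} (hD : D ⊆ S.window)
    (h : ∀ q ∈ Q, (q.2.2.2 + 1 - q.1 : ℤ) * (κ - H) ≤
      Real.logb 2 (A.pr (D ∩ Finset.Icc q.2.1 q.2.2.1) y)) :
    S.size * (κ - H) - (S.window \ Q.biUnion fun q => Finset.Icc q.2.1 q.2.2.1).card * A.loss H ≤
      Real.logb 2 (A.pr D y) := by
  set O := S.window \ Q.biUnion fun q => Finset.Icc q.2.1 q.2.2.1 with hO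
  have huniq : ∀ q ∈ Q, ∀ q' ∈ Q, ∀ t, q.2.1 ≤ t → t ≤ q.2.2.1 → q'.1 ≤ t → t ≤ q'.2.2.2 →
      q = q' := by
    intro q hq q' hq' t h1 h2 h3 h4
    obtain ⟨a1, a2, a3, a4⟩ := (hQ q hq).2.2.unique (hQ q' hq').2.2 h1 h2 h3 h4
    exact Prod.ext a1 (Prod.ext a2 (Prod.ext a3 a4))
  have hdis : ∀ q ∈ Q, ∀ q' ∈ Q, q ≠ q' →
      Disjoint (Finset.Icc q.2.1 q.2.2.1) (Finset.Icc q'.2.1 q'.2.2.1) := by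
    intro q hq q' hq' hne
    rw [Finset.disjoint_left]
    intro t ht ht'
    rw [Finset.mem_Icc] at ht ht'
    have := (hQ q' hq').2.2.lo_le
    have := (hQ q' hq').2.2.le_hi
    exact hne (huniq q hq q' hq' t ht.1 ht.2 (by omega) (by omega))
  have hprod := A.pr_ge_prod Q (fun q => q.2.1) (fun q => q.2.2.1)
    (fun q hq => (hQ q hq).2.2.c_le) hdis y D
  have hb := A.bd_pos
  have hpp : ∀ q ∈ Q, A.bd ^ 3 * A.pr (D ∩ Finset.Icc q.2.1 q.2.2.1) y ≠ 0 := fun q _ =>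
    (mul_pos (by positivity) (A.pr_pos _ _)).ne'
  have hlog := Real.logb_le_logb_of_le one_lt_two (mul_pos (by positivity)
    (Finset.prod_pos fun q hq => (hpp q hq).symm.lt_of_le
      (mul_nonneg (by positivity) (A.pr_pos _ _).le))) hprod
  rw [Real.logb_mul (by positivity) (Finset.prod_ne_zero_iff.2 hpp), Real.logb_pow, Real.logb_pow,
    Real.logb_prod _ _ hpp] at hlog
  have hsum : ∑ q ∈ Q, (3 * Real.logb 2 A.bd + (q.2.2.2 + 1 - q.1 : ℤ) * (κ - H)) ≤
      ∑ q ∈ Q, Real.logb 2 (A.bd ^ 3 * A.pr (D ∩ Finset.Icc q.2.1 q.2.2.1) y) := by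
    refine Finset.sum_le_sum fun q hq => ?_
    rw [Real.logb_mul (by positivity) (A.pr_pos _ _).ne', Real.logb_pow]
    have := h q hq
    push_cast at this ⊢
    linarith
  -- the left blocks with the cores are disjoint, and so are the right blocks
  have hleft : ∑ q ∈ Q, (Finset.Icc q.1 q.2.2.1).card ≤ S.window.card := by
    rw [← Finset.card_biUnion]
    · refine Finset.card_le_card (Finset.biUnion_subset.2 fun q hq => ?_)
      have := hQ q hq
      have := this.2.2.le_hi
      exact Finset.Icc_subset_Icc (by omega) (by omega)
    · intro q hq q' hq' hne
      rw [Function.onFun, Finset.disjoint_left]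
      intro t ht ht'
      rw [Finset.mem_Icc] at ht ht'
      have p := (hQ q hq).2.2
      have p' := (hQ q' hq').2.2
      have := p.le_hi
      have := p'.le_hi
      have := p.lo_le
      have := p'.lo_le
      by_cases c1 : q.2.1 ≤ t
      · exact hne (huniq q hq q' hq' t c1 ht.2 ht'.1 (by omega))
      by_cases c2 : q'.2.1 ≤ t
      · exact hne (huniq q' hq' q hq t c2 ht'.2 ht.1 (by omega)).symm
      have hc : q.2.1 = q'.2.1 := by
        rcases lt_trichotomy q.2.1 q'.2.1 with e | e | e
        · exact absurd (p'.left q.2.1 (by omega) e) p.not_c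
        · exact e
        · exact absurd (p.left q'.2.1 (by omega) e) p'.not_c
      have := p.c_le
      have := p'.c_le
      exact hne (huniq q hq q' hq' q.2.1 le_rfl (by omega) (by omega) (by omega))
  have hright : ∑ q ∈ Q, (Finset.Ioc q.2.2.1 q.2.2.2).card ≤ O.card := by
    rw [← Finset.card_biUnion]
    · refine Finset.card_le_card (Finset.biUnion_subset.2 fun q hq => ?_)
      intro t ht
      rw [Finset.mem_Ioc] at ht
      have hq3 := hQ q hq
      have := hq3.2.2.c_le
      have := hq3.2.2.lo_le
      rw [hO, Finset.mem_sdiff, Finset.mem_biUnion, Skeleton.window, Finset.mem_Icc]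
      refine ⟨by omega, ?_⟩
      rintro ⟨q', hq', ht'⟩
      rw [Finset.mem_Icc] at ht'
      have := huniq q' hq' q hq t ht'.1 ht'.2 (by omega) (by omega)
      rw [this] at ht'
      omega
    · intro q hq q' hq' hne
      rw [Function.onFun, Finset.disjoint_left]
      intro t ht ht'
      rw [Finset.mem_Ioc] at ht ht'
      have p := (hQ q hq).2.2
      have p' := (hQ q' hq').2.2
      have := p.le_hi
      have := p'.le_hi
      have := p.lo_le
      have := p'.lo_le
      have := p.c_le
      have := p'.c_le
      have hc : q.2.2.1 = q'.2.2.1 := by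
        rcases lt_trichotomy q.2.2.1 q'.2.2.1 with e | e | e
        · exact absurd (p.right q'.2.2.1 (by omega) (by omega)) p'.not_d
        · exact e
        · exact absurd (p'.right q.2.2.1 (by omega) (by omega)) p.not_d
      exact hne (huniq q hq q' hq' q.2.2.1 (by omega) le_rfl (by omega) (by omega))
  -- A right block has at least `m ≥ 1` positions.
  have hQcard : Q.card ≤ O.card := by
    refine le_trans ?_ hright
    rw [Finset.card_eq_sum_ones]
    refine Finset.sum_le_sum fun q hq => ?_
    have := (hQ q hq).2.2.le_hi
    have := (hQ q hq).2.2.pos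
    rw [Int.card_Ioc]; omega
  -- Each part is split into left block with core, and right block; the former fit disjointly into
  -- the window, the latter into the positions outside the cores.
  have hsize : (∑ q ∈ Q, (q.2.2.2 + 1 - q.1 : ℤ)) ≤ (S.size : ℤ) + O.card := by
    have e : ∑ q ∈ Q, (q.2.2.2 + 1 - q.1 : ℤ) = ((∑ q ∈ Q, (Finset.Icc q.1 q.2.2.1).card : ℕ) : ℤ) +
        ((∑ q ∈ Q, (Finset.Ioc q.2.2.1 q.2.2.2).card : ℕ) : ℤ) := by
      push_cast
      rw [← Finset.sum_add_distrib]
      refine Finset.sum_congr rfl fun q hq => ?_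
      have := (hQ q hq).2.2.le_hi
      have := (hQ q hq).2.2.lo_le
      have := (hQ q hq).2.2.c_le
      rw [Int.card_Icc, Int.card_Ioc]; omega
    rw [e, Skeleton.size_eq hS]
    exact_mod_cast add_le_add hleft hright
  have hDO : (D \ Q.biUnion fun q => Finset.Icc q.2.1 q.2.2.1).card ≤ O.card :=
    Finset.card_le_card (Finset.sdiff_subset_sdiff hD subset_rfl)
  rw [Finset.sum_add_distrib, Finset.sum_const, nsmul_eq_mul, ← Finset.sum_mul] at hsum
  have hlb : Real.logb 2 A.bd ≤ 0 :=
    (Real.logb_nonpos_iff one_lt_two hb).2 A.bd_lt_one.le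
  have c1 : (Q.card : ℝ) ≤ O.card := by exact_mod_cast hQcard
  have c2 : ((D \ Q.biUnion fun q => Finset.Icc q.2.1 q.2.2.1).card : ℝ) ≤ O.card := by
    exact_mod_cast hDO
  have c3 : (∑ q ∈ Q, ((q.2.2.2 + 1 - q.1 : ℤ) : ℝ)) ≤ (S.size : ℝ) + O.card := by
    exact_mod_cast hsize
  have c4 : (0 : ℝ) ≤ O.card := by positivity
  unfold MarkovSystem.loss
  push_cast at *
  nlinarith [mul_nonneg (sub_nonneg.2 c1) (neg_nonneg.2 hlb),
    mul_nonneg (sub_nonneg.2 c2) (neg_nonneg.2 hlb), mul_nonneg (sub_nonneg.2 c3) (sub_nonneg.2 hκ),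
    mul_nonneg c4 hκ0]

end Determined

end

/-! ### Lower and upper bounds for the probability of the determined positions -/

noncomputable section

section Determined

variable {k : ℕ} {A : MarkovSystem k} {N : ℕ → ℕ} {M : List (Fin (k + 1)) → ℕ → ℚ} {H : ℝ}
  {η : ℕ → ℝ}

/-- Admissible rates: `pr (determined m S)` is at least `2 ^ (-size * (H - κ m))` on good
skeletons. -/
structure RateBounds (A : MarkovSystem k) (H : ℝ) (base : Skeleton → Prop) (e : ℕ → ℕ)
    (κ : ℕ → ℝ) : Prop where
  nonneg : ∀ m, 0 ≤ κ m
  le_eps : ∀ m, κ m ≤ eps m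
  le_entropy : ∀ m, 1 ≤ m → κ m ≤ H
  gap : ∀ m, A.loss H / 2 ^ e (m + 1) ≤ (κ m - κ (m + 1)) / 2
  base : ∀ S, base S → S.zeros ⊆ S.window → ∀ y : ℤ → Fin (k + 1), (∀ i ∈ S.zeros, y i = 0) →
    S.size * (κ 1 - H) ≤ Real.logb 2 (A.pr S.zeros y)

/-- The level at which the parts are queried is at least that of the whole skeleton, so the parts
meet the lower bound on the level in the induction. -/
theorem le_clog {t n : ℕ} (ht : t ≠ 0) : n ≤ Nat.clog 2 ((3 * t) ^ n) := by
  calc n = Nat.clog 2 (2 ^ n) := (Nat.clog_pow 2 n (by norm_num)).symm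
    _ ≤ _ := Nat.clog_mono_right 2 (Nat.pow_le_pow_left (by omega) n)

/-- The bounds of rank `m + 1` are combined over the good parts. The loss uses up only half of the
gap between `κ (m + 1)` and `κ (m + 2)`; the other half is kept, to absorb the approximation errors
in `le_cylApprox_determined`. -/
theorem le_logb_determinedParts {base : Skeleton → Prop} {e : ℕ → ℕ} {κ : ℕ → ℝ}
    (hR : RateBounds A H base e κ) {m : ℕ}
    (ih : ∀ S, S.zeros ⊆ S.window → GoodSkeleton N base e (m + 1) S → ∀ y : ℤ → Fin (k + 1),
      (∀ i ∈ S.zeros, y i = 0) → ∀ n, m + 1 ≤ n →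
      S.size * (κ (m + 1) - H) ≤ Real.logb 2 (A.pr (determined N M H η (m + 1) S y n) y))
    {S : Skeleton} (hS : S.zeros ⊆ S.window) (hG : GoodSkeleton N base e (m + 2) S)
    {y : ℤ → Fin (k + 1)} (hy : ∀ i ∈ S.zeros, y i = 0) {n : ℕ} (hn : m + 1 ≤ n) :
    S.size * ((κ (m + 1) + κ (m + 2)) / 2 - H) ≤
      Real.logb 2 (A.pr (S.zeros ∪ determinedParts N M H η (m + 1) S y n) y) := by
  obtain ⟨Q, hQ, hO⟩ := hG
  have h1 := le_logb_pr_of_parts (A := A) hS (fun q hq => ⟨(hQ q hq).1, (hQ q hq).2.1, (hQ q hq).2.2.1⟩)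
    (hR.nonneg (m + 1)) (hR.le_entropy (m + 1) (by omega)) (y := y)
    (D := S.zeros ∪ determinedParts N M H η (m + 1) S y n)
    (Finset.union_subset hS (determinedParts_subset_window _ _ _)) ?_
  · refine le_trans ?_ h1
    have hg := hR.gap (m + 1)
    have hp : (0 : ℝ) < 2 ^ e (m + 1 + 1) := by positivity
    rw [div_le_iff₀ hp] at hg
    have hO' : ((S.window \ Q.biUnion fun q => Finset.Icc q.2.1 q.2.2.1).card : ℝ) *
        2 ^ e (m + 2) ≤ S.size := by exact_mod_cast hO
    set o : ℝ := ((S.window \ Q.biUnion fun q => Finset.Icc q.2.1 q.2.2.1).card : ℝ)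
    have ho : 0 ≤ o := by positivity
    have hl : 0 ≤ A.loss H := by
      have h2 := hR.nonneg 1
      have h3 := hR.le_entropy 1 le_rfl
      have h4 : Real.logb 2 A.bd ≤ 0 :=
        (Real.logb_nonpos_iff one_lt_two A.bd_pos).2 A.bd_lt_one.le
      unfold MarkovSystem.loss
      linarith
    have hg0 : 0 ≤ (κ (m + 1) - κ (m + 1 + 1)) / 2 := by
      by_contra! hc
      have := mul_neg_of_neg_of_pos hc hp
      linarith
    have h5 := mul_le_mul_of_nonneg_left hg ho
    have h6 := mul_le_mul_of_nonneg_right hO' hg0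
    have e2 : m + 1 + 1 = m + 2 := rfl
    rw [e2] at *
    nlinarith
  · intro q hq
    obtain ⟨q1, q2, q3, q4⟩ := hQ q hq
    have hlo := q3.lo_le
    have hc := q3.c_le
    have hhi := q3.le_hi
    have hmem : (q.1, q.2.2.2) ∈ S.parts (N (m + 1)) := by
      refine Skeleton.mem_parts_iff.2 ⟨?_, _, _, q3⟩
      simp only [Skeleton.window, Finset.mem_Icc]
      omega
    have h2 := ih _ (S.restrict_zeros_subset q.1 q.2.2.2) q4 y
      (fun i hi => hy i (Finset.mem_inter.1 hi).1)
      (Nat.clog 2 ((3 * (S.parts (N (m + 1))).card) ^ n))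
      (hn.trans (le_clog (Finset.card_ne_zero_of_mem hmem)))
    have hsz : ((S.restrict q.1 q.2.2.2).size : ℤ) = q.2.2.2 + 1 - q.1 := by
      rw [Skeleton.size_eq (S.restrict_zeros_subset _ _), Skeleton.card_window _ (by
        show q.1 ≤ q.2.2.2 + 1; omega)]
      rfl
    have hsz' : ((S.restrict q.1 q.2.2.2).size : ℝ) = ((q.2.2.2 + 1 - q.1 : ℤ) : ℝ) := by
      exact_mod_cast hsz
    rw [hsz'] at h2
    refine h2.trans (Real.logb_le_logb_of_le one_lt_two (A.pr_pos _ _) (A.pr_mono ?_ _))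
    intro i hi
    obtain ⟨hi1, hi2⟩ := Finset.mem_inter.1 hi
    rw [Finset.mem_Icc] at hi2
    rcases Finset.mem_union.1 hi1 with hi1 | hi1
    · refine zeros_subset_determined _ _ _ _ (Finset.mem_inter.2 ⟨hi1, ?_⟩)
      rw [Finset.mem_Icc]; omega
    · obtain ⟨p, hp, hip⟩ := Finset.mem_biUnion.1 hi1
      have hw := determined_subset_window _ (S.restrict_zeros_subset _ _) _ _ hip
      simp only [Skeleton.window, Skeleton.restrict, Finset.mem_Icc] at hw
      obtain ⟨-, c', d', hp'⟩ := Skeleton.mem_parts_iff.1 hp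
      -- A part whose interval contains a point of the core of `q` is `q` itself. So inside this
      -- core only the positions determined by `q` count, although neighbouring parts share their
      -- blocks and may be bad.
      obtain ⟨u1, -, -, u4⟩ := q3.unique hp' hi2.1 hi2.2 hw.1 hw.2
      rwa [u1, u4]

/-- Induction on the rank. A non-empty last segment has reached the threshold, whose exponent `eps`
is at least `κ`. For an empty one, the bound comes from `RateBounds.base` in rank `1` and from the
parts in higher rank. -/
theorem le_logb_determined (hM : A.IsMachine M) (hη0 : ∀ m, 0 < η m) (hη1 : ∀ m, η m ≤ 1)
    {base : Skeleton → Prop} {e : ℕ → ℕ} {κ : ℕ → ℝ}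
    (hR : RateBounds A H base e κ) (m : ℕ) :
    ∀ S, S.zeros ⊆ S.window → GoodSkeleton N base e (m + 1) S → ∀ y : ℤ → Fin (k + 1),
      (∀ i ∈ S.zeros, y i = 0) → ∀ n, m + 1 ≤ n →
      S.size * (κ (m + 1) - H) ≤ Real.logb 2 (A.pr (determined N M H η (m + 1) S y n) y) := by
  have hthr : ∀ (m : ℕ) (S : Skeleton) (D : Finset ℤ) (y : ℤ → Fin (k + 1)) (n : ℕ), m ≤ n →
      D ⊆ S.window → fillBound H η m S.size ≤ cylApprox M S D y n →
      S.size * (κ m - H) ≤ Real.logb 2 (A.pr D y) := by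
    intro m S D y n hmn hD h
    refine le_trans ?_ (le_logb_of_fillBound_le hM hD hmn (hη0 m) (hη1 m) h)
    have := hR.le_eps m
    gcongr
  induction m with
  | zero =>
    intro S hS hG y hy n hn
    obtain ⟨j, h1, h2⟩ := determined_one (N := N) (M := M) (H := H) (η := η) S y n
    have hw := determined_subset_window (N := N) (M := M) (H := H) (η := η) 1 hS y n
    rw [h1] at hw ⊢
    by_cases hj : j = 0
    · rw [hj, firstElems_zero, Finset.union_empty]
      exact hR.base S hG hS y hy
    · exact hthr _ _ _ _ _ hn hw (h2 hj)
  | succ m ih =>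
    intro S hS hG y hy n hn
    obtain ⟨j, h1, h2, -⟩ := determined_add_two (N := N) (M := M) (H := H) (η := η) m S y n
    have hw := determined_subset_window (N := N) (M := M) (H := H) (η := η) (m + 2) hS y n
    rw [h1] at hw ⊢
    by_cases hj : j = 0
    · rw [hj, firstElems_zero, Finset.union_empty]
      refine le_trans ?_ (le_logb_determinedParts hR ih hS hG hy (by omega))
      have hg := hR.gap (m + 1)
      have hl : 0 ≤ A.loss H / 2 ^ e (m + 1 + 1) := by
        have h2 := hR.nonneg 1
        have h3 := hR.le_entropy 1 le_rfl
        have h4 : Real.logb 2 A.bd ≤ 0 :=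
          (Real.logb_nonpos_iff one_lt_two A.bd_pos).2 A.bd_lt_one.le
        have : 0 ≤ A.loss H := by unfold MarkovSystem.loss; linarith
        positivity
      have e2 : m + 1 + 1 = m + 2 := rfl
      rw [e2] at *
      refine mul_le_mul_of_nonneg_left ?_ (by positivity)
      linarith
    · exact hthr _ _ _ _ _ hn hw (h2 hj).le

/-- The approximate class probability is at least the threshold without the factor `1 / η`. -/
theorem le_cylApprox_determined (hM : A.IsMachine M) (hη0 : ∀ m, 0 < η m) (hη1 : ∀ m, η m ≤ 1)
    {base : Skeleton → Prop} {e : ℕ → ℕ} {κ : ℕ → ℝ}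
    (hR : RateBounds A H base e κ) {m : ℕ} {S : Skeleton} (hS : S.zeros ⊆ S.window)
    (hG : GoodSkeleton N base e (m + 2) S) {y : ℤ → Fin (k + 1)} (hy : ∀ i ∈ S.zeros, y i = 0)
    {n : ℕ} (hn : m + 2 ≤ n) (hκ : κ (m + 2) = eps (m + 2))
    (hL : 4 ≤ S.size * (κ (m + 1) - κ (m + 2))) :
    (1 + eps (m + 2)) * (2 : ℝ) ^ (-(S.size : ℝ) * (H - eps (m + 2))) ≤
      cylApprox M S (determined N M H η (m + 2) S y n) y n := by
  obtain ⟨j, h1, h2, -⟩ := determined_add_two (N := N) (M := M) (H := H) (η := η) m S y n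
  have hw := determined_subset_window (N := N) (M := M) (H := H) (η := η) (m + 2) hS y n
  have he := eps_pos (m + 2)
  by_cases hj : j = 0
  · have hb := (A.cylApprox_bounds hM S hw y n).1
    refine le_trans ?_ hb
    rw [h1, hj, firstElems_zero, Finset.union_empty]
    have h3 := le_logb_determinedParts hR (le_logb_determined hM hη0 hη1 hR m) hS hG hy
      (n := n) (by omega)
    rw [Real.le_logb_iff_rpow_le one_lt_two (A.pr_pos _ _)] at h3
    have e1 : eps n ≤ 1 / 2 := by rw [← eps_one]; exact eps_anti (by omega)
    have e2 : eps (m + 2) ≤ 1 / 2 := by rw [← eps_one]; exact eps_anti (by omega)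
    -- By `hL` the unused half of the gap is worth at least two bits. The factor `4` gained beats `1
    -- + eps (m + 2) ≤ 2` together with the relative error `1 - eps n ≥ 1 / 2`.
    have h4 : (2 : ℝ) ^ ((2 : ℝ) + -(S.size : ℝ) * (H - eps (m + 2))) ≤
        2 ^ ((S.size : ℝ) * ((κ (m + 1) + κ (m + 2)) / 2 - H)) := by
      refine Real.rpow_le_rpow_of_exponent_le one_le_two ?_
      rw [← hκ]
      linarith
    rw [Real.rpow_add two_pos] at h4
    have h5 : (2 : ℝ) ^ (2 : ℝ) = 4 := by norm_num
    rw [h5] at h4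
    set R : ℝ := 2 ^ (-(S.size : ℝ) * (H - eps (m + 2)))
    have hR0 : 0 < R := by positivity
    have := h4.trans h3
    nlinarith
  · refine le_trans ?_ (h1 ▸ (h2 hj).le)
    rw [fillBound]
    gcongr
    rw [le_div_iff₀ (hη0 _)]
    exact mul_le_of_le_one_right (by linarith) (hη1 _)

/-- Either all positions are determined, or the probability is close to the threshold. -/
theorem determined_dichotomy (hM : A.IsMachine M) (hη0 : ∀ m, 0 < η m) {m : ℕ} {S : Skeleton}
    (hS : S.zeros ⊆ S.window) (y : ℤ → Fin (k + 1)) {n : ℕ} (hn : 1 ≤ n) :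
    determined N M H η (m + 2) S y n = S.window ∨
      A.pr (determined N M H η (m + 2) S y n) y ≤
        4 / (A.bd ^ 4 * η (m + 2)) * (2 : ℝ) ^ (-(S.size : ℝ) * (H - eps (m + 2))) := by
  obtain ⟨j, h1, -, h2⟩ := determined_add_two (N := N) (M := M) (H := H) (η := η) m S y n
  have hw := determined_subset_window (N := N) (M := M) (H := H) (η := η) (m + 2) hS y n
  set J₀ := determinedParts N M H η (m + 1) S y n
  rcases h2 with h2 | h2
  · left
    refine hw.antisymm fun i hi => ?_
    rw [h1, h2, firstElems_card]
    simp only [Finset.mem_union, Finset.mem_sdiff, Skeleton.blanks]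
    tauto
  · right
    have hw2 : S.zeros ∪ J₀ ∪ firstElems (S.blanks \ J₀) (j + 1) ⊆ S.window :=
      Finset.union_subset (Finset.union_subset hS (determinedParts_subset_window _ _ _))
        ((firstElems_subset _ _).trans (Finset.sdiff_subset.trans Finset.sdiff_subset))
    have h3 := (A.cylApprox_bounds hM S hw2 y n).1.trans h2
    obtain ⟨i, hi⟩ := firstElems_succ_subset (S.blanks \ J₀) j
    -- The segment longer by one position fails the threshold, and that position costs at most the
    -- factor `bd ^ 4`. The constant `4` in the statement collects `1 + eps (m + 2) ≤ 2` and `1 -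
    -- eps n ≥ 1 / 2`.
    have h4 : A.bd ^ 4 * A.pr (determined N M H η (m + 2) S y n) y ≤
        A.pr (S.zeros ∪ J₀ ∪ firstElems (S.blanks \ J₀) (j + 1)) y := by
      refine (A.pr_insert_ge _ i y).trans (A.pr_mono ?_ y)
      rw [h1]
      refine Finset.union_subset (Finset.subset_union_left.trans (Finset.subset_insert _ _)) ?_
      exact hi.trans (Finset.insert_subset_insert _ Finset.subset_union_right)
    have e1 : eps n ≤ 1 / 2 := by rw [← eps_one]; exact eps_anti hn
    have e2 : eps (m + 2) ≤ 1 := by rw [← eps_zero]; exact eps_anti (by omega)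
    have hb := A.bd_pos
    have hη := hη0 (m + 2)
    rw [fillBound] at h3
    set R : ℝ := 2 ^ (-(S.size : ℝ) * (H - eps (m + 2)))
    have hR0 : 0 < R := by positivity
    set P := A.pr (determined N M H η (m + 2) S y n) y
    set P' := A.pr (S.zeros ∪ J₀ ∪ firstElems (S.blanks \ J₀) (j + 1)) y
    have hP' : 0 < P' := A.pr_pos _ _
    rw [div_mul_eq_mul_div, le_div_iff₀ (by positivity)]
    rw [div_mul_eq_mul_div, le_div_iff₀ hη] at h3
    have h5 : P' * η (m + 2) ≤ 4 * R := by
      have : (1 / 2) * (P' * η (m + 2)) ≤ (1 - eps n) * P' * η (m + 2) := by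
        rw [mul_assoc]
        exact mul_le_mul_of_nonneg_right (by linarith) (by positivity)
      nlinarith
    calc P * (A.bd ^ 4 * η (m + 2)) = (A.bd ^ 4 * P) * η (m + 2) := by ring
      _ ≤ P' * η (m + 2) := by gcongr
      _ ≤ _ := h5

end Determined

end

/-! ### Typical words -/

noncomputable section

open Classical in
/-- The number of occurrences of the pair `a b` in the word of `y` on `[lo, hi]`. -/
def pairCount {k : ℕ} (y : ℤ → Fin (k + 1)) (lo hi : ℤ) (a b : Fin (k + 1)) : ℕ :=
  ((Finset.Ico lo hi).filter fun i => y i = a ∧ y (i + 1) = b).card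

/-- All pairs occur in the word of `y` on `[lo, hi]` with approximately the right frequency. -/
def IsTypical {k : ℕ} (A : MarkovSystem k) (δ : ℝ) (y : ℤ → Fin (k + 1)) (lo hi : ℤ) : Prop :=
  ∀ a b, |(pairCount y lo hi a b : ℝ) - (hi + 1 - lo) * (A.init a * A.trans a b)| ≤
    δ * (hi + 1 - lo)

theorem sum_pairCount {k : ℕ} (y : ℤ → Fin (k + 1)) (lo hi : ℤ) (f : Fin (k + 1) → Fin (k + 1) → ℝ) :
    ∑ i ∈ Finset.Ico lo hi, f (y i) (y (i + 1)) =
      ∑ a, ∑ b, (pairCount y lo hi a b : ℝ) * f a b := by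
  classical
  rw [← Finset.sum_product', Finset.univ_product_univ,
    ← Finset.sum_fiberwise (Finset.Ico lo hi) (fun i => (y i, y (i + 1)))]
  refine Finset.sum_congr rfl fun p _ => ?_
  rw [pairCount, ← nsmul_eq_mul, ← Finset.sum_const]
  have : (Finset.Ico lo hi).filter (fun i => (y i, y (i + 1)) = p) =
      (Finset.Ico lo hi).filter fun i => y i = p.1 ∧ y (i + 1) = p.2 := by
    ext i; simp [Prod.ext_iff]
  rw [this]
  refine Finset.sum_congr rfl fun i hi => ?_
  obtain ⟨-, h1, h2⟩ := Finset.mem_filter.1 hi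
  rw [h1, h2]

namespace MarkovSystem

variable {k : ℕ} (A : MarkovSystem k)

theorem pr_Icc_eq (y : ℤ → Fin (k + 1)) {lo hi : ℤ} (h : lo ≤ hi) :
    A.pr (Finset.Icc lo hi) y =
      A.init (y lo) * ∏ i ∈ Finset.Ico lo hi, A.trans (y i) (y (i + 1)) := by
  obtain ⟨n, rfl⟩ : ∃ n : ℕ, hi = lo + n := ⟨(hi - lo).toNat, by omega⟩
  have e : Finset.Icc lo (lo + (n : ℤ)) = Finset.Ico lo (lo + ((n + 1 : ℕ) : ℤ)) := by
    ext j; simp; omega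
  rw [e, pr_Ico, wordProb_wordFrom_succ]
  congr 1
  symm
  refine Finset.prod_nbij' (fun i => (i - lo).toNat) (fun i => lo + i) ?_ ?_ ?_ ?_ ?_
  · intro i hi; rw [Finset.mem_Ico] at hi; rw [Finset.mem_range]; omega
  · intro i hi; rw [Finset.mem_range] at hi; rw [Finset.mem_Ico]; omega
  · intro i hi; rw [Finset.mem_Ico] at hi; omega
  · intro i hi; omega
  · intro i hi; rw [Finset.mem_Ico] at hi
    rw [show lo + ((i - lo).toNat : ℤ) = i by omega]

/-- The sum of all transition information contents. -/
def info : ℝ := ∑ a, ∑ b, -Real.logb 2 (A.trans a b)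

theorem neg_logb_trans_pos (a b) : 0 < -Real.logb 2 (A.trans a b) :=
  neg_pos.2 (Real.logb_neg one_lt_two (A.trans_pos a b) (A.trans_lt_one a b))

theorem info_nonneg : 0 ≤ A.info :=
  Finset.sum_nonneg fun a _ => Finset.sum_nonneg fun b _ => (A.neg_logb_trans_pos a b).le

theorem entropy_eq : A.entropy = ∑ a, ∑ b, A.init a * A.trans a b * -Real.logb 2 (A.trans a b) := by
  simp only [entropy, one_div, Real.logb_inv]

theorem entropy_pos : 0 < A.entropy := by
  rw [entropy_eq]
  refine Finset.sum_pos (fun a _ => Finset.sum_pos (fun b _ => ?_) Finset.univ_nonempty)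
    Finset.univ_nonempty
  exact mul_pos (mul_pos (A.init_pos a) (A.trans_pos a b)) (A.neg_logb_trans_pos a b)

theorem abs_sum_typical {δ : ℝ} {y : ℤ → Fin (k + 1)} {lo hi : ℤ} (h : IsTypical A δ y lo hi) :
    |(∑ i ∈ Finset.Ico lo hi, -Real.logb 2 (A.trans (y i) (y (i + 1)))) -
      (hi + 1 - lo) * A.entropy| ≤ (hi + 1 - lo) * (δ * A.info) := by
  rw [sum_pairCount y lo hi fun a b => -Real.logb 2 (A.trans a b), entropy_eq, info,
    Finset.mul_sum, Finset.mul_sum, Finset.mul_sum, ← Finset.sum_sub_distrib]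
  refine (Finset.abs_sum_le_sum_abs _ _).trans (Finset.sum_le_sum fun a _ => ?_)
  rw [Finset.mul_sum, Finset.mul_sum, Finset.mul_sum, ← Finset.sum_sub_distrib]
  refine (Finset.abs_sum_le_sum_abs _ _).trans (Finset.sum_le_sum fun b _ => ?_)
  have hp := A.neg_logb_trans_pos a b
  rw [show (pairCount y lo hi a b : ℝ) * -Real.logb 2 (A.trans a b) -
    (hi + 1 - lo) * (A.init a * A.trans a b * -Real.logb 2 (A.trans a b)) =
    (pairCount y lo hi a b - (hi + 1 - lo) * (A.init a * A.trans a b)) *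
      -Real.logb 2 (A.trans a b) by ring, abs_mul, abs_of_pos hp]
  calc _ ≤ (δ * (hi + 1 - lo)) * -Real.logb 2 (A.trans a b) := by gcongr; exact h a b
    _ = _ := by ring

theorem logb_pr_Icc (y : ℤ → Fin (k + 1)) {lo hi : ℤ} (h : lo ≤ hi) :
    Real.logb 2 (A.pr (Finset.Icc lo hi) y) = Real.logb 2 (A.init (y lo)) -
      ∑ i ∈ Finset.Ico lo hi, -Real.logb 2 (A.trans (y i) (y (i + 1))) := by
  rw [pr_Icc_eq A y h, Real.logb_mul (A.init_pos _).ne'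
    (Finset.prod_ne_zero_iff.2 fun i _ => (A.trans_pos _ _).ne'),
    Real.logb_prod _ _ fun i _ => (A.trans_pos _ _).ne', Finset.sum_neg_distrib, sub_neg_eq_add]

/-- The probability of a typical word. -/
theorem logb_pr_typical {δ : ℝ} {y : ℤ → Fin (k + 1)} {lo hi : ℤ} (hle : lo ≤ hi)
    (h : IsTypical A δ y lo hi) :
    -((hi + 1 - lo) * (A.entropy + δ * A.info)) + Real.logb 2 A.bd ≤
        Real.logb 2 (A.pr (Finset.Icc lo hi) y) ∧
      Real.logb 2 (A.pr (Finset.Icc lo hi) y) ≤ -((hi + 1 - lo) * (A.entropy - δ * A.info)) := by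
  have h1 := abs_le.1 (A.abs_sum_typical h)
  have h2 : Real.logb 2 A.bd ≤ Real.logb 2 (A.init (y lo)) :=
    Real.logb_le_logb_of_le one_lt_two A.bd_pos (A.bd_le_init _)
  have h3 : Real.logb 2 (A.init (y lo)) ≤ 0 :=
    (Real.logb_nonpos_iff one_lt_two (A.init_pos _)).2 (A.init_le_one _)
  rw [logb_pr_Icc A y hle]
  constructor <;> nlinarith [h1.1, h1.2]

/-- The information gained at least from each further symbol. -/
def gain : ℝ := -Real.logb 2 (1 - A.bd ^ 4)

theorem bd_pow_lt_one : A.bd ^ 4 < 1 := pow_lt_one₀ A.bd_pos.le A.bd_lt_one (by norm_num)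

theorem gain_pos : 0 < A.gain := by
  have := A.bd_pow_lt_one
  have := pow_pos A.bd_pos 4
  exact neg_pos.2 (Real.logb_neg one_lt_two (by linarith) (by linarith))

/-- By `pr_insert_le` every further fixed symbol divides the probability by at least `1 / (1 - bd ^
4)`, that is, it carries at least `gain` bits. -/
theorem logb_pr_le_of_subset {D D' : Finset ℤ} (h : D ⊆ D') (y : ℤ → Fin (k + 1)) :
    Real.logb 2 (A.pr D' y) ≤ Real.logb 2 (A.pr D y) - (D' \ D).card * A.gain := by
  have h1 := A.pr_union_le (X := D' \ D) Finset.disjoint_sdiff y (D := D)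
  rw [Finset.union_sdiff_of_subset h] at h1
  have hb : 0 < 1 - A.bd ^ 4 := sub_pos.2 A.bd_pow_lt_one
  have h2 := Real.logb_le_logb_of_le one_lt_two (A.pr_pos _ _) h1
  rw [Real.logb_mul (pow_pos hb _).ne' (A.pr_pos _ _).ne', Real.logb_pow] at h2
  unfold gain
  linarith

theorem init_zero_lt_one : A.init 0 < 1 := by
  obtain ⟨b, hb⟩ := A.exists_ne 0
  have h := Finset.sum_le_sum_of_subset_of_nonneg (s := {0, b}) (Finset.subset_univ _)
    (f := A.init) fun c _ _ => A.init_nonneg c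
  rw [Finset.sum_pair hb.symm, A.init_sum] at h
  have := A.init_pos b
  linarith

theorem card_nonzero_typical {δ : ℝ} {y : ℤ → Fin (k + 1)} {lo hi : ℤ} (h : IsTypical A δ y lo hi) :
    (hi + 1 - lo) * (1 - A.init 0 - δ * (k + 1) ^ 2) ≤
      (((Finset.Ico lo hi).filter fun i => y i ≠ 0).card : ℝ) := by
  have h1 := sum_pairCount y lo hi fun a _ => if a = 0 then 0 else 1
  have h2 : ∑ i ∈ Finset.Ico lo hi, (if y i = 0 then (0 : ℝ) else 1) =
      ((Finset.Ico lo hi).filter fun i => y i ≠ 0).card := by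
    rw [Finset.card_filter]; push_cast
    exact Finset.sum_congr rfl fun i _ => by by_cases h : y i = 0 <;> simp [h]
  rw [h2] at h1
  rw [h1]
  have h3 : ∀ a b : Fin (k + 1), (hi + 1 - lo) * ((A.init a * A.trans a b) * (if a = 0 then 0 else 1) - δ) ≤
      (pairCount y lo hi a b : ℝ) * (if a = 0 then 0 else 1) := by
    intro a b
    have := (abs_le.1 (h a b))
    have h0 : 0 ≤ δ * (hi + 1 - lo) := (abs_nonneg _).trans (h a b)
    split_ifs
    · nlinarith
    · nlinarith [this.1]
  refine le_trans (le_of_eq ?_) (Finset.sum_le_sum fun a _ => Finset.sum_le_sum fun b _ => h3 a b)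
  simp only [← Finset.mul_sum, Finset.sum_sub_distrib]
  congr 1
  have h4 : ∑ a, ∑ b, A.init a * A.trans a b * (if a = 0 then (0 : ℝ) else 1) = 1 - A.init 0 := by
    have : ∀ a, ∑ b, A.init a * A.trans a b * (if a = 0 then (0 : ℝ) else 1) =
        A.init a - if a = 0 then A.init 0 else 0 := by
      intro a
      rw [← Finset.sum_mul, ← Finset.mul_sum, A.trans_sum]
      split_ifs with h <;> simp [h]
    simp only [this, Finset.sum_sub_distrib, A.init_sum]
    simp
  rw [h4]
  simp
  ring

/-- A typical filler costs about `entropy` bits per position. It has a fraction of about `1 - init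
0` nonzero symbols; none of these is fixed by the zeros alone, and each saves at least `gain` bits.
The hypothesis `hδ` lets the errors, including the additive constant `logb 2 bd` spread over at
least `s` positions, consume at most half of the saving. -/
theorem le_logb_pr_zeros {δ s : ℝ} {S : Skeleton} (hS : S.zeros ⊆ S.window)
    {y : ℤ → Fin (k + 1)} (hy : ∀ i ∈ S.zeros, y i = 0) (hle : S.lo ≤ S.hi)
    (h : IsTypical A δ y S.lo S.hi) (hs : s ≤ S.size) (hs0 : 0 < s)
    (hδ : δ * (A.info + A.gain * (k + 1) ^ 2) - Real.logb 2 A.bd / s ≤ A.gain * (1 - A.init 0) / 2) :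
    S.size * (A.gain * (1 - A.init 0) / 2 - A.entropy) ≤ Real.logb 2 (A.pr S.zeros y) := by
  have hsz : (S.size : ℝ) = S.hi + 1 - S.lo := by
    have := Skeleton.card_window S (by omega)
    rw [Skeleton.size_eq hS]; exact_mod_cast this
  have h1 := (A.logb_pr_typical hle h).1
  have h2 := A.logb_pr_le_of_subset hS y
  have h3 := A.card_nonzero_typical h
  have h4 : (((Finset.Ico S.lo S.hi).filter fun i => y i ≠ 0).card : ℝ) ≤
      (S.window \ S.zeros).card := by
    refine Nat.cast_le.2 (Finset.card_le_card fun i hi => ?_)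
    obtain ⟨hi1, hi2⟩ := Finset.mem_filter.1 hi
    rw [Finset.mem_Ico] at hi1
    rw [Finset.mem_sdiff, Skeleton.window, Finset.mem_Icc]
    exact ⟨by omega, fun h => hi2 (hy i h)⟩
  rw [Skeleton.window] at h2 h4
  rw [← hsz] at h1 h3
  have hg := A.gain_pos
  have hb : Real.logb 2 A.bd ≤ 0 :=
    (Real.logb_nonpos_iff one_lt_two A.bd_pos).2 A.bd_lt_one.le
  have hS0 : 0 < (S.size : ℝ) := hs0.trans_le hs
  have h5 : -Real.logb 2 A.bd ≤ S.size * (-Real.logb 2 A.bd / s) := by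
    rw [mul_div_assoc', le_div_iff₀ hs0]; nlinarith
  have h6 := mul_le_mul_of_nonneg_left hδ hS0.le
  have h7 := mul_le_mul_of_nonneg_left (h3.trans h4) hg.le
  have h8 : S.size * (Real.logb 2 A.bd / s) = -(S.size * (-Real.logb 2 A.bd / s)) := by ring
  nlinarith

end MarkovSystem

end

/-! ### Choice of the rates and conclusions for typical fillers -/

noncomputable section

theorem tendsto_eps : Tendsto eps atTop (𝓝 0) := by
  have := tendsto_pow_atTop_nhds_zero_of_lt_one (r := (1 / 2 : ℝ)) (by norm_num) (by norm_num)
  refine this.congr fun n => ?_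
  rw [eps, one_div_pow]

theorem eps_add (m n : ℕ) : eps (m + n) = eps m * eps n := by
  unfold eps; rw [pow_add]; field_simp

theorem four_pow_mul_eps (m : ℕ) : (4 : ℝ) ^ m * eps m = 2 ^ m := by
  unfold eps
  rw [show (4 : ℝ) = 2 * 2 by norm_num, mul_pow]; field_simp

theorem tendsto_four_pow : Tendsto (fun c : ℕ => (4 : ℝ) ^ c) atTop atTop :=
  tendsto_pow_atTop_atTop_of_one_lt (by norm_num)

namespace MarkovSystem

variable {k : ℕ} (A : MarkovSystem k)

/-- The rate at which the zeros of a typical skeleton fall short of the entropy. -/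
def zeroRate : ℝ := min (A.gain * (1 - A.init 0) / 2) A.entropy

theorem zeroRate_pos : 0 < A.zeroRate := by
  have := A.gain_pos
  have := sub_pos.2 A.init_zero_lt_one
  exact lt_min (by positivity) A.entropy_pos

/-- The rates for the probabilities of the sets of determined positions. -/
def rate (m : ℕ) : ℝ := min (eps m) (A.zeroRate * (1 / 2 + eps m))

/-- Both terms of the minimum in `rate` fall by a fixed multiple of `eps (m + 1)`, which leaves room
for losses decreasing like `2 ^ (-m)`. The second term keeps the rate below `zeroRate` in rank `1`
and on; as it stays above `zeroRate / 2`, the minimum is eventually `eps m`. -/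
theorem rate_gap (m : ℕ) : min 1 A.zeroRate * eps (m + 1) ≤ A.rate m - A.rate (m + 1) := by
  have h := A.zeroRate_pos
  have e := eps_pos m
  rw [le_sub_iff_add_le]
  unfold rate
  rw [eps_succ]
  refine le_min ?_ ?_
  · have h1 := min_le_left (1 : ℝ) A.zeroRate
    have h2 := min_le_left (eps m / 2) (A.zeroRate * (1 / 2 + eps m / 2))
    nlinarith
  · have h1 := min_le_right (1 : ℝ) A.zeroRate
    have h2 := min_le_right (eps m / 2) (A.zeroRate * (1 / 2 + eps m / 2))
    nlinarith

/-- The condition on skeletons of rank `1`: there is a typical filler. -/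
def HasTypicalFiller (c : ℕ) (S : Skeleton) : Prop :=
  ∃ y : ℤ → Fin (k + 1), (∀ i ∈ S.zeros, y i = 0) ∧ S.lo ≤ S.hi ∧
    IsTypical A (6 * eps (1 + c)) y S.lo S.hi ∧ 4 ^ (1 + c) ≤ S.size

/-- The loss `loss / 2 ^ (m + 1 + c)` and the gap of the rates are both multiples of `eps (m + 1)`,
so a single large `c` serves all ranks. The same `c` makes rank `1` skeletons long and typical
enough for `le_logb_pr_zeros`. The last conjunct provides the two bits of slack. -/
theorem eventually_rateBounds :
    ∀ᶠ c : ℕ in atTop, RateBounds A A.entropy (A.HasTypicalFiller c) (fun m => m + c) A.rate ∧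
      4 ≤ (4 : ℝ) ^ c * min 1 A.zeroRate := by
  have hz := A.zeroRate_pos
  have hz1 : 0 < min 1 A.zeroRate := lt_min one_pos hz
  have hg := A.gain_pos
  have hi := sub_pos.2 A.init_zero_lt_one
  have t1 : Tendsto (fun c : ℕ => A.loss A.entropy * eps c) atTop (𝓝 0) := by
    simpa using tendsto_eps.const_mul (A.loss A.entropy)
  have t2 : Tendsto (fun c : ℕ => 6 * eps (1 + c) * (A.info + A.gain * (k + 1) ^ 2) -
      Real.logb 2 A.bd / (4 : ℝ) ^ (1 + c)) atTop (𝓝 0) := by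
    have e1 : Tendsto (fun c : ℕ => 1 + c) atTop atTop := tendsto_add_atTop_nat 1 |>.congr
      fun c => by ring
    have e2 := ((tendsto_eps.comp e1).const_mul 6).mul_const (A.info + A.gain * (k + 1) ^ 2)
    have e3 := (tendsto_const_nhds (x := Real.logb 2 A.bd)).div_atTop (tendsto_four_pow.comp e1)
    simpa using e2.sub e3
  have t3 : Tendsto (fun c : ℕ => (4 : ℝ) ^ c * min 1 A.zeroRate) atTop atTop :=
    tendsto_four_pow.atTop_mul_const hz1
  filter_upwards [t1.eventually_le_const (u := min 1 A.zeroRate / 2) (by positivity),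
    t2.eventually_le_const (u := A.gain * (1 - A.init 0) / 2) (by positivity),
    t3.eventually_ge_atTop 4] with c h1 h2 h3
  refine ⟨⟨fun m => ?_, fun m => min_le_left _ _, fun m hm => ?_, fun m => ?_, ?_⟩, h3⟩
  · have := eps_pos m
    exact le_min this.le (by positivity)
  · have e : eps m ≤ 1 / 2 := by rw [← eps_one]; exact eps_anti hm
    have e' := eps_pos m
    have : A.rate m ≤ A.zeroRate := (min_le_right _ _).trans (by nlinarith)
    exact this.trans (min_le_right _ _)
  · have h4 := A.rate_gap m
    have h5 := eps_pos (m + 1)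
    have : A.loss A.entropy / 2 ^ (m + 1 + c) = (A.loss A.entropy * eps c) * eps (m + 1) := by
      rw [mul_assoc, ← eps_add, add_comm c, eps, mul_one_div]
    rw [this]
    nlinarith
  · rintro S ⟨y₀, hy₀, hle, hty, hs⟩ hS y hy
    have hs' : (4 : ℝ) ^ (1 + c) ≤ S.size := by exact_mod_cast hs
    have := A.le_logb_pr_zeros hS hy₀ hle hty hs' (by positivity) h2
    rw [A.pr_congr fun i hi => (hy i hi).trans (hy₀ i hi).symm]
    refine le_trans ?_ this
    gcongr
    refine ((min_le_right _ _).trans ?_).trans (min_le_left _ A.entropy)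
    rw [eps_one]
    exact le_of_eq (by rw [zeroRate]; ring)

set_option maxHeartbeats 1000000 in
/-- The conclusion for typical fillers. -/
theorem eventually_typical {N : ℕ → ℕ} {M : List (Fin (k + 1)) → ℕ → ℚ} (hM : A.IsMachine M)
    {η θ : ℕ → ℝ} {η₀ : ℝ} (h0 : 0 < η₀) (h1 : η₀ < 1) (hη : ∀ m, η₀ ≤ η m)
    (hη1 : ∀ m, η m ≤ 1) (hθ : ∀ᶠ r in atTop, η₀ ≤ θ r ∧ θ r < 1) :
    ∀ᶠ c : ℕ in atTop, ∀ n, ∀ S : Skeleton, S.zeros ⊆ S.window → S.lo ≤ S.hi →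
      4 ^ (n + c) ≤ S.size → ∀ y : ℤ → Fin (k + 1), IsTypical A (6 * eps (n + c)) y S.lo S.hi →
      cylApprox M S (determined N M A.entropy η (n + c) S y (n + c)) y (n + c) <
        (1 + eps n) / η n * (2 : ℝ) ^ (-(S.size : ℝ) * (A.entropy - eps n)) ∧
      1 - 2 / |Real.logb 2 (θ (n + c))| * eps n <
        ((determined N M A.entropy η (n + c) S y (n + c)).card : ℝ) / S.size := by
  have hb := A.bd_pos
  have hg := A.gain_pos
  have hinfo := A.info_nonneg
  -- `C` bounds the constant of `determined_dichotomy` uniformly in the rank. `D` collects all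
  -- additive errors, and `Θ` bounds `|logb 2 (θ r)|`.
  set C : ℝ := 4 / (A.bd ^ 4 * η₀) with hC
  have hC0 : 0 < C := by positivity
  set D : ℝ := -Real.logb 2 A.bd + Real.logb 2 C with hD
  set Θ : ℝ := -Real.logb 2 η₀ with hΘ
  have hΘ0 : 0 < Θ := neg_pos.2 (Real.logb_neg one_lt_two h0 h1)
  have hD0 : 0 ≤ D := by
    have h2 : Real.logb 2 A.bd ≤ 0 :=
      (Real.logb_nonpos_iff one_lt_two hb).2 A.bd_lt_one.le
    have h3 : 0 ≤ Real.logb 2 C := by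
      refine Real.logb_nonneg one_lt_two ?_
      rw [hC, le_div_iff₀ (by positivity)]
      have := A.bd_pow_lt_one
      have : A.bd ^ 4 * η₀ ≤ 1 := by
        have := pow_pos hb 4
        nlinarith
      linarith
    linarith
  have t1 : Tendsto (fun c : ℕ => 6 * eps c * A.info) atTop (𝓝 0) := by
    simpa using (tendsto_eps.const_mul 6).mul_const A.info
  have t2 : Tendsto (fun c : ℕ => (6 * A.info + 1) * eps c + D / (4 : ℝ) ^ c) atTop (𝓝 0) := by
    simpa using (tendsto_eps.const_mul (6 * A.info + 1)).add
      ((tendsto_const_nhds (x := D)).div_atTop tendsto_four_pow)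
  obtain ⟨R, hR⟩ := eventually_atTop.1 hθ
  filter_upwards [t1.eventually_le_const (u := 1 / 2) (by norm_num),
    t2.eventually_lt_const (u := 2 * A.gain / Θ) (by positivity),
    tendsto_four_pow.eventually_ge_atTop (2 * Real.logb 2 (2 * C) + 1), eventually_ge_atTop 2,
    eventually_ge_atTop R] with c b1 b2 b3 b4 b5 n S hS hle hs y hy
  obtain ⟨m, hm⟩ : ∃ m, n + c = m + 2 := ⟨n + c - 2, by omega⟩
  obtain ⟨θ1, θ2⟩ := hR (n + c) (by omega)
  set J := determined N M A.entropy η (n + c) S y (n + c) with hJ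
  have hw : J ⊆ S.window := determined_subset_window _ hS _ _
  have hty := A.logb_pr_typical hle hy
  have hcard := Skeleton.size_eq hS
  have hsz : (S.size : ℝ) = S.hi + 1 - S.lo := by
    have := Skeleton.card_window S (by omega)
    rw [hcard]; exact_mod_cast this
  rw [← hsz] at hty
  have hs' : (4 : ℝ) ^ (n + c) ≤ S.size := by exact_mod_cast hs
  have hS0 : 0 < (S.size : ℝ) := lt_of_lt_of_le (by positivity) hs'
  have en := eps_pos n
  have ec := eps_pos c
  rw [eps_add] at hty
  -- The length grows like `4 ^ n` while `eps n` decays like `2 ^ (-n)`, so `size * eps n` exceeds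
  -- any constant, uniformly in `n`, once `c` is large.
  have hsn : (4 : ℝ) ^ c ≤ S.size * eps n := by
    have h2 : (1 : ℝ) ≤ 4 ^ n * eps n := by rw [four_pow_mul_eps]; exact one_le_pow₀ one_le_two
    calc (4 : ℝ) ^ c ≤ 4 ^ c * (4 ^ n * eps n) := le_mul_of_one_le_right (by positivity) h2
      _ = 4 ^ (n + c) * eps n := by rw [pow_add]; ring
      _ ≤ _ := by gcongr
  have h16 : (16 : ℝ) ≤ 4 ^ c := by
    calc (16 : ℝ) = 4 ^ 2 := by norm_num
      _ ≤ _ := pow_le_pow_right₀ (by norm_num) b4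
  have ec4 : eps c ≤ 1 / 4 := by
    refine (eps_anti b4).trans ?_
    norm_num [eps]
  have hlogθ : 0 < |Real.logb 2 (θ (n + c))| ∧ |Real.logb 2 (θ (n + c))| ≤ Θ := by
    have h2 := Real.logb_neg one_lt_two (h0.trans_le θ1) θ2
    rw [abs_of_neg h2]
    exact ⟨neg_pos.2 h2, neg_le_neg (Real.logb_le_logb_of_le one_lt_two h0 θ1)⟩
  have hca := (A.cylApprox_bounds hM S hw y (n + c)).2
  have e1 : eps (n + c) ≤ 1 := by rw [← eps_zero]; exact eps_anti (by omega)
  have hpJ := A.pr_pos J y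
  have hca2 : cylApprox M S J y (n + c) ≤ 2 * A.pr J y := hca.trans (by nlinarith)
  have hfin : Real.logb 2 (2 * A.pr J y) < -(S.size : ℝ) * (A.entropy - eps n) →
      cylApprox M S J y (n + c) <
        (1 + eps n) / η n * (2 : ℝ) ^ (-(S.size : ℝ) * (A.entropy - eps n)) := by
    intro h
    rw [Real.logb_lt_iff_lt_rpow one_lt_two (by positivity)] at h
    refine hca2.trans_lt (h.trans_le (le_mul_of_one_le_left (by positivity) ?_))
    rw [le_div_iff₀ (h0.trans_le (hη n))]
    linarith [hη1 n]
  have hlog2 : Real.logb 2 (2 * A.pr J y) = 1 + Real.logb 2 (A.pr J y) := by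
    rw [Real.logb_mul two_ne_zero hpJ.ne', Real.logb_self_eq_one one_lt_two]
  rcases determined_dichotomy (N := N) (H := A.entropy) (η := η) (m := m) hM
    (fun m => h0.trans_le (hη m)) hS y (n := n + c) (by omega) with hd | hd
  · rw [← hm] at hd
    have hJw : J = S.window := hd
    constructor
    · refine hfin ?_
      rw [hlog2, hJw, Skeleton.window]
      have h3 : S.size * (6 * (eps n * eps c) * A.info) ≤ S.size * eps n * (1 / 2) := by
        calc _ = S.size * eps n * (6 * eps c * A.info) := by ring
          _ ≤ _ := by gcongr
      nlinarith [hty.2]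
    · rw [hJw, ← hcard, div_self hS0.ne']
      have := hlogθ.1
      have : 0 < 2 / |Real.logb 2 (θ (n + c))| * eps n := by positivity
      linarith
  · rw [← hm] at hd
    have hd' : A.pr J y ≤ C * (2 : ℝ) ^ (-(S.size : ℝ) * (A.entropy - eps (n + c))) := by
      refine hd.trans (mul_le_mul_of_nonneg_right ?_ (by positivity))
      have := hη (n + c)
      exact div_le_div_of_nonneg_left (by norm_num) (by positivity)
        (mul_le_mul_of_nonneg_left this (by positivity))
    have hd2 := Real.logb_le_logb_of_le one_lt_two hpJ hd'
    rw [Real.logb_mul hC0.ne' (by positivity), Real.logb_rpow two_pos (by norm_num), eps_add] at hd2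
    constructor
    · refine hfin ?_
      rw [Real.logb_mul two_ne_zero hC0.ne', Real.logb_self_eq_one one_lt_two] at b3
      rw [hlog2]
      have h3 : S.size * (eps n * eps c) ≤ S.size * eps n * (1 / 4) := by
        rw [← mul_assoc]; gcongr
      linarith
    · have h3 := A.logb_pr_le_of_subset hw y
      have h4 : ((S.window \ J).card : ℝ) = S.size - J.card := by
        rw [Finset.card_sdiff_of_subset hw, ← hcard, Nat.cast_sub]
        rw [hcard]; exact Finset.card_le_card hw
      rw [Skeleton.window] at h3 h4
      rw [h4] at h3
      set u : ℝ := S.size - J.card with hu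
      have hty1 := hty.1
      rw [lt_div_iff₀ hS0]
      -- The `u` undetermined positions account for the difference between the bits of the whole
      -- word, at most about `size * entropy`, and those of `J`, at least about `size * (entropy -
      -- eps n * eps c)`.
      have h5 : u * A.gain ≤ S.size * (6 * (eps n * eps c) * A.info) + S.size * (eps n * eps c) + D := by
        rw [hD]; nlinarith
      have h6 : D ≤ S.size * eps n * (D / 4 ^ c) := by
        rw [mul_div_assoc', le_div_iff₀ (by positivity)]
        nlinarith
      have h7 : u * A.gain < S.size * eps n * (2 * A.gain / Θ) := by
        have := mul_lt_mul_of_pos_left b2 (show 0 < S.size * eps n by positivity)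
        nlinarith
      have h8 : u < S.size * eps n * (2 / Θ) := by
        have : S.size * eps n * (2 * A.gain / Θ) = (S.size * eps n * (2 / Θ)) * A.gain := by ring
        rw [this] at h7
        exact lt_of_mul_lt_mul_right h7 hg.le
      have h9 : 2 / Θ ≤ 2 / |Real.logb 2 (θ (n + c))| := by
        have := hlogθ.1
        gcongr
        exact hlogθ.2
      have h10 := mul_le_mul_of_nonneg_left h9 (show 0 ≤ S.size * eps n by positivity)
      nlinarith

end MarkovSystem

end

noncomputable section

/-! ### Finite words -/

section Words

variable {k : ℕ}

/-- The set of all words of length `n`. -/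
def words (k n : ℕ) : Finset (List (Fin (k + 1))) :=
  Finset.univ.image fun w : Fin n → Fin (k + 1) => List.ofFn w

theorem mem_words {n : ℕ} {w : List (Fin (k + 1))} : w ∈ words k n ↔ w.length = n := by
  simp only [words, Finset.mem_image, Finset.mem_univ, true_and]
  constructor
  · rintro ⟨w, rfl⟩; simp
  · rintro rfl; exact ⟨w.get, List.ofFn_get w⟩

theorem getD_wordFrom (x : ℤ → Fin (k + 1)) (u : ℤ) {n j : ℕ} (h : j < n) :
    (wordFrom x u n).getD j 0 = x (u + j) := by
  rw [List.getD_eq_getElem _ _ (by simpa using h), getElem_wordFrom]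

theorem wordFrom_congr {x y : ℤ → Fin (k + 1)} {u v : ℤ} {n : ℕ}
    (h : ∀ j < n, x (u + (j : ℕ)) = y (v + (j : ℕ))) : wordFrom x u n = wordFrom y v n := by
  unfold wordFrom
  congr 1
  funext j
  exact h j j.2

theorem wordFrom_inj {x y : ℤ → Fin (k + 1)} {u v : ℤ} {n : ℕ}
    (h : wordFrom x u n = wordFrom y v n) {j : ℕ} (hj : j < n) : x (u + j) = y (v + j) := by
  rw [← getD_wordFrom x u hj, h, getD_wordFrom y v hj]

/-- The pattern of the zeros of a word that are not isolated. -/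
def zeroPattern (v : List (Fin (k + 1))) : List Bool :=
  (List.range v.length).map fun j =>
    decide (v.getD j 0 = 0 ∧ (v.getD (j - 1) 0 = 0 ∨ v.getD (j + 1) 0 = 0))

/-- The words with the same pattern of zeros as `v`. -/
def similarWords (v : List (Fin (k + 1))) : Finset (List (Fin (k + 1))) :=
  (words k v.length).filter fun v' => zeroPattern v' = zeroPattern v

/-- The number of occurrences of the pair `a b` in a word. -/
def pairs (v : List (Fin (k + 1))) (a b : Fin (k + 1)) : ℕ :=
  ((Finset.range (v.length - 1)).filter fun j => v.getD j 0 = a ∧ v.getD (j + 1) 0 = b).card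

theorem pairs_wordFrom (x : ℤ → Fin (k + 1)) (lo hi : ℤ) (a b : Fin (k + 1)) :
    pairs (wordFrom x lo (hi + 1 - lo).toNat) a b = pairCount x lo hi a b := by
  unfold pairs pairCount
  rw [length_wordFrom]
  refine Finset.card_nbij' (fun j => lo + (j : ℕ)) (fun i => (i - lo).toNat) ?_ ?_ ?_ ?_
  · intro j hj
    simp only [Finset.coe_filter, Finset.mem_range, Set.mem_ofPred_eq, Finset.mem_Ico] at hj ⊢
    rw [getD_wordFrom _ _ (by omega), getD_wordFrom _ _ (by omega)] at hj
    refine ⟨by omega, hj.2.1, ?_⟩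
    rw [← hj.2.2]; congr 1; push_cast; ring
  · intro i h
    simp only [Finset.coe_filter, Finset.mem_range, Set.mem_ofPred_eq, Finset.mem_Ico] at h ⊢
    rw [getD_wordFrom _ _ (by omega), getD_wordFrom _ _ (by omega)]
    refine ⟨by omega, ?_, ?_⟩
    · rw [← h.2.1]; congr 1; omega
    · rw [← h.2.2]; congr 1; omega
  · intro j _; simp
  · intro i h
    simp only [Finset.coe_filter, Set.mem_ofPred_eq, Finset.mem_Ico] at h
    simp only; omega

/-- The word `v` is typical at precision `e`, according to the table `T` of approximate
probabilities. -/
def TypicalWord (T : List (Fin (k + 1)) → ℕ → ℕ) (e : ℕ) (v : List (Fin (k + 1))) : Prop :=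
  ∀ a b, pairs v a b * 2 ^ e ≤ v.length * T [a, b] e + 4 * v.length ∧
    v.length * T [a, b] e ≤ pairs v a b * 2 ^ e + 4 * v.length

open Classical in
/-- According to the table `T`, most words with the same pattern of zeros as `v` are typical. -/
def Concentrated (T : List (Fin (k + 1)) → ℕ → ℕ) (e s j : ℕ) (v : List (Fin (k + 1))) : Prop :=
  (∑ v' ∈ (similarWords v).filter fun v' => ¬ TypicalWord T e v', (T v' s + 2)) * 2 ^ j +
    2 * (similarWords v).card ≤ ∑ v' ∈ similarWords v, T v' s

/-- `T w s` approximates `2 ^ s` times the probability of `w`. -/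
def MarkovSystem.IsTable (A : MarkovSystem k) (T : List (Fin (k + 1)) → ℕ → ℕ) : Prop :=
  ∀ w s, |(T w s : ℝ) - 2 ^ s * A.wordProb w| ≤ 2

variable {A : MarkovSystem k} {T : List (Fin (k + 1)) → ℕ → ℕ}

theorem MarkovSystem.IsTable.le (hT : A.IsTable T) (w : List (Fin (k + 1))) (s : ℕ) :
    2 ^ s * A.wordProb w ≤ T w s + 2 := by
  have := (abs_le.1 (hT w s)).1; linarith

theorem MarkovSystem.IsTable.ge (hT : A.IsTable T) (w : List (Fin (k + 1))) (s : ℕ) :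
    (T w s : ℝ) ≤ 2 ^ s * A.wordProb w + 2 := by
  have := (abs_le.1 (hT w s)).2; linarith

theorem wordProb_pair (a b : Fin (k + 1)) : A.wordProb [a, b] = A.init a * A.trans a b := by
  simp [MarkovSystem.wordProb, transProd]

/-- The tolerance `4` of the integer test and the table error `2` add up to `6`. In the converse
`typicalWord_of_isTypical` a tolerance `2` and the table error fit into `4`. -/
theorem TypicalWord.isTypical (hT : A.IsTable T) {e : ℕ} {x : ℤ → Fin (k + 1)} {lo hi : ℤ}
    (hle : lo ≤ hi + 1) (h : TypicalWord T e (wordFrom x lo (hi + 1 - lo).toNat)) :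
    IsTypical A (6 * eps e) x lo hi := by
  intro a b
  obtain ⟨h1, h2⟩ := h a b
  rw [length_wordFrom, pairs_wordFrom] at h1 h2
  have hn : (((hi + 1 - lo).toNat : ℕ) : ℝ) = hi + 1 - lo := by
    have : (((hi + 1 - lo).toNat : ℕ) : ℤ) = hi + 1 - lo := by omega
    exact_mod_cast this
  have h1' : (pairCount x lo hi a b * 2 ^ e : ℝ) ≤
      (hi + 1 - lo) * T [a, b] e + 4 * (hi + 1 - lo) := by rw [← hn]; exact_mod_cast h1
  have h2' : ((hi + 1 - lo) * T [a, b] e : ℝ) ≤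
      pairCount x lo hi a b * 2 ^ e + 4 * (hi + 1 - lo) := by rw [← hn]; exact_mod_cast h2
  have hl : (0 : ℝ) ≤ hi + 1 - lo := by rw [← hn]; positivity
  have t1 := mul_le_mul_of_nonneg_left (hT.le [a, b] e) hl
  have t2 := mul_le_mul_of_nonneg_left (hT.ge [a, b] e) hl
  rw [wordProb_pair] at t1 t2
  have h2e : (0 : ℝ) < 2 ^ e := by positivity
  rw [eps, mul_one_div, div_mul_eq_mul_div, le_div_iff₀ h2e, ← abs_of_pos h2e, ← abs_mul,
    abs_le]
  constructor <;> nlinarith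

theorem typicalWord_of_isTypical (hT : A.IsTable T) {e : ℕ} {x : ℤ → Fin (k + 1)} {lo hi : ℤ}
    (hle : lo ≤ hi + 1) (h : IsTypical A (2 * eps e) x lo hi) :
    TypicalWord T e (wordFrom x lo (hi + 1 - lo).toNat) := by
  intro a b
  have h := h a b
  rw [length_wordFrom, pairs_wordFrom]
  have hn : (((hi + 1 - lo).toNat : ℕ) : ℝ) = hi + 1 - lo := by
    have : (((hi + 1 - lo).toNat : ℕ) : ℤ) = hi + 1 - lo := by omega
    exact_mod_cast this
  have hl : (0 : ℝ) ≤ hi + 1 - lo := by rw [← hn]; positivity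
  have t1 := mul_le_mul_of_nonneg_left (hT.le [a, b] e) hl
  have t2 := mul_le_mul_of_nonneg_left (hT.ge [a, b] e) hl
  rw [wordProb_pair] at t1 t2
  have h2e : (0 : ℝ) < 2 ^ e := by positivity
  rw [eps, mul_one_div, div_mul_eq_mul_div, le_div_iff₀ h2e, ← abs_of_pos h2e, ← abs_mul,
    abs_le] at h
  constructor
  · have : (pairCount x lo hi a b * 2 ^ e : ℝ) ≤
      (hi + 1 - lo) * T [a, b] e + 4 * (hi + 1 - lo) := by nlinarith
    rw [← hn] at this; exact_mod_cast this
  · have : ((hi + 1 - lo) * T [a, b] e : ℝ) ≤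
      pairCount x lo hi a b * 2 ^ e + 4 * (hi + 1 - lo) := by nlinarith
    rw [← hn] at this; exact_mod_cast this

open Classical in
-- The table values are raised by `2` on the atypical side and lowered by `2` on the other, so the
-- integer test is sound for the true probabilities at every precision `s`.
theorem Concentrated.le (hT : A.IsTable T) {e s j : ℕ} {v : List (Fin (k + 1))}
    (h : Concentrated T e s j v) :
    ∑ v' ∈ (similarWords v).filter fun v' => ¬ TypicalWord T e v', A.wordProb v' ≤
      eps j * ∑ v' ∈ similarWords v, A.wordProb v' := by
  unfold Concentrated at h
  have h' : (∑ v' ∈ (similarWords v).filter fun v' => ¬ TypicalWord T e v', ((T v' s : ℝ) + 2)) *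
      2 ^ j + 2 * (similarWords v).card ≤ ∑ v' ∈ similarWords v, (T v' s : ℝ) := by
    exact_mod_cast h
  have h1 := Finset.sum_le_sum fun v' (_ : v' ∈ (similarWords v).filter fun v' =>
    ¬ TypicalWord T e v') => hT.le v' s
  have h2 := Finset.sum_le_sum fun v' (_ : v' ∈ similarWords v) => hT.ge v' s
  rw [← Finset.mul_sum] at h1
  rw [Finset.sum_add_distrib, ← Finset.mul_sum, Finset.sum_const, nsmul_eq_mul] at h2
  rw [eps, one_div, inv_mul_eq_div, le_div_iff₀ (by positivity)]
  have h3 := mul_le_mul_of_nonneg_right h1 (show (0 : ℝ) ≤ 2 ^ j by positivity)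
  have h4 : (0 : ℝ) < 2 ^ s := by positivity
  refine le_of_mul_le_mul_left ?_ h4
  linarith

open Classical in
-- With a factor of `2` to spare in the true ratio (`j + 1` instead of `j`), the errors of the
-- finitely many table values become negligible as `s` grows.
theorem eventually_concentrated (hT : A.IsTable T) {e j : ℕ} {v : List (Fin (k + 1))}
    (h : (∑ v' ∈ (similarWords v).filter fun v' => ¬ TypicalWord T e v', A.wordProb v') *
      2 ^ (j + 1) ≤ ∑ v' ∈ similarWords v, A.wordProb v') :
    ∀ᶠ s in atTop, Concentrated T e s j v := by
  set P := ∑ v' ∈ similarWords v, A.wordProb v' with hP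
  set Q := ∑ v' ∈ (similarWords v).filter fun v' => ¬ TypicalWord T e v', A.wordProb v' with hQ
  set n : ℝ := ((similarWords v).card : ℝ) with hn
  have hP0 : 0 < P := Finset.sum_pos (fun v' _ => A.wordProb_pos v')
    ⟨v, Finset.mem_filter.2 ⟨mem_words.2 rfl, rfl⟩⟩
  have ht : Tendsto (fun s : ℕ => (2 : ℝ) ^ s * (P / 2)) atTop atTop :=
    (tendsto_pow_atTop_atTop_of_one_lt one_lt_two).atTop_mul_const (by positivity)
  filter_upwards [ht.eventually_ge_atTop (4 * n * 2 ^ j + 4 * n)] with s hs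
  unfold Concentrated
  have h1 := Finset.sum_le_sum fun v' (_ : v' ∈ (similarWords v).filter fun v' =>
    ¬ TypicalWord T e v') => hT.ge v' s
  have h2 := Finset.sum_le_sum fun v' (_ : v' ∈ similarWords v) => hT.le v' s
  rw [Finset.sum_add_distrib, ← Finset.mul_sum, Finset.sum_const, nsmul_eq_mul] at h1
  rw [← Finset.mul_sum, Finset.sum_add_distrib, Finset.sum_const, nsmul_eq_mul] at h2
  have hc : (((similarWords v).filter fun v' => ¬ TypicalWord T e v').card : ℝ) ≤ n := by
    rw [hn]; exact_mod_cast Finset.card_filter_le _ _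
  rw [← hP] at h2
  have : (∑ v' ∈ (similarWords v).filter fun v' => ¬ TypicalWord T e v', ((T v' s : ℝ) + 2)) *
      2 ^ j + 2 * (similarWords v).card ≤ ∑ v' ∈ similarWords v, (T v' s : ℝ) := by
    rw [Finset.sum_add_distrib, Finset.sum_const, nsmul_eq_mul, ← hn]
    have h5 : (0 : ℝ) < 2 ^ j := by positivity
    have h6 : (0 : ℝ) < 2 ^ s := by positivity
    have h3 := mul_le_mul_of_nonneg_right (h1.trans (add_le_add_right (mul_le_mul_of_nonneg_right hc
      zero_le_two) _)) h5.le
    have h4 := mul_le_mul_of_nonneg_left h h6.le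
    have h7 := mul_le_mul_of_nonneg_right hc h5.le
    rw [pow_succ] at h4
    nlinarith
  exact_mod_cast this

end Words
end

/-! ### Layers: finite data certifying nice positions -/

noncomputable section

variable {k : ℕ}

/-- The parameters of a layer: the threshold `N` for the delimiting blocks of zeros, the radius `W`
of the window on which membership is decided, the precision `s` of the approximations to the
probabilities, and the list of the words of length `2 W + 1` outside the layer. -/
abbrev LayerData (k : ℕ) : Type := ℕ × ℕ × ℕ × List (List (Fin (k + 1)))

/-- The word of radius `W` around the position `t`. -/
def wordAround (x : ℤ → Fin (k + 1)) (W : ℕ) (t : ℤ) : List (Fin (k + 1)) :=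
  wordFrom x (t - W) (2 * W + 1)

open Classical in
/-- The position `t` lies in the core of a part `[lo, hi]` of `x` with threshold `N`, which is long,
typical, has few positions of the bad set of the previous layer, and whose pattern of zeros has
mostly typical fillers. -/
structure NiceAt (T : List (Fin (k + 1)) → ℕ → ℕ) (e j len W : ℕ) (B : List (List (Fin (k + 1))))
    (N s : ℕ) (x : ℤ → Fin (k + 1)) (t lo c d hi : ℤ) : Prop where
  part : IsPart N (fun i => x i = 0) lo c d hi
  c_le : c ≤ t
  le_d : t ≤ d
  long : len ≤ ((Finset.Icc lo hi).filter fun i => x i ≠ 0).card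
  typical : TypicalWord T e (wordFrom x lo (hi + 1 - lo).toNat)
  few : ((Finset.Icc lo hi).filter fun i => wordAround x W i ∈ B).card * 2 ^ e ≤ (hi + 1 - lo).toNat
  conc : Concentrated T e s j (wordFrom x lo (hi + 1 - lo).toNat)

/-- Niceness is translation invariant and depends only on the symbols within distance `W + 1` of the
part. This allows it to be read off a finite word. -/
theorem NiceAt.shift {T : List (Fin (k + 1)) → ℕ → ℕ} {e j len W : ℕ} {B : List (List (Fin (k + 1)))}
    {N s : ℕ} {x y : ℤ → Fin (k + 1)} {t lo c d hi : ℤ} (h : NiceAt T e j len W B N s x t lo c d hi)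
    {r : ℤ} (hxy : ∀ i, lo - W - 1 ≤ i → i ≤ hi + W + 1 → x i = y (i + r)) :
    NiceAt T e j len W B N s y (t + r) (lo + r) (c + r) (d + r) (hi + r) := by
  have e1 : (hi + r + 1 - (lo + r)).toNat = (hi + 1 - lo).toNat := by omega
  have e2 : wordFrom y (lo + r) (hi + 1 - lo).toNat = wordFrom x lo (hi + 1 - lo).toNat :=
    wordFrom_congr fun j hj => by
      rw [hxy _ (by omega) (by omega)]; congr 1; ring
  have key : ∀ p q : ℤ → Prop, (∀ i, lo ≤ i → i ≤ hi → (p i ↔ q (i + r))) →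
      ∀ [DecidablePred p] [DecidablePred q],
      ((Finset.Icc (lo + r) (hi + r)).filter q).card = ((Finset.Icc lo hi).filter p).card := by
    intro p q hpq _ _
    symm
    refine Finset.card_nbij' (fun i => i + r) (fun i => i - r) ?_ ?_ ?_ ?_
    · intro i h
      simp only [Finset.coe_filter, Finset.mem_Icc, Set.mem_ofPred_eq] at h ⊢
      exact ⟨by omega, (hpq i h.1.1 h.1.2).1 h.2⟩
    · intro i h
      simp only [Finset.coe_filter, Finset.mem_Icc, Set.mem_ofPred_eq] at h ⊢
      refine ⟨by omega, (hpq (i - r) (by omega) (by omega)).2 ?_⟩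
      rw [sub_add_cancel]; exact h.2
    · intro i _; simp
    · intro i _; simp
  refine ⟨(h.part.congr fun i a b => ?_).shift r, by linarith [h.c_le], by linarith [h.le_d], ?_, ?_, ?_,
    ?_⟩
  · rw [hxy i (by omega) (by omega)]
  · rw [key (fun i => x i ≠ 0) _ fun i a b => by rw [hxy i (by omega) (by omega)]]
    exact h.long
  · rw [e1, e2]; exact h.typical
  · rw [e1, key (fun i => wordAround x W i ∈ B) _ fun i a b => ?_]
    · exact h.few
    · unfold wordAround
      rw [wordFrom_congr fun j hj => ?_]
      rw [hxy _ (by omega) (by omega)]; congr 1; ring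
  · rw [e1, e2]; exact h.conc

/-- The word `w` of length `2 W' + 1` guarantees that its centre is nice. -/
def NiceWord (T : List (Fin (k + 1)) → ℕ → ℕ) (e j len W : ℕ) (B : List (List (Fin (k + 1))))
    (N W' s : ℕ) (w : List (Fin (k + 1))) : Prop :=
  ∃ lo c d hi : ℕ, W + 1 ≤ lo ∧ hi + W + 1 ≤ 2 * W' ∧
    NiceAt T e j len W B N s (MarkovSystem.extendWord w 0) W' lo c d hi

theorem extendWord_wordFrom (x : ℤ → Fin (k + 1)) (u : ℤ) {n : ℕ} {i : ℤ} (h0 : 0 ≤ i) (h1 : i < n) :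
    MarkovSystem.extendWord (wordFrom x u n) 0 i = x (i + u) := by
  rw [MarkovSystem.extendWord, getD_wordFrom _ _ (by omega)]; congr 1; omega

theorem niceWord_iff {T : List (Fin (k + 1)) → ℕ → ℕ} {e j len W : ℕ} {B : List (List (Fin (k + 1)))}
    {N W' s : ℕ} {x : ℤ → Fin (k + 1)} {t : ℤ} :
    NiceWord T e j len W B N W' s (wordAround x W' t) ↔ ∃ lo c d hi : ℤ,
      t - W' + W + 1 ≤ lo ∧ hi + W + 1 ≤ t + W' ∧ NiceAt T e j len W B N s x t lo c d hi := by
  constructor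
  · rintro ⟨lo, c, d, hi, h1, h2, h⟩
    have := h.shift (y := x) (r := t - W') fun i a b => by
      rw [wordAround, extendWord_wordFrom x _ (by omega) (by push_cast; omega)]
    rw [show (W' : ℤ) + (t - W') = t by ring] at this
    exact ⟨_, _, _, _, by omega, by omega, this⟩
  · rintro ⟨lo, c, d, hi, h1, h2, h⟩
    have := h.shift (y := MarkovSystem.extendWord (wordAround x W' t) 0) (r := W' - t) fun i a b => by
      rw [wordAround, extendWord_wordFrom x _ (by omega) (by push_cast; omega)]
      congr 1; ring
    rw [show t + ((W' : ℤ) - t) = W' by ring] at this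
    have a1 := h.part.lo_le
    have a2 := h.part.c_le
    have a3 := h.part.le_hi
    refine ⟨(lo + (W' - t)).toNat, (c + (W' - t)).toNat, (d + (W' - t)).toNat,
      (hi + (W' - t)).toNat, by omega, by omega, ?_⟩
    convert this using 1 <;> omega

/-- The bad words of a layer have small probability. -/
def SmallLayer (T : List (Fin (k + 1)) → ℕ → ℕ) (e : ℕ) (st : LayerData k) : Prop :=
  (st.2.2.2.map fun w => T w st.2.2.1 + 2).sum * 2 ^ (e + 4) ≤ 2 ^ st.2.2.1

/-- The layer `st'` refines the layer `st` of rank `m`. -/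
def NextLayer (T : List (Fin (k + 1)) → ℕ → ℕ) (c₀ : ℕ) (L : ℕ → ℕ) (m : ℕ)
    (st st' : LayerData k) : Prop :=
  st.1 < st'.1 ∧ SmallLayer T (m + 1 + c₀) st' ∧ ∀ w ∈ words k (2 * st'.2.1 + 1), w ∉ st'.2.2.2 →
    NiceWord T (m + 1 + c₀) (m + 1) (L (m + 1) + 4 ^ (m + 1 + c₀)) st.2.1 st.2.2.2 st'.1 st'.2.1
      st'.2.2.1 w

namespace IsPart

variable {m M : ℕ} {z : ℤ → Prop} {lo c d hi lo' c' d' hi' : ℤ}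

/-- A part around a position of a part with a larger threshold is contained in it. -/
theorem nested (h : IsPart M z lo c d hi) (h' : IsPart m z lo' c' d' hi') (hm : m ≤ M) {t : ℤ}
    (h1 : lo ≤ t) (h2 : t ≤ hi) (h3 : c' ≤ t) (h4 : t ≤ d') : lo ≤ lo' ∧ hi' ≤ hi := by
  have a1 := h.lo_le
  have a2 := h.le_hi
  have a3 := h'.lo_le
  have a4 := h'.le_hi
  have hp := h'.pos
  have b1 : ∀ u, lo ≤ u → u < c → u < c' ∨ d' < u := fun u =>
    h'.le_core (by omega) h.left
  have b2 : ∀ u, d < u → u ≤ hi → u < c' ∨ d' < u := fun u v1 v2 =>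
    h'.le_core (s := d + 1) (e := hi + 1) (by omega) (fun i i1 i2 => h.right i (by omega) (by omega))
      (by omega) (by omega)
  have b3 := b1 t h1
  have b4 : d < t → _ := fun v => b2 t v h2
  have b5 := b1 (c - 1) (by omega) (by omega)
  have b6 := b2 (d + 1) (by omega) (by omega)
  constructor
  · by_contra! hc
    exact h.not_lo (h'.left _ (by omega) (by omega))
  · by_contra! hc
    exact h.not_hi (h'.right _ (by omega) (by omega))

end IsPart

/-! ### Nice positions yield good skeletons -/

section Soundness

variable {A : MarkovSystem k} {T : List (Fin (k + 1)) → ℕ → ℕ} {c₀ : ℕ} {L : ℕ → ℕ}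
  {st : ℕ → LayerData k}

theorem restrict_blockZeros {x : ℤ → Fin (k + 1)} {lo hi lo' hi' : ℤ} (h1 : lo ≤ lo') (h2 : hi' ≤ hi) :
    (Skeleton.mk lo hi (blockZeros x lo hi)).restrict lo' hi' =
      ⟨lo', hi', blockZeros x lo' hi'⟩ := by
  unfold Skeleton.restrict
  congr 1
  ext i
  simp only [Finset.mem_inter, mem_blockZeros, Finset.mem_Icc]
  constructor
  · rintro ⟨⟨-, a⟩, b⟩; exact ⟨b, a⟩
  · rintro ⟨b, a⟩; exact ⟨⟨⟨by omega, by omega⟩, a⟩, b⟩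

theorem size_blockZeros (x : ℤ → Fin (k + 1)) {lo hi : ℤ} :
    (Skeleton.mk lo hi (blockZeros x lo hi)).size = (hi + 1 - lo).toNat := by
  rw [Skeleton.size_eq (blockZeros_subset x lo hi), Skeleton.window, Int.card_Icc]

theorem card_nonzero_le_length (x : ℤ → Fin (k + 1)) (lo hi : ℤ) :
    ((Finset.Icc lo hi).filter fun i => x i ≠ 0).card ≤
      (Skeleton.mk lo hi (blockZeros x lo hi)).length := by
  refine Finset.card_le_card fun i hi => ?_
  rw [Finset.mem_filter] at hi
  refine Finset.mem_sdiff.2 ⟨hi.1, fun h => hi.2 (mem_blockZeros.1 h).2.1⟩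

theorem two_le_threshold (h0 : st 0 = (1, 0, 0, [])) (hst : ∀ m, NextLayer T c₀ L m (st m) (st (m + 1)))
    (m : ℕ) : 2 ≤ (st (m + 1)).1 ∧ (st m).1 ≤ (st (m + 1)).1 := by
  have hmono : StrictMono fun m => (st m).1 := strictMono_nat_of_lt_succ fun m => (hst m).1
  have := hmono.monotone (Nat.zero_le m)
  have h1 := (hst m).1
  simp only [h0] at this
  omega

theorem exists_niceAt (hst : ∀ m, NextLayer T c₀ L m (st m) (st (m + 1))) {m : ℕ}
    {x : ℤ → Fin (k + 1)} {t : ℤ} (h : wordAround x (st (m + 1)).2.1 t ∉ (st (m + 1)).2.2.2) :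
    ∃ lo c d hi : ℤ, NiceAt T (m + 1 + c₀) (m + 1) (L (m + 1) + 4 ^ (m + 1 + c₀)) (st m).2.1
      (st m).2.2.2 (st (m + 1)).1 (st (m + 1)).2.2.1 x t lo c d hi := by
  obtain ⟨lo, c, d, hi, -, -, h⟩ := niceWord_iff.1 ((hst m).2.2 _ (mem_words.2 (by simp [wordAround])) h)
  exact ⟨lo, c, d, hi, h⟩

/-- Every position of the part whose surroundings are not bad for the preceding layer lies in the
core of a nice part of that layer. This smaller part is nested in the given one, since thresholds
increase, and is good by induction. The remaining positions are few by `NiceAt.few`. -/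
theorem NiceAt.good (hT : A.IsTable T) (h0 : st 0 = (1, 0, 0, []))
    (hst : ∀ m, NextLayer T c₀ L m (st m) (st (m + 1))) : ∀ {m : ℕ} {x : ℤ → Fin (k + 1)}
    {t lo c d hi : ℤ}, NiceAt T (m + 1 + c₀) (m + 1) (L (m + 1) + 4 ^ (m + 1 + c₀)) (st m).2.1
      (st m).2.2.2 (st (m + 1)).1 (st (m + 1)).2.2.1 x t lo c d hi →
    GoodSkeleton (fun m => (st m).1) (A.HasTypicalFiller c₀) (fun m => m + c₀) (m + 1)
      ⟨lo, hi, blockZeros x lo hi⟩ := by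
  intro m
  induction m with
  | zero =>
    intro x t lo c d hi h
    have a1 := h.part.lo_le
    have a2 := h.part.c_le
    have a3 := h.part.le_hi
    refine ⟨x, fun i hi => (mem_blockZeros.1 hi).2.1, by change lo ≤ hi; omega,
      TypicalWord.isTypical (lo := lo) (hi := hi) hT (by omega) h.typical, ?_⟩
    have h1 := h.long
    have h2 := card_nonzero_le_length x lo hi
    have h3 : (Skeleton.mk lo hi (blockZeros x lo hi)).length ≤
        (Skeleton.mk lo hi (blockZeros x lo hi)).size := Nat.le_add_right _ _
    rw [zero_add] at h1
    exact (Nat.le_add_left _ _).trans (h1.trans (h2.trans h3))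
  | succ m ih =>
    intro x t lo c d hi h
    classical
    obtain ⟨hN1, hN2⟩ := two_le_threshold h0 hst m
    obtain ⟨-, hN3⟩ := two_le_threshold h0 hst (m + 1)
    have hex : ∀ i, ∃ q : ℤ × ℤ × ℤ × ℤ, wordAround x (st (m + 1)).2.1 i ∉ (st (m + 1)).2.2.2 →
        NiceAt T (m + 1 + c₀) (m + 1) (L (m + 1) + 4 ^ (m + 1 + c₀)) (st m).2.1
          (st m).2.2.2 (st (m + 1)).1 (st (m + 1)).2.2.1 x i q.1 q.2.1 q.2.2.1 q.2.2.2 := by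
      intro i
      by_cases hi : wordAround x (st (m + 1)).2.1 i ∈ (st (m + 1)).2.2.2
      · exact ⟨(0, 0, 0, 0), fun h => absurd hi h⟩
      · obtain ⟨a, b, c, d, h⟩ := exists_niceAt hst hi
        exact ⟨(a, b, c, d), fun _ => h⟩
    choose f hf using hex
    refine ⟨((Finset.Icc lo hi).filter fun i =>
      wordAround x (st (m + 1)).2.1 i ∉ (st (m + 1)).2.2.2).image f, ?_, ?_⟩
    · intro q hq
      obtain ⟨i, hi', rfl⟩ := Finset.mem_image.1 hq
      obtain ⟨h1, h2⟩ := Finset.mem_filter.1 hi'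
      rw [Finset.mem_Icc] at h1
      have hn := hf i h2
      obtain ⟨n1, n2⟩ := h.part.nested hn.part hN3 h1.1 h1.2 hn.c_le hn.le_d
      refine ⟨n1, n2, ?_, ?_⟩
      · exact (isPart_blockZeros_iff hN1 n1 n2 h.part.not_lo h.part.not_hi).2 hn.part
      · rw [restrict_blockZeros n1 n2]
        exact ih hn
    · rw [size_blockZeros]
      refine le_trans (Nat.mul_le_mul_right _ (Finset.card_le_card fun i hi' => ?_)) h.few
      obtain ⟨h1, h2⟩ := Finset.mem_sdiff.1 hi'
      refine Finset.mem_filter.2 ⟨h1, ?_⟩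
      by_contra hc
      refine h2 (Finset.mem_biUnion.2 ⟨f i, Finset.mem_image_of_mem _
        (Finset.mem_filter.2 ⟨h1, hc⟩), ?_⟩)
      exact Finset.mem_Icc.2 ⟨(hf i hc).c_le, (hf i hc).le_d⟩

end Soundness
end

noncomputable section

variable {k : ℕ}

/-! ### Fillers and words -/

theorem zeroPattern_eq_iff {v v' : List (Fin (k + 1))} (h : v'.length = v.length) :
    zeroPattern v' = zeroPattern v ↔ ∀ j < v.length,
      ((v'.getD j 0 = 0 ∧ (v'.getD (j - 1) 0 = 0 ∨ v'.getD (j + 1) 0 = 0)) ↔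
        (v.getD j 0 = 0 ∧ (v.getD (j - 1) 0 = 0 ∨ v.getD (j + 1) 0 = 0))) := by
  unfold zeroPattern
  rw [h, List.map_inj_left]
  simp only [List.mem_range, decide_eq_decide]

/-- The positions `lo`, `lo + 1`, `hi - 1`, `hi` carry zeros. -/
structure ZeroEnds (x : ℤ → Fin (k + 1)) (lo hi : ℤ) : Prop where
  lt : lo < hi
  left : x lo = 0
  left' : x (lo + 1) = 0
  right : x hi = 0
  right' : x (hi - 1) = 0

theorem IsPart.zeroEnds {m : ℕ} (hm : 2 ≤ m) {x : ℤ → Fin (k + 1)} {lo c d hi : ℤ}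
    (h : IsPart m (fun i => x i = 0) lo c d hi) : ZeroEnds x lo hi := by
  have a1 := h.lo_le
  have a2 := h.c_le
  have a3 := h.le_hi
  exact ⟨by omega, h.left _ (by omega) (by omega), h.left _ (by omega) (by omega),
    h.right _ (by omega) (by omega), h.right _ (by omega) (by omega)⟩

/-- At the two ends of the word, the truncated index `j - 1` and the default value `0` simulate a
neighbouring zero. This is correct because the word begins and ends with two zeros. -/
theorem blockZero_wordFrom {x : ℤ → Fin (k + 1)} {lo hi : ℤ} (h : ZeroEnds x lo hi) {j : ℕ}
    (hj : j < (hi + 1 - lo).toNat) {v : List (Fin (k + 1))}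
    (hv : v = wordFrom x lo (hi + 1 - lo).toNat) :
    (v.getD j 0 = 0 ∧ (v.getD (j - 1) 0 = 0 ∨ v.getD (j + 1) 0 = 0)) ↔
      lo + (j : ℤ) ∈ blockZeros x lo hi := by
  subst hv
  have hlt := h.lt
  rw [getD_wordFrom _ _ hj, getD_wordFrom _ _ (by omega), mem_blockZeros, IsBlockZero]
  rcases Nat.eq_zero_or_pos j with rfl | hj0
  · rw [getD_wordFrom _ _ (by omega)]
    have := h.left
    have := h.left'
    simp_all
    try omega
  · rw [show lo + ((j - 1 : ℕ) : ℤ) = lo + j - 1 by omega]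
    by_cases hj1 : j + 1 < (hi + 1 - lo).toNat
    · rw [getD_wordFrom _ _ hj1, show lo + ((j + 1 : ℕ) : ℤ) = lo + j + 1 by push_cast; ring]
      exact ⟨fun h => ⟨⟨by omega, by omega⟩, h⟩, fun h => h.2⟩
    · have e : lo + (j : ℤ) = hi := by omega
      rw [e]
      have := h.right
      have := h.right'
      simp_all
      omega

theorem fill_of_mem {S : Skeleton} (F : S.blanks → Fin (k + 1)) {i : ℤ} (h : i ∈ S.blanks) :
    fill S F i = F ⟨i, h⟩ := by simp [fill, h]

theorem fill_of_notMem {S : Skeleton} (F : S.blanks → Fin (k + 1)) {i : ℤ} (h : i ∉ S.blanks) :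
    fill S F i = 0 := by simp [fill, h]

theorem wordOn_eq_wordFrom (S : Skeleton) (y : ℤ → Fin (k + 1)) :
    wordOn S y = wordFrom y S.lo (S.hi + 1 - S.lo).toNat := rfl

theorem wordOn_fill_injective (S : Skeleton) :
    Function.Injective fun F : S.blanks → Fin (k + 1) => wordOn S (fill S F) := by
  intro F G h
  simp only [wordOn_eq_wordFrom] at h
  funext ⟨i, hi⟩
  have hw := Finset.mem_Icc.1 (Finset.mem_sdiff.1 hi).1
  have := wordFrom_inj h (j := (i - S.lo).toNat) (by omega)
  rwa [show S.lo + ((i - S.lo).toNat : ℤ) = i by omega, fill_of_mem F hi, fill_of_mem G hi] at this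

section

variable {x : ℤ → Fin (k + 1)} {lo hi : ℤ}

theorem zeroEnds_fill (h : ZeroEnds x lo hi)
    (F : (Skeleton.mk lo hi (blockZeros x lo hi)).blanks → Fin (k + 1)) :
    ZeroEnds (fill ⟨lo, hi, blockZeros x lo hi⟩ F) lo hi := by
  have hlt := h.lt
  have key : ∀ i, i ∈ blockZeros x lo hi → fill ⟨lo, hi, blockZeros x lo hi⟩ F i = 0 := fun i hi =>
    fill_of_notMem F fun hb => (Finset.mem_sdiff.1 hb).2 hi
  refine ⟨h.lt, key _ ?_, key _ ?_, key _ ?_, key _ ?_⟩ <;> rw [mem_blockZeros]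
  · exact ⟨⟨by omega, by omega⟩, h.left, Or.inr h.left'⟩
  · exact ⟨⟨by omega, by omega⟩, h.left', Or.inl (by rw [add_sub_cancel_right]; exact h.left)⟩
  · exact ⟨⟨by omega, by omega⟩, h.right, Or.inl h.right'⟩
  · exact ⟨⟨by omega, by omega⟩, h.right', Or.inr (by rw [sub_add_cancel]; exact h.right)⟩

theorem blockZeros_fill (h : ZeroEnds x lo hi)
    {F : (Skeleton.mk lo hi (blockZeros x lo hi)).blanks → Fin (k + 1)}
    (hF : F ∈ fillers k ⟨lo, hi, blockZeros x lo hi⟩) :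
    blockZeros (fill ⟨lo, hi, blockZeros x lo hi⟩ F) lo hi = blockZeros x lo hi := by
  have key : ∀ i, i ∈ blockZeros x lo hi → fill ⟨lo, hi, blockZeros x lo hi⟩ F i = 0 := fun i hi =>
    fill_of_notMem F fun hb => (Finset.mem_sdiff.1 hb).2 hi
  have hE := zeroEnds_fill h F
  have hlt := h.lt
  simp only [fillers, Finset.mem_filter, Finset.mem_univ, true_and] at hF
  ext i
  rw [mem_blockZeros]
  constructor
  · rintro ⟨h1, h2, h3⟩
    by_contra hc
    have := hF i (Finset.mem_sdiff.2 ⟨Finset.mem_Icc.2 h1, hc⟩) h2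
    tauto
  · intro hi'
    obtain ⟨h1, h2, h3⟩ := mem_blockZeros.1 hi'
    refine ⟨h1, key i hi', ?_⟩
    rcases eq_or_ne i lo with rfl | hl
    · exact Or.inr hE.left'
    rcases eq_or_ne i hi with rfl | hr
    · exact Or.inl hE.right'
    rcases h3 with h3 | h3
    · refine Or.inl (key _ (mem_blockZeros.2 ⟨⟨by omega, by omega⟩, h3, Or.inr ?_⟩))
      rw [sub_add_cancel]; exact h2
    · refine Or.inr (key _ (mem_blockZeros.2 ⟨⟨by omega, by omega⟩, h3, Or.inl ?_⟩))
      rw [add_sub_cancel_right]; exact h2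

/-- Words with the zero pattern of the skeleton are exactly its filled words. Thereby the measure of
sets of fillers becomes a sum over words, to which the finite test `Concentrated` applies. -/
theorem similarWords_eq_image (h : ZeroEnds x lo hi) :
    similarWords (wordFrom x lo (hi + 1 - lo).toNat) =
      (fillers k ⟨lo, hi, blockZeros x lo hi⟩).image fun F =>
        wordOn ⟨lo, hi, blockZeros x lo hi⟩ (fill ⟨lo, hi, blockZeros x lo hi⟩ F) := by
  set S : Skeleton := ⟨lo, hi, blockZeros x lo hi⟩ with hS
  have hlt := h.lt
  ext v
  simp only [similarWords, Finset.mem_filter, mem_words, length_wordFrom, Finset.mem_image]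
  constructor
  · rintro ⟨hl, hv⟩
    rw [zeroPattern_eq_iff (by simpa using hl), length_wordFrom] at hv
    have hv' : ∀ j < (hi + 1 - lo).toNat, ((v.getD j 0 = 0 ∧
        (v.getD (j - 1) 0 = 0 ∨ v.getD (j + 1) 0 = 0)) ↔ lo + (j : ℤ) ∈ blockZeros x lo hi) :=
      fun j hj => (hv j hj).trans (blockZero_wordFrom h hj rfl)
    have hfill : ∀ j < (hi + 1 - lo).toNat,
        fill S (fun i => v.getD ((i : ℤ) - lo).toNat 0) (lo + (j : ℕ)) = v.getD j 0 := by
      intro j hj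
      by_cases hb : lo + (j : ℤ) ∈ blockZeros x lo hi
      · rw [((hv' j hj).2 hb).1]
        exact fill_of_notMem _ fun h => (Finset.mem_sdiff.1 h).2 hb
      · rw [fill_of_mem _ (Finset.mem_sdiff.2 ⟨Finset.mem_Icc.2 ⟨by simp [hS], by simp [hS]; omega⟩, hb⟩)]
        simp
    refine ⟨fun i => v.getD ((i : ℤ) - lo).toNat 0, ?_, ?_⟩
    · simp only [fillers, Finset.mem_filter, Finset.mem_univ, true_and]
      intro i hb hi0
      obtain ⟨hb1, hb2⟩ := Finset.mem_sdiff.1 hb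
      have hb1 := Finset.mem_Icc.1 hb1
      simp only [hS] at hb1 hb2
      have hnl : i ≠ lo := by
        rintro rfl
        exact hb2 (mem_blockZeros.2 ⟨⟨by omega, by omega⟩, h.left, Or.inr h.left'⟩)
      have hnr : i ≠ hi := by
        rintro rfl
        exact hb2 (mem_blockZeros.2 ⟨⟨by omega, by omega⟩, h.right, Or.inl h.right'⟩)
      have e0 := hfill (i - lo).toNat (by omega)
      have e1 := hfill ((i - lo).toNat - 1) (by omega)
      have e2 := hfill ((i - lo).toNat + 1) (by omega)
      have e3 := hv' (i - lo).toNat (by omega)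
      rw [show lo + ((i - lo).toNat : ℤ) = i by omega] at e0 e3
      rw [show lo + (((i - lo).toNat - 1 : ℕ) : ℤ) = i - 1 by omega] at e1
      rw [show lo + (((i - lo).toNat + 1 : ℕ) : ℤ) = i + 1 by omega] at e2
      rw [← e0, ← e1, ← e2] at e3
      rw [hi0] at e3
      have := mt e3.1 hb2
      tauto
    · refine List.ext_getElem (by simp [wordOn_eq_wordFrom, hl, hS]) fun j h1 h2 => ?_
      have h3 : j < (hi + 1 - lo).toNat := by rwa [← hl]
      have := hfill j h3
      rw [List.getD_eq_getElem _ _ h2] at this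
      rw [← this]
      simp only [wordOn_eq_wordFrom]
      rw [getElem_wordFrom]
  · rintro ⟨F, hF, rfl⟩
    refine ⟨by simp [wordOn_eq_wordFrom, hS], ?_⟩
    rw [zeroPattern_eq_iff (by simp [wordOn_eq_wordFrom, hS]), length_wordFrom]
    intro j hj
    rw [blockZero_wordFrom h hj rfl]
    refine (blockZero_wordFrom (zeroEnds_fill h F) hj rfl).trans ?_
    rw [blockZeros_fill h hF]

open Classical in
theorem fillerMeasure_filter (A : MarkovSystem k) (h : ZeroEnds x lo hi)
    (p : List (Fin (k + 1)) → Prop) :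
    fillerMeasure A ⟨lo, hi, blockZeros x lo hi⟩
      ((fillers k ⟨lo, hi, blockZeros x lo hi⟩).filter fun F =>
        p (wordOn ⟨lo, hi, blockZeros x lo hi⟩ (fill ⟨lo, hi, blockZeros x lo hi⟩ F))) =
      ∑ v ∈ (similarWords (wordFrom x lo (hi + 1 - lo).toNat)).filter p, A.wordProb v := by
  rw [similarWords_eq_image h, Finset.filter_image,
    Finset.sum_image fun F _ G _ hFG => wordOn_fill_injective _ hFG]
  rfl

theorem fillerMeasure_fillers (A : MarkovSystem k) (h : ZeroEnds x lo hi) :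
    fillerMeasure A ⟨lo, hi, blockZeros x lo hi⟩ (fillers k ⟨lo, hi, blockZeros x lo hi⟩) =
      ∑ v ∈ similarWords (wordFrom x lo (hi + 1 - lo).toNat), A.wordProb v := by
  rw [similarWords_eq_image h, Finset.sum_image fun F _ G _ hFG => wordOn_fill_injective _ hFG]
  rfl

end
end

noncomputable section

/-! ### Computable functions and predicates -/

attribute [fun_prop] Computable

namespace Computable

variable {α β γ : Type*} [Primcodable α] [Primcodable β] [Primcodable γ]

@[fun_prop] theorem id_fun : Computable fun x : α => x := Computable.id

@[fun_prop] theorem const_fun (c : β) : Computable fun _ : α => c := Computable.const c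

@[fun_prop] theorem comp_fun {g : β → γ} {f : α → β} (hg : Computable g) (hf : Computable f) :
    Computable fun x => g (f x) := hg.comp hf

@[fun_prop] theorem mk_fun {g : α → γ} {f : α → β} (hf : Computable f) (hg : Computable g) :
    Computable fun x => (f x, g x) := hf.pair hg

@[fun_prop] theorem fst_fun {f : α → β × γ} (hf : Computable f) : Computable fun x => (f x).1 :=
  Computable.fst.comp hf

@[fun_prop] theorem snd_fun {f : α → β × γ} (hf : Computable f) : Computable fun x => (f x).2 :=
  Computable.snd.comp hf

@[fun_prop] theorem add_fun {f g : α → ℕ} (hf : Computable f) (hg : Computable g) :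
    Computable fun x => f x + g x := Primrec.nat_add.to_comp.comp hf hg

@[fun_prop] theorem mul_fun {f g : α → ℕ} (hf : Computable f) (hg : Computable g) :
    Computable fun x => f x * g x := Primrec.nat_mul.to_comp.comp hf hg

@[fun_prop] theorem sub_fun {f g : α → ℕ} (hf : Computable f) (hg : Computable g) :
    Computable fun x => f x - g x := Primrec.nat_sub.to_comp.comp hf hg

@[fun_prop] theorem div_fun {f g : α → ℕ} (hf : Computable f) (hg : Computable g) :
    Computable fun x => f x / g x := Primrec.nat_div.to_comp.comp hf hg

@[fun_prop] theorem pow_fun {f : α → ℕ} (c : ℕ) (hf : Computable f) :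
    Computable fun x => c ^ f x := by
  refine (Computable.nat_rec hf (Computable.const 1)
    (h := fun (_ : α) (p : ℕ × ℕ) => p.2 * c) ?_).of_eq fun a => ?_
  · exact Computable₂.mk (by fun_prop)
  · induction f a with
    | zero => rfl
    | succ n ih => rw [pow_succ, ← ih]

@[fun_prop] theorem getD_fun {f : α → List β} {g : α → ℕ} {d : β} (hf : Computable f)
    (hg : Computable g) : Computable fun x => (f x).getD (g x) d :=
  (Primrec.list_getD d).to_comp.comp hf hg

@[fun_prop] theorem length_fun {f : α → List β} (hf : Computable f) :
    Computable fun x => (f x).length := Computable.list_length.comp hf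

@[fun_prop] theorem drop_fun {f : α → List β} {g : α → ℕ} (hf : Computable f) (hg : Computable g) :
    Computable fun x => (f x).drop (g x) := Primrec.list_drop.to_comp.comp hg hf

@[fun_prop] theorem take_fun {f : α → List β} {g : α → ℕ} (hf : Computable f) (hg : Computable g) :
    Computable fun x => (f x).take (g x) := Primrec.list_take.to_comp.comp hg hf

theorem ite_fun {p : α → Prop} [DecidablePred p] (hp : ComputablePred p) {f g : α → β} (hf : Computable f)
    (hg : Computable g) : Computable fun a => if p a then f a else g a := by
  simpa [Bool.cond_decide] using hp.decide.cond hf hg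

theorem sum_range {f : α → ℕ} {g : α → ℕ → ℕ} (hf : Computable f)
    (hg : Computable fun p : α × ℕ => g p.1 p.2) :
    Computable fun a => ∑ j ∈ Finset.range (f a), g a j := by
  refine (Computable.nat_rec hf (Computable.const 0)
    (h := fun (a : α) (p : ℕ × ℕ) => p.2 + g a p.1) ?_).of_eq fun a => ?_
  · have : Computable fun q : α × ℕ × ℕ => g q.1 q.2.1 :=
      hg.comp (g := fun q : α × ℕ × ℕ => (q.1, q.2.1)) (by fun_prop)
    exact Computable₂.mk (by fun_prop)
  · induction f a with
    | zero => rfl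
    | succ n ih => rw [Finset.sum_range_succ, ← ih]

theorem sum_list {f : α → List β} {g : α → β → ℕ} (hf : Computable f)
    (hg : Computable fun p : α × β => g p.1 p.2) :
    Computable fun a => ((f a).map (g a)).sum := by
  have h1 : Computable fun p : α × ℕ => (Option.casesOn ((f p.1)[p.2]?) 0 (g p.1) : ℕ) := by
    refine Computable.option_casesOn (Computable.list_getElem?.comp (by fun_prop) (by fun_prop))
      (Computable.const 0) ?_
    exact Computable₂.mk (hg.comp (g := fun q : (α × ℕ) × β => (q.1.1, q.2)) (by fun_prop))
  refine (sum_range (f := fun a => (f a).length)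
    (g := fun a j => (Option.casesOn ((f a)[j]?) 0 (g a) : ℕ)) (by fun_prop) h1).of_eq fun a => ?_
  induction f a with
  | nil => rfl
  | cons b l ih =>
    rw [List.length_cons, Finset.sum_range_succ', add_comm]
    simp only [List.getElem?_cons_succ, List.getElem?_cons_zero, List.map_cons, List.sum_cons, ih]

theorem card_filter_range {f : α → ℕ} {p : α → ℕ → Prop} [∀ a, DecidablePred (p a)]
    (hf : Computable f)
    (hp : ComputablePred fun q : α × ℕ => p q.1 q.2) :
    Computable fun a => ((Finset.range (f a)).filter (p a)).card := by
  simp only [Finset.card_filter]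
  exact sum_range (g := fun a j => if p a j then 1 else 0) hf
    (ite_fun hp (const_fun 1) (const_fun 0))

end Computable

namespace ComputablePred

variable {α β : Type*} [Primcodable α] [Primcodable β]

theorem comp {p : β → Prop} (hp : ComputablePred p) {f : α → β} (hf : Computable f) :
    ComputablePred fun a => p (f a) := by
  obtain ⟨_, hp⟩ := hp
  exact ⟨inferInstance, hp.comp hf⟩

theorem le {f g : α → ℕ} (hf : Computable f) (hg : Computable g) :
    ComputablePred fun a => f a ≤ g a :=
  ComputablePred.comp (p := fun q : ℕ × ℕ => q.1 ≤ q.2)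
    (PrimrecPred.computablePred Primrec.nat_le) (f := fun a => (f a, g a)) (by fun_prop)

theorem lt {f g : α → ℕ} (hf : Computable f) (hg : Computable g) :
    ComputablePred fun a => f a < g a := le (f := fun a => f a + 1) (by fun_prop) hg

theorem eq {f g : α → β} (hf : Computable f) (hg : Computable g) :
    ComputablePred fun a => f a = g a := by
  classical
  exact ComputablePred.comp (p := fun q : β × β => q.1 = q.2)
    (PrimrecPred.computablePred Primrec.eq) (f := fun a => (f a, g a)) (by fun_prop)

theorem and {p q : α → Prop} (hp : ComputablePred p) (hq : ComputablePred q) :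
    ComputablePred fun a => p a ∧ q a := by
  obtain ⟨f, hf, rfl⟩ := computable_iff.1 hp
  obtain ⟨g, hg, rfl⟩ := computable_iff.1 hq
  exact computable_iff.2 ⟨fun a => f a && g a, Primrec.and.to_comp.comp hf hg, by simp⟩

theorem or {p q : α → Prop} (hp : ComputablePred p) (hq : ComputablePred q) :
    ComputablePred fun a => p a ∨ q a :=
  (hp.not.and hq.not).not.of_eq fun a => by tauto

theorem imp {p q : α → Prop} (hp : ComputablePred p) (hq : ComputablePred q) :
    ComputablePred fun a => p a → q a :=
  (hp.and hq.not).not.of_eq fun a => by tauto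

theorem iff {p q : α → Prop} (hp : ComputablePred p) (hq : ComputablePred q) :
    ComputablePred fun a => (p a ↔ q a) :=
  ((hp.imp hq).and (hq.imp hp)).of_eq fun a => by tauto

theorem mem_list {f : α → β} {g : α → List β} (hf : Computable f) (hg : Computable g) :
    ComputablePred fun a => f a ∈ g a := by
  have h : PrimrecRel fun (L : List β) (b : β) => ∃ c ∈ L, c = b :=
    PrimrecRel.exists_mem_list Primrec.eq
  exact (ComputablePred.comp (p := fun q : List β × β => ∃ c ∈ q.1, c = q.2)
    (PrimrecPred.computablePred h) (f := fun a => (g a, f a)) (by fun_prop)).of_eq fun a => by simp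

theorem forall_mem_list {f : α → List β} {p : α → β → Prop} (hf : Computable f)
    (hp : ComputablePred fun q : α × β => p q.1 q.2) :
    ComputablePred fun a => ∀ b ∈ f a, p a b := by
  classical
  -- The number of failures is computable; the universal statement says that it vanishes.
  have := Computable.sum_list (g := fun a b => if p a b then 0 else 1) hf
    (Computable.ite_fun hp (by fun_prop) (by fun_prop))
  refine (eq this (Computable.const 0)).of_eq fun a => ?_
  rw [List.sum_eq_zero_iff]
  simp

theorem forall_lt {f : α → ℕ} {p : α → ℕ → Prop} (hf : Computable f)
    (hp : ComputablePred fun q : α × ℕ => p q.1 q.2) :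
    ComputablePred fun a => ∀ n < f a, p a n := by
  have : Computable fun a => List.range (f a) := Primrec.list_range.to_comp.comp hf
  exact (forall_mem_list this hp).of_eq fun a => by simp

theorem exists_lt {f : α → ℕ} {p : α → ℕ → Prop} (hf : Computable f)
    (hp : ComputablePred fun q : α × ℕ => p q.1 q.2) :
    ComputablePred fun a => ∃ n < f a, p a n :=
  (forall_lt (p := fun a n => ¬ p a n) hf hp.not).not.of_eq fun a => by push Not; rfl

theorem forall_finite {ι : Type*} [Finite ι] {p : ι → α → Prop} (hp : ∀ i, ComputablePred (p i)) :
    ComputablePred fun a => ∀ i, p i a := by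
  classical
  have := Fintype.ofFinite ι
  have h : ∀ s : Finset ι, ComputablePred fun a => ∀ i ∈ s, p i a := by
    intro s
    induction s using Finset.induction_on with
    | empty =>
      exact (le (Computable.const 0) (Computable.const 0)).of_eq fun a => by simp
    | insert i s hi ih => exact ((hp i).and ih).of_eq fun a => by simp
  exact (h Finset.univ).of_eq fun a => by simp

/-- Unbounded search. -/
theorem exists_choice [Inhabited β] {p : α → β → Prop}
    (hp : ComputablePred fun q : α × β => p q.1 q.2) (h : ∀ a, ∃ b, p a b) :
    ∃ f : α → β, Computable f ∧ ∀ a, p a (f a) := by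
  classical
  have h1 : Computable fun n : ℕ => (Encodable.decode n : Option β).getD default :=
    Computable.option_getD Computable.decode (Computable.const default)
  have h2 : ∀ a, ∃ n : ℕ, p a ((Encodable.decode n : Option β).getD default) := fun a => by
    obtain ⟨b, hb⟩ := h a
    exact ⟨Encodable.encode b, by simpa using hb⟩
  have h3 := Computable.find (P := fun a n => p a ((Encodable.decode n : Option β).getD default))
    (ComputablePred.comp hp (f := fun q : α × ℕ => (q.1, (Encodable.decode q.2 : Option β).getD default))
      (Computable.fst.pair (h1.comp Computable.snd))) h2
  exact ⟨_, h1.comp h3, fun a => Nat.find_spec (h2 a)⟩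

end ComputablePred

/-! ### Enumeration of words -/

section Words

variable {k : ℕ}

/-- The list of all words of length `n`. -/
def allWords (k : ℕ) : ℕ → List (List (Fin (k + 1)))
  | 0 => [[]]
  | n + 1 => (allWords k n).flatMap fun w => (List.finRange (k + 1)).map fun a => a :: w

theorem mem_allWords {n : ℕ} : ∀ {w : List (Fin (k + 1))}, w ∈ allWords k n ↔ w.length = n := by
  induction n with
  | zero => intro w; simp [allWords]
  | succ n ih =>
    intro w
    simp only [allWords, List.mem_flatMap, List.mem_map, List.mem_finRange, true_and, ih]
    constructor
    · rintro ⟨v, hv, a, rfl⟩; simp [hv]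
    · intro h
      cases w with
      | nil => simp at h
      | cons a v => exact ⟨v, by simpa using h, a, rfl⟩

theorem nodup_allWords (n : ℕ) : (allWords k n).Nodup := by
  induction n with
  | zero => simp [allWords]
  | succ n ih =>
    rw [allWords, List.nodup_flatMap]
    refine ⟨fun w _ => (List.nodup_finRange _).map fun a b h => (List.cons.inj h).1, ?_⟩
    refine ih.imp fun {v w} hvw => ?_
    rw [Function.onFun, List.disjoint_left]
    rintro _ h1 h2
    obtain ⟨a, -, rfl⟩ := List.mem_map.1 h1
    obtain ⟨b, -, h⟩ := List.mem_map.1 h2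
    exact hvw (List.cons.inj h).2.symm

theorem toFinset_allWords (n : ℕ) : (allWords k n).toFinset = words k n := by
  ext w; rw [List.mem_toFinset, mem_allWords, mem_words]

theorem computable_allWords : Computable (allWords k) := by
  refine Primrec.to_comp ?_
  refine (Primrec.nat_rec₁ (f := fun (_ : ℕ) (l : List (List (Fin (k + 1)))) =>
    l.flatMap fun w => (List.finRange (k + 1)).map fun a => a :: w) [[]] ?_).of_eq fun n => ?_
  · refine Primrec.list_flatMap Primrec.snd (Primrec.list_map (Primrec.const _) ?_)
    exact Primrec.list_cons.comp Primrec.snd (Primrec.snd.comp Primrec.fst)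
  · induction n with
    | zero => rfl
    | succ n ih => rw [allWords, ← ih]

variable {α : Type*} [Primcodable α]

open Classical in
theorem Computable.sum_words {f : α → ℕ} {p : α → List (Fin (k + 1)) → Prop}
    {g : α → List (Fin (k + 1)) → ℕ} (hf : Computable f)
    (hp : ComputablePred fun q : α × List (Fin (k + 1)) => p q.1 q.2)
    (hg : Computable fun q : α × List (Fin (k + 1)) => g q.1 q.2) :
    Computable fun a => ∑ v ∈ (words k (f a)).filter (p a), g a v := by
  have := Computable.sum_list (g := fun a v => if p a v then g a v else 0)
    (computable_allWords.comp hf) (Computable.ite_fun hp hg (by fun_prop))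
  refine this.of_eq fun a => ?_
  rw [Finset.sum_filter, ← toFinset_allWords, List.sum_toFinset _ (nodup_allWords _)]

theorem ComputablePred.forall_words {f : α → ℕ} {p : α → List (Fin (k + 1)) → Prop}
    (hf : Computable f) (hp : ComputablePred fun q : α × List (Fin (k + 1)) => p q.1 q.2) :
    ComputablePred fun a => ∀ v ∈ words k (f a), p a v :=
  (ComputablePred.forall_mem_list (computable_allWords.comp hf) hp).of_eq fun a => by
    simp only [mem_allWords, mem_words]

end Words
end

noncomputable section

/-! ### Computability of the layers -/

section

variable {k : ℕ} {α : Type*} [Primcodable α]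

theorem computable_pairs {v : α → List (Fin (k + 1))} (hv : Computable v) (x y : Fin (k + 1)) :
    Computable fun a => pairs (v a) x y := by
  classical
  refine (Computable.card_filter_range (f := fun a => (v a).length - 1)
    (p := fun a j => (v a).getD j 0 = x ∧ (v a).getD (j + 1) 0 = y) (by fun_prop)
    (.and (.eq (by fun_prop) (by fun_prop)) (.eq (by fun_prop) (by fun_prop)))).of_eq fun a => ?_
  unfold pairs
  congr!

variable {T : List (Fin (k + 1)) → ℕ → ℕ}
  (hT : Computable fun q : List (Fin (k + 1)) × ℕ => T q.1 q.2)

include hT in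
theorem computable_table {v : α → List (Fin (k + 1))} {s : α → ℕ} (hv : Computable v)
    (hs : Computable s) : Computable fun a => T (v a) (s a) :=
  hT.comp (g := fun a => (v a, s a)) (by fun_prop)

include hT in
theorem computablePred_typicalWord {v : α → List (Fin (k + 1))} {e : α → ℕ} (hv : Computable v)
    (he : Computable e) : ComputablePred fun a => TypicalWord T (e a) (v a) := by
  refine ComputablePred.forall_finite fun x => ComputablePred.forall_finite fun y => ?_
  have h1 := computable_pairs hv x y
  have h2 : Computable fun a => T [x, y] (e a) := computable_table hT (by fun_prop) he
  exact .and (.le (by fun_prop) (by fun_prop)) (.le (by fun_prop) (by fun_prop))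

theorem computablePred_zeroPattern {v v' : α → List (Fin (k + 1))} (hv : Computable v)
    (hv' : Computable v') :
    ComputablePred fun a => (v' a).length = (v a).length ∧ zeroPattern (v' a) = zeroPattern (v a) := by
  have key : ∀ {u : α → List (Fin (k + 1))}, Computable u → ComputablePred fun q : α × ℕ =>
      ((u q.1).getD q.2 0 = 0 ∧ ((u q.1).getD (q.2 - 1) 0 = 0 ∨ (u q.1).getD (q.2 + 1) 0 = 0)) :=
    fun hu => .and (.eq (by fun_prop) (by fun_prop)) (.or (.eq (by fun_prop) (by fun_prop))
      (.eq (by fun_prop) (by fun_prop)))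
  have h := ComputablePred.forall_lt (f := fun a => (v a).length) (p := fun a j =>
    ((v' a).getD j 0 = 0 ∧ ((v' a).getD (j - 1) 0 = 0 ∨ (v' a).getD (j + 1) 0 = 0)) ↔
      ((v a).getD j 0 = 0 ∧ ((v a).getD (j - 1) 0 = 0 ∨ (v a).getD (j + 1) 0 = 0)))
    (by fun_prop) (.iff (key hv') (key hv))
  exact (ComputablePred.and (.eq (f := fun a => (v' a).length) (g := fun a => (v a).length)
    (by fun_prop) (by fun_prop)) h).of_eq fun a => and_congr_right fun hl =>
      (zeroPattern_eq_iff hl).symm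

open Classical in
theorem computable_sum_similar {v : α → List (Fin (k + 1))} (hv : Computable v)
    {p : α → List (Fin (k + 1)) → Prop} {g : α → List (Fin (k + 1)) → ℕ}
    (hp : ComputablePred fun q : α × List (Fin (k + 1)) => p q.1 q.2)
    (hg : Computable fun q : α × List (Fin (k + 1)) => g q.1 q.2) :
    Computable fun a => ∑ v' ∈ (similarWords (v a)).filter (p a), g a v' := by
  have h1 : ComputablePred fun q : α × List (Fin (k + 1)) =>
      (q.2.length = (v q.1).length ∧ zeroPattern q.2 = zeroPattern (v q.1)) ∧ p q.1 q.2 :=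
    .and (computablePred_zeroPattern (v := fun q : α × List (Fin (k + 1)) => v q.1) (by fun_prop)
      Computable.snd) hp
  refine (Computable.sum_words (f := fun a => (v a).length) (p := fun a w =>
    (w.length = (v a).length ∧ zeroPattern w = zeroPattern (v a)) ∧ p a w) (by fun_prop) h1 hg).of_eq fun a => ?_
  refine Finset.sum_congr ?_ fun _ _ => rfl
  ext w
  simp only [similarWords, Finset.mem_filter, mem_words]
  tauto

include hT in
theorem computablePred_concentrated {v : α → List (Fin (k + 1))} {e s j : α → ℕ}
    (hv : Computable v) (he : Computable e) (hs : Computable s) (hj : Computable j) :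
    ComputablePred fun a => Concentrated T (e a) (s a) (j a) (v a) := by
  classical
  have ht : Computable fun q : α × List (Fin (k + 1)) => T q.2 (s q.1) :=
    computable_table hT Computable.snd (by fun_prop)
  have htrue : ComputablePred fun _ : α × List (Fin (k + 1)) => True :=
    (ComputablePred.le (Computable.const 0) (Computable.const 0)).of_eq fun a => by simp
  have h1 := computable_sum_similar (p := fun a v' => ¬ TypicalWord T (e a) v')
    (g := fun a v' => T v' (s a) + 2) hv
    (computablePred_typicalWord hT Computable.snd (by fun_prop)).not (by fun_prop)
  have h2 := computable_sum_similar (p := fun _ _ => True) (g := fun a v' => T v' (s a)) hv htrue ht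
  have h3 := computable_sum_similar (p := fun _ _ => True) (g := fun _ _ => 1) hv htrue (by fun_prop)
  simp only [Finset.filter_true] at h2 h3
  refine (ComputablePred.le (f := fun a => (∑ v' ∈ (similarWords (v a)).filter
    (fun v' => ¬ TypicalWord T (e a) v'), (T v' (s a) + 2)) * 2 ^ j a +
      2 * ∑ v' ∈ similarWords (v a), 1) (Computable.add_fun (Computable.mul_fun (by convert h1) (by fun_prop))
        (Computable.mul_fun (by fun_prop) h3)) h2).of_eq fun a => ?_
  unfold Concentrated
  rw [Finset.sum_const, smul_eq_mul, mul_one]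

/-- All quantifiers become bounded quantifiers over natural numbers, which makes the condition
decidable. The bound `1 ≤ lo` keeps the truncated `lo - 1` correct. -/
theorem isPart_natCast_iff {N : ℕ} {z : ℤ → Prop} {lo c d hi : ℕ} (hlo : 1 ≤ lo) :
    IsPart N z lo c d hi ↔ lo + N ≤ c ∧ c ≤ d ∧ d + N ≤ hi ∧ (∀ i < c, lo ≤ i → z (i : ℕ)) ∧
      ¬ z (c : ℕ) ∧ (∀ i < hi + 1, d < i → z (i : ℕ)) ∧ ¬ z (d : ℕ) ∧ ¬ z ((lo - 1 : ℕ) : ℤ) ∧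
      ¬ z ((hi + 1 : ℕ) : ℤ) ∧ ∀ i < d + 1, c ≤ i → i + N ≤ d + 1 → ∃ j < N, ¬ z ((i + j : ℕ) : ℤ) := by
  have e1 : (((lo - 1 : ℕ) : ℤ)) = lo - 1 := by omega
  rw [e1]
  push_cast
  constructor
  · intro h
    refine ⟨by exact_mod_cast h.lo_le, by exact_mod_cast h.c_le, by exact_mod_cast h.le_hi,
      fun i a b => h.left i (by omega) (by omega), h.not_c, fun i a b => h.right i (by omega) (by omega),
      h.not_d, h.not_lo, h.not_hi, fun i a b hN => ?_⟩
    obtain ⟨j, j1, j2, j3⟩ := h.no_run i (by omega) (by omega)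
    refine ⟨(j - i).toNat, by omega, ?_⟩
    rwa [show (i : ℤ) + ((j - i).toNat : ℤ) = j by omega]
  · rintro ⟨h1, h2, h3, h4, h5, h6, h7, h8, h9, h10⟩
    refine ⟨by exact_mod_cast h1, by exact_mod_cast h2, by exact_mod_cast h3, fun i a b => ?_, h5,
      fun i a b => ?_, h7, h8, h9, fun i a b => ?_⟩
    · have := h4 i.toNat (by omega) (by omega)
      rwa [show ((i.toNat : ℕ) : ℤ) = i by omega] at this
    · have := h6 i.toNat (by omega) (by omega)
      rwa [show ((i.toNat : ℕ) : ℤ) = i by omega] at this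
    · have hN : N ≠ 0 := by
        rintro rfl
        obtain ⟨j, j1, -⟩ := h10 c (by omega) le_rfl (by omega)
        omega
      obtain ⟨j, j1, j2⟩ := h10 i.toNat (by omega) (by omega) (by omega)
      exact ⟨i + j, by omega, by omega, by rwa [show ((i.toNat : ℕ) : ℤ) = i by omega] at j2⟩

theorem wordFrom_extendWord_eq (w : List (Fin (k + 1))) {u n : ℕ} (h : u + n ≤ w.length) :
    wordFrom (MarkovSystem.extendWord w 0) u n = (w.drop u).take n := by
  refine List.ext_getElem (by simp; omega) fun j h1 h2 => ?_
  rw [getElem_wordFrom, MarkovSystem.extendWord]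
  rw [length_wordFrom] at h1
  rw [show ((u : ℤ) + j - 0).toNat = u + j by omega, List.getD_eq_getElem _ _ (by omega)]
  simp

open Classical in
/-- A decidable form of `NiceWord`. -/
def NiceWordNat (T : List (Fin (k + 1)) → ℕ → ℕ) (e j len W : ℕ) (B : List (List (Fin (k + 1))))
    (N W' s : ℕ) (w : List (Fin (k + 1))) : Prop :=
  ∃ lo < w.length, ∃ c < w.length, ∃ d < w.length, ∃ hi < w.length,
    (W + 1 ≤ lo ∧ hi + W + 1 ≤ 2 * W' ∧ c ≤ W' ∧ W' ≤ d) ∧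
    (lo + N ≤ c ∧ c ≤ d ∧ d + N ≤ hi ∧ (∀ i < c, lo ≤ i → w.getD i 0 = 0) ∧
      ¬ w.getD c 0 = 0 ∧ (∀ i < hi + 1, d < i → w.getD i 0 = 0) ∧ ¬ w.getD d 0 = 0 ∧
      ¬ w.getD (lo - 1) 0 = 0 ∧ ¬ w.getD (hi + 1) 0 = 0 ∧
      ∀ i < d + 1, c ≤ i → i + N ≤ d + 1 → ∃ j < N, ¬ w.getD (i + j) 0 = 0) ∧
    len ≤ ((Finset.range (hi + 1 - lo)).filter fun i => ¬ w.getD (lo + i) 0 = 0).card ∧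
    TypicalWord T e ((w.drop lo).take (hi + 1 - lo)) ∧
    ((Finset.range (hi + 1 - lo)).filter fun i =>
      (w.drop (lo + i - W)).take (2 * W + 1) ∈ B).card * 2 ^ e ≤ hi + 1 - lo ∧
    Concentrated T e s j ((w.drop lo).take (hi + 1 - lo))

theorem card_filter_Icc_natCast {lo hi : ℕ} {p : ℤ → Prop} {q : ℕ → Prop} [DecidablePred p]
    [DecidablePred q] (h : ∀ i < hi + 1 - lo, (p ((lo + i : ℕ) : ℤ) ↔ q i)) :
    ((Finset.Icc (lo : ℤ) hi).filter p).card = ((Finset.range (hi + 1 - lo)).filter q).card := by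
  symm
  refine Finset.card_nbij' (fun i => (lo : ℤ) + (i : ℕ)) (fun i => (i - lo).toNat) ?_ ?_ ?_ ?_
  · intro i hi
    simp only [Finset.coe_filter, Finset.mem_range, Finset.mem_Icc, Set.mem_ofPred_eq] at hi ⊢
    refine ⟨by omega, ?_⟩
    have := (h i hi.1).2 hi.2
    exact_mod_cast this
  · intro i hi
    simp only [Finset.coe_filter, Finset.mem_range, Finset.mem_Icc, Set.mem_ofPred_eq] at hi ⊢
    refine ⟨by omega, (h _ (by omega)).1 ?_⟩
    rw [show ((lo + (i - lo).toNat : ℕ) : ℤ) = i by omega]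
    exact hi.2
  · intro i _; simp
  · intro i hi
    simp only [Finset.coe_filter, Finset.mem_Icc, Set.mem_ofPred_eq] at hi
    simp only; omega

theorem niceWord_iff_nat {e j len W : ℕ} {B : List (List (Fin (k + 1)))} {N W' s : ℕ}
    {w : List (Fin (k + 1))} (hw : w.length = 2 * W' + 1) :
    NiceWord T e j len W B N W' s w ↔ NiceWordNat T e j len W B N W' s w := by
  classical
  have ez : ∀ i : ℕ, MarkovSystem.extendWord w 0 (i : ℤ) = w.getD i 0 := fun i => by
    simp [MarkovSystem.extendWord]
  have key : ∀ lo c d hi : ℕ, W + 1 ≤ lo → hi + W + 1 ≤ 2 * W' →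
      (NiceAt T e j len W B N s (MarkovSystem.extendWord w 0) W' lo c d hi ↔
      (c ≤ W' ∧ W' ≤ d) ∧ (lo + N ≤ c ∧ c ≤ d ∧ d + N ≤ hi ∧ (∀ i < c, lo ≤ i → w.getD i 0 = 0) ∧
      ¬ w.getD c 0 = 0 ∧ (∀ i < hi + 1, d < i → w.getD i 0 = 0) ∧ ¬ w.getD d 0 = 0 ∧
      ¬ w.getD (lo - 1) 0 = 0 ∧ ¬ w.getD (hi + 1) 0 = 0 ∧
      ∀ i < d + 1, c ≤ i → i + N ≤ d + 1 → ∃ j < N, ¬ w.getD (i + j) 0 = 0) ∧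
    len ≤ ((Finset.range (hi + 1 - lo)).filter fun i => ¬ w.getD (lo + i) 0 = 0).card ∧
    TypicalWord T e ((w.drop lo).take (hi + 1 - lo)) ∧
    ((Finset.range (hi + 1 - lo)).filter fun i =>
      (w.drop (lo + i - W)).take (2 * W + 1) ∈ B).card * 2 ^ e ≤ hi + 1 - lo ∧
    Concentrated T e s j ((w.drop lo).take (hi + 1 - lo))) := by
    intro lo c d hi h1 h2
    have e1 : ((hi : ℤ) + 1 - lo).toNat = hi + 1 - lo := by omega
    have e2 : lo ≤ hi + 1 → wordFrom (MarkovSystem.extendWord w 0) (lo : ℤ) (hi + 1 - lo) =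
      (w.drop lo).take (hi + 1 - lo) := fun h => wordFrom_extendWord_eq w (by omega)
    have e3 : ((Finset.Icc (lo : ℤ) hi).filter fun i => MarkovSystem.extendWord w 0 i ≠ 0).card =
        ((Finset.range (hi + 1 - lo)).filter fun i => ¬ w.getD (lo + i) 0 = 0).card :=
      card_filter_Icc_natCast fun i _ => by simp only [ez, ne_eq]
    have e4 : ((Finset.Icc (lo : ℤ) hi).filter fun i =>
        wordAround (MarkovSystem.extendWord w 0) W i ∈ B).card =
        ((Finset.range (hi + 1 - lo)).filter fun i =>
          (w.drop (lo + i - W)).take (2 * W + 1) ∈ B).card :=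
      card_filter_Icc_natCast fun i _ => by
        rw [wordAround, ← wordFrom_extendWord_eq w (by omega)]
        rw [show ((lo + i : ℕ) : ℤ) - W = ((lo + i - W : ℕ) : ℤ) by omega]
    have e5 := isPart_natCast_iff (N := N) (z := fun i => MarkovSystem.extendWord w 0 i = 0)
      (lo := lo) (c := c) (d := d) (hi := hi) (by omega)
    simp only [ez] at e5
    constructor
    · intro h
      have hp := e5.1 h.part
      have a1 := h.typical
      have a2 := h.conc
      have a3 := h.few
      have a4 := h.long
      rw [e1, e2 (by omega)] at a1 a2
      rw [e1, e4] at a3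
      rw [e3] at a4
      exact ⟨⟨by exact_mod_cast h.c_le, by exact_mod_cast h.le_d⟩, hp, a4, a1, a3, a2⟩
    · rintro ⟨⟨b1, b2⟩, hp, a4, a1, a3, a2⟩
      have hp' := hp.1
      have hp2 := hp.2.1
      have hp3 := hp.2.2.1
      refine ⟨e5.2 hp, by exact_mod_cast b1, by exact_mod_cast b2, by rw [e3]; exact a4, ?_, ?_, ?_⟩
      · rw [e1, e2 (by omega)]; exact a1
      · rw [e1, e4]; exact a3
      · rw [e1, e2 (by omega)]; exact a2
  constructor
  · rintro ⟨lo, c, d, hi, h1, h2, h⟩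
    have h' := (key lo c d hi h1 h2).1 h
    have a1 := h'.2.1.1
    have a2 := h'.2.1.2.1
    have a3 := h'.2.1.2.2.1
    exact ⟨lo, by omega, c, by omega, d, by omega, hi, by omega, ⟨h1, h2, h'.1.1, h'.1.2⟩, h'.2⟩
  · rintro ⟨lo, -, c, -, d, -, hi, -, ⟨h1, h2, h3, h4⟩, h⟩
    exact ⟨lo, c, d, hi, h1, h2, (key lo c d hi h1 h2).2 ⟨⟨h3, h4⟩, h⟩⟩

theorem computablePred_partNat {N lo c d hi : α → ℕ} {w : α → List (Fin (k + 1))}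
    (hN : Computable N) (hlo : Computable lo) (hc : Computable c) (hd : Computable d)
    (hhi : Computable hi) (hw : Computable w) :
    ComputablePred fun a => lo a + N a ≤ c a ∧ c a ≤ d a ∧ d a + N a ≤ hi a ∧
      (∀ i < c a, lo a ≤ i → (w a).getD i 0 = 0) ∧
      ¬ (w a).getD (c a) 0 = 0 ∧ (∀ i < hi a + 1, d a < i → (w a).getD i 0 = 0) ∧
      ¬ (w a).getD (d a) 0 = 0 ∧
      ¬ (w a).getD (lo a - 1) 0 = 0 ∧ ¬ (w a).getD (hi a + 1) 0 = 0 ∧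
      ∀ i < d a + 1, c a ≤ i → i + N a ≤ d a + 1 → ∃ j < N a, ¬ (w a).getD (i + j) 0 = 0 := by
  refine .and (.le (by fun_prop) (by fun_prop)) (.and (.le (by fun_prop) (by fun_prop))
    (.and (.le (by fun_prop) (by fun_prop)) (.and ?_ (.and ?_ (.and ?_ (.and ?_ (.and ?_ (.and ?_ ?_))))))))
  · exact .forall_lt (by fun_prop) (.imp (.le (by fun_prop) (by fun_prop))
      (.eq (by fun_prop) (by fun_prop)))
  · exact .not (.eq (by fun_prop) (by fun_prop))
  · exact .forall_lt (by fun_prop) (.imp (.lt (by fun_prop) (by fun_prop))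
      (.eq (by fun_prop) (by fun_prop)))
  · exact .not (.eq (by fun_prop) (by fun_prop))
  · exact .not (.eq (by fun_prop) (by fun_prop))
  · exact .not (.eq (by fun_prop) (by fun_prop))
  · exact .forall_lt (by fun_prop) (.imp (.le (by fun_prop) (by fun_prop))
      (.imp (.le (by fun_prop) (by fun_prop))
        (.exists_lt (by fun_prop) (.not (.eq (by fun_prop) (by fun_prop))))))

include hT in
theorem computablePred_niceWordNat {e j len W N W' s : α → ℕ} {B : α → List (List (Fin (k + 1)))}
    {w : α → List (Fin (k + 1))} (he : Computable e) (hj : Computable j) (hlen : Computable len)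
    (hW : Computable W) (hB : Computable B) (hN : Computable N) (hW' : Computable W')
    (hs : Computable s) (hw : Computable w) :
    ComputablePred fun a => NiceWordNat T (e a) (j a) (len a) (W a) (B a) (N a) (W' a) (s a) (w a) := by
  classical
  unfold NiceWordNat
  refine .exists_lt (by fun_prop) (.exists_lt (by fun_prop) (.exists_lt (by fun_prop)
    (.exists_lt (by fun_prop) ?_)))
  refine .and ?_ (.and ?_ (.and ?_ (.and ?_ (.and ?_ ?_))))
  · exact .and (.le (by fun_prop) (by fun_prop)) (.and (.le (by fun_prop) (by fun_prop))
      (.and (.le (by fun_prop) (by fun_prop)) (.le (by fun_prop) (by fun_prop))))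
  · exact computablePred_partNat (by fun_prop) (by fun_prop) (by fun_prop) (by fun_prop)
      (by fun_prop) (by fun_prop)
  · have h : ComputablePred fun q : ((((α × ℕ) × ℕ) × ℕ) × ℕ) × ℕ =>
        ¬ (w q.1.1.1.1.1).getD (q.1.1.1.1.2 + q.2) 0 = 0 := .not (.eq (by fun_prop) (by fun_prop))
    exact .le (by fun_prop) (Computable.card_filter_range (p := fun (a : (((α × ℕ) × ℕ) × ℕ) × ℕ) i =>
      ¬ (w a.1.1.1.1).getD (a.1.1.1.2 + i) 0 = 0) (by fun_prop) h)
  · exact computablePred_typicalWord hT (by fun_prop) (by fun_prop)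
  · have h : ComputablePred fun q : ((((α × ℕ) × ℕ) × ℕ) × ℕ) × ℕ =>
        ((w q.1.1.1.1.1).drop (q.1.1.1.1.2 + q.2 - W q.1.1.1.1.1)).take
          (2 * W q.1.1.1.1.1 + 1) ∈ B q.1.1.1.1.1 := .mem_list (by fun_prop) (by fun_prop)
    exact .le (Computable.mul_fun (Computable.card_filter_range
      (p := fun (a : (((α × ℕ) × ℕ) × ℕ) × ℕ) i => ((w a.1.1.1.1).drop
        (a.1.1.1.2 + i - W a.1.1.1.1)).take (2 * W a.1.1.1.1 + 1) ∈ B a.1.1.1.1)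
        (by fun_prop) h) (by fun_prop)) (by fun_prop)
  · exact computablePred_concentrated hT (by fun_prop) (by fun_prop) (by fun_prop) (by fun_prop)

end

/-! ### A computable sequence of layers by search -/

section

variable {k : ℕ} {T : List (Fin (k + 1)) → ℕ → ℕ} {c₀ : ℕ} {L : ℕ → ℕ}

theorem computablePred_smallLayer {α : Type*} [Primcodable α]
    (hT : Computable fun q : List (Fin (k + 1)) × ℕ => T q.1 q.2)
    {e : α → ℕ} {st : α → LayerData k} (he : Computable e) (hst : Computable st) :
    ComputablePred fun a => SmallLayer T (e a) (st a) := by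
  unfold SmallLayer
  have h : Computable fun q : α × List (Fin (k + 1)) => T q.2 (st q.1).2.2.1 :=
    computable_table hT Computable.snd (by fun_prop)
  have h2 := Computable.sum_list (f := fun a => (st a).2.2.2)
    (g := fun a w => T w (st a).2.2.1 + 2) (by fun_prop) (by fun_prop)
  exact .le (by fun_prop) (by fun_prop)

theorem computablePred_nextLayer (hT : Computable fun q : List (Fin (k + 1)) × ℕ => T q.1 q.2)
    (hL : Computable L) :
    ComputablePred fun q : (ℕ × LayerData k) × LayerData k =>
      NextLayer T c₀ L q.1.1 q.1.2 q.2 := by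
  unfold NextLayer
  refine .and (.lt (by fun_prop) (by fun_prop)) (.and (computablePred_smallLayer hT (by fun_prop)
    (by fun_prop)) ?_)
  have h : ComputablePred fun q : ((ℕ × LayerData k) × LayerData k) × List (Fin (k + 1)) =>
      q.2 ∉ q.1.2.2.2.2 → NiceWordNat T (q.1.1.1 + 1 + c₀) (q.1.1.1 + 1)
        (L (q.1.1.1 + 1) + 4 ^ (q.1.1.1 + 1 + c₀)) q.1.1.2.2.1 q.1.1.2.2.2.2 q.1.2.1 q.1.2.2.1
        q.1.2.2.2.1 q.2 :=
    .imp (.not (.mem_list (by fun_prop) (by fun_prop))) (computablePred_niceWordNat hT (by fun_prop)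
      (by fun_prop) (by fun_prop) (by fun_prop) (by fun_prop) (by fun_prop) (by fun_prop)
      (by fun_prop) (by fun_prop))
  refine (ComputablePred.forall_words (f := fun q : (ℕ × LayerData k) × LayerData k =>
    2 * q.2.2.1 + 1) (p := fun q w => w ∉ q.2.2.2.2 → NiceWordNat T (q.1.1 + 1 + c₀) (q.1.1 + 1)
      (L (q.1.1 + 1) + 4 ^ (q.1.1 + 1 + c₀)) q.1.2.2.1 q.1.2.2.2.2 q.2.1 q.2.2.1
      q.2.2.2.1 w) (by fun_prop) h).of_eq fun q => ?_
  refine forall₂_congr fun w hw => forall_congr' fun _ => (niceWord_iff_nat (mem_words.1 hw)).symm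

/-- A computable sequence of layers. -/
theorem exists_computable_layers (hT : Computable fun q : List (Fin (k + 1)) × ℕ => T q.1 q.2)
    (hL : Computable L)
    (hex : ∀ m st, SmallLayer T (m + c₀) st → ∃ st', NextLayer T c₀ L m st st') :
    ∃ st : ℕ → LayerData k, Computable st ∧ st 0 = (1, 0, 0, []) ∧
      ∀ m, NextLayer T c₀ L m (st m) (st (m + 1)) := by
  -- Search must halt on every input, whereas a refinement is only known to exist for small layers.
  -- The implication makes the predicate satisfiable also for the others, which never occur in the
  -- sequence.
  have hp : ComputablePred fun q : (ℕ × LayerData k) × LayerData k =>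
      SmallLayer T (q.1.1 + c₀) q.1.2 → NextLayer T c₀ L q.1.1 q.1.2 q.2 :=
    .imp (computablePred_smallLayer hT (by fun_prop) (by fun_prop)) (computablePred_nextLayer hT hL)
  obtain ⟨f, hf, hf'⟩ := ComputablePred.exists_choice
    (p := fun (a : ℕ × LayerData k) b => SmallLayer T (a.1 + c₀) a.2 → NextLayer T c₀ L a.1 a.2 b)
    hp fun a => by
      by_cases h : SmallLayer T (a.1 + c₀) a.2
      · obtain ⟨b, hb⟩ := hex _ _ h
        exact ⟨b, fun _ => hb⟩
      · exact ⟨a.2, fun h' => absurd h' h⟩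
  let st : ℕ → LayerData k := fun n => Nat.rec (1, 0, 0, []) (fun m s => f (m, s)) n
  have hc : Computable st := by
    refine Computable.nat_rec (α := ℕ) Computable.id (Computable.const _)
      (h := fun (_ : ℕ) (p : ℕ × LayerData k) => f p) ?_
    exact Computable₂.mk (by fun_prop)
  have hsmall : ∀ m, SmallLayer T (m + c₀) (st m) := by
    intro m
    induction m with
    | zero => simp [SmallLayer, st]
    | succ m ih => exact (hf' (m, st m) ih).2.1
  exact ⟨st, hc, rfl, fun m => hf' (m, st m) (hsmall m)⟩

end
end

noncomputable section

/-! ### Existence of parts -/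

/-- The core extends from the end of the last run of `N` zeros before `q` to the start of the first
one after `p`. No run lies between them: it would have to contain `q` or `p`, these being at most
`N` apart. The non-zeros at `e` and `f` bound the two maximal blocks. -/
theorem exists_isPart {z : ℤ → Prop} {N : ℕ} {q p u u' e f : ℤ} (hq : ¬ z q) (hp : ¬ z p)
    (hqp : q < p) (hpq : p ≤ q + N) (hu : u + N ≤ q) (hu1 : ∀ j, u ≤ j → j < u + N → z j)
    (hu' : p + 1 ≤ u') (hu1' : ∀ j, u' ≤ j → j < u' + N → z j) (he : e < u) (he1 : ¬ z e)
    (hf : u' + N ≤ f) (hf1 : ¬ z f) :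
    ∃ lo c d hi, IsPart N z lo c d hi ∧ e < lo ∧ hi < f ∧ c ≤ q ∧ p ≤ d := by
  obtain ⟨i, ⟨i1, i2⟩, i3⟩ := Int.exists_greatest_of_bdd
    (P := fun i => i + N ≤ q ∧ ∀ j, i ≤ j → j < i + N → z j) ⟨q, fun i h => by omega⟩ ⟨u, hu, hu1⟩
  obtain ⟨i', ⟨i1', i2'⟩, i3'⟩ := Int.exists_least_of_bdd
    (P := fun i => p + 1 ≤ i ∧ ∀ j, i ≤ j → j < i + N → z j) ⟨p, fun i h => by omega⟩ ⟨u', hu', hu1'⟩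
  have hui := i3 u ⟨hu, hu1⟩
  have hui' := i3' u' ⟨hu', hu1'⟩
  obtain ⟨l, ⟨l1, l2⟩, l3⟩ := Int.exists_greatest_of_bdd
    (P := fun l => l < i ∧ ¬ z l) ⟨i, fun i h => by omega⟩ ⟨e, by omega, he1⟩
  obtain ⟨l', ⟨l1', l2'⟩, l3'⟩ := Int.exists_least_of_bdd
    (P := fun l => i' + N ≤ l ∧ ¬ z l) ⟨i', fun i h => by omega⟩ ⟨f, by omega, hf1⟩
  have hle := l3 e ⟨by omega, he1⟩
  have hle' := l3' f ⟨by omega, hf1⟩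
  have hc : ¬ z (i + N) := by
    intro hz
    rcases eq_or_ne (i + N) q with h | h
    · rw [h] at hz; exact hq hz
    · have := i3 (i + 1) ⟨by omega, fun j j1 j2 => by
        rcases eq_or_ne j (i + N) with rfl | hj
        · exact hz
        · exact i2 j (by omega) (by omega)⟩
      omega
  have hd : ¬ z (i' - 1) := by
    intro hz
    rcases eq_or_ne (i' - 1) p with h | h
    · rw [h] at hz; exact hp hz
    · have := i3' (i' - 1) ⟨by omega, fun j j1 j2 => by
        rcases eq_or_ne j (i' - 1) with rfl | hj
        · exact hz
        · exact i2' j (by omega) (by omega)⟩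
      omega
  refine ⟨l + 1, i + N, i' - 1, l' - 1, ⟨by omega, by omega, by omega, ?_, hc, ?_, hd, by simpa using l2,
    by simpa using l2', ?_⟩, by omega, by omega, i1, by omega⟩
  · intro j j1 j2
    by_contra hj
    rcases lt_or_ge j i with h | h
    · have := l3 j ⟨h, hj⟩; omega
    · exact hj (i2 j h j2)
  · intro j j1 j2
    by_contra hj
    rcases lt_or_ge j (i' + N) with h | h
    · exact hj (i2' j (by omega) h)
    · have := l3' j ⟨h, hj⟩; omega
  · intro j j1 j2
    by_contra! hj
    rcases lt_or_ge (j + N) (q + 1) with h | h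
    · have := i3 j ⟨by omega, hj⟩; omega
    · rcases le_or_gt j q with h' | h'
      · exact hq (hj q h' (by omega))
      · rcases le_or_gt j p with h2 | h2
        · exact hp (hj p h2 (by omega))
        · have := i3' j ⟨by omega, hj⟩; omega

namespace MarkovSystem

variable {k : ℕ} (A : MarkovSystem k)

/-- The sequences in which the words of length `n` with the property `p` do not have the right
frequency in some interval of length at least `K` that begins or ends at the origin. -/
def irregular (p : List (Fin (k + 1)) → Prop) (n : ℕ) (δ : ℝ) (K : ℕ) : Set (ℤ → Fin (k + 1)) :=
  {x | ∃ j ≥ K, δ * j < |(occurrences p n x 0 j : ℝ) - j * A.wordFreq n p| ∨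
    δ * j < |(occurrences p n x (-j) j : ℝ) - j * A.wordFreq n p|}

theorem exists_irregular_le (p : List (Fin (k + 1)) → Prop) (n : ℕ) {δ ρ : ℝ} (hδ : 0 < δ)
    (hρ : 0 < ρ) : ∀ᶠ K in atTop, A.measure.real (A.irregular p n δ K) ≤ ρ := by
  obtain ⟨K, hK⟩ := A.frequencies p n hδ hρ
  exact eventually_atTop.2 ⟨K, hK⟩

/-- An interval reaching at least `K` to both sides of the origin splits there into two intervals
for which the frequencies are controlled. -/
theorem card_of_regular {p : List (Fin (k + 1)) → Prop} [DecidablePred p] {n : ℕ} {δ : ℝ} {K : ℕ}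
    {x : ℤ → Fin (k + 1)} (hx : x ∉ A.irregular p n δ K) {s t : ℤ} (hs : s ≤ -K) (ht : K ≤ t) :
    |(((Finset.Ico s t).filter fun i => p (wordFrom x i n)).card : ℝ) - (t - s) * A.wordFreq n p| ≤
      δ * (t - s) := by
  have hx' : ∀ j ≥ K, |(occurrences p n x 0 j : ℝ) - j * A.wordFreq n p| ≤ δ * j ∧
      |(occurrences p n x (-j) j : ℝ) - j * A.wordFreq n p| ≤ δ * j := by
    intro j hj
    by_contra hc
    refine hx ⟨j, hj, ?_⟩
    rw [not_and_or, not_le, not_le] at hc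
    exact hc
  have key : ∀ (u : ℤ) (j : ℕ), ((Finset.Ico u (u + j)).filter fun i => p (wordFrom x i n)).card =
      occurrences p n x u j := by
    intro u j
    symm
    unfold occurrences
    refine Finset.card_nbij' (fun t => u + (t : ℕ)) (fun i => (i - u).toNat) ?_ ?_ ?_ ?_
    · intro i hi
      simp only [Finset.coe_filter, Finset.mem_range, Finset.mem_Ico, Set.mem_ofPred_eq] at hi ⊢
      exact ⟨by omega, hi.2⟩
    · intro i hi
      simp only [Finset.coe_filter, Finset.mem_range, Finset.mem_Ico, Set.mem_ofPred_eq] at hi ⊢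
      rw [show u + ((i - u).toNat : ℤ) = i by omega]
      exact ⟨by omega, hi.2⟩
    · intro i _; simp
    · intro i hi
      simp only [Finset.coe_filter, Finset.mem_Ico, Set.mem_ofPred_eq] at hi
      simp only; omega
  obtain ⟨j1, h1⟩ : ∃ j : ℕ, s = -j := ⟨(-s).toNat, by omega⟩
  obtain ⟨j2, h2⟩ : ∃ j : ℕ, t = j := ⟨t.toNat, by omega⟩
  subst h1 h2
  have e : (Finset.Ico (-(j1 : ℤ)) j2).filter (fun i => p (wordFrom x i n)) =
      (Finset.Ico (-(j1 : ℤ)) (-j1 + j1)).filter (fun i => p (wordFrom x i n)) ∪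
        (Finset.Ico (0 : ℤ) (0 + j2)).filter (fun i => p (wordFrom x i n)) := by
    rw [← Finset.filter_union, neg_add_cancel, zero_add, Finset.Ico_union_Ico_eq_Ico (by omega) (by omega)]
  rw [e, Finset.card_union_of_disjoint, key, key]
  · have a1 := abs_le.1 (hx' j1 (by omega)).2
    have a2 := abs_le.1 (hx' j2 (by omega)).1
    push_cast
    rw [abs_le]
    constructor <;> nlinarith
  · refine Finset.disjoint_filter_filter ?_
    rw [neg_add_cancel]
    exact Finset.Ico_disjoint_Ico_consecutive _ _ _ |>.mono_right (by rw [zero_add])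

theorem wordFreq_eq_wordProb (w : List (Fin (k + 1))) :
    A.wordFreq w.length (fun v => v = w) = A.wordProb w := by
  rw [← A.measure_wordFrom _ 0, ← A.measureReal_cylinderAt 0 w, cylinderAt_eq_wordFrom]

theorem wordFreq_ne_zero : A.wordFreq 1 (fun v => v ≠ [0]) = 1 - A.init 0 := by
  have h1 := A.wordFreq_eq_wordProb [0]
  have h2 := A.measure_wordFrom (fun v => v = [0]) 0 1
  have h3 := A.measure_wordFrom (fun v => v ≠ [0]) 0 1
  rw [List.length_singleton] at h1
  rw [← h3]
  have e : {x : ℤ → Fin (k + 1) | wordFrom x 0 1 ≠ [0]} = {x | wordFrom x 0 1 = [0]}ᶜ := rfl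
  rw [e, probReal_compl_eq_one_sub (measurableSet_wordFrom (fun v => v = [0]) 0 1), h2, h1]
  simp [wordProb, transProd]

theorem wordFrom_one (x : ℤ → Fin (k + 1)) (i : ℤ) : wordFrom x i 1 = [x i] := by
  simp [wordFrom]

theorem wordFrom_two (x : ℤ → Fin (k + 1)) (i : ℤ) : wordFrom x i 2 = [x i, x (i + 1)] := by
  simp [wordFrom, List.ofFn_succ]

theorem eventually_pr_zeros_le {ρ : ℝ} (hρ : 0 < ρ) :
    ∀ᶠ M : ℕ in atTop, ∀ s : ℤ, A.pr (Finset.Ico s (s + M)) (fun _ => 0) ≤ ρ := by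
  have hb := A.bd_pos
  have h1 := A.bd_pow_lt_one
  have ht := tendsto_pow_atTop_nhds_zero_of_lt_one (r := 1 - A.bd ^ 4) (by linarith)
    (by have := pow_pos hb 4; linarith)
  filter_upwards [ht.eventually_le_const hρ] with M hM s
  have := A.pr_union_le (D := ∅) (X := Finset.Ico s (s + M)) (Finset.disjoint_empty_left _) (fun _ => 0)
  rw [Finset.empty_union, Int.card_Ico, pr_empty, mul_one, add_sub_cancel_left, Int.toNat_natCast] at this
  exact this.trans hM

/-- The interval of length `j` contains more than `r` occurrences, so not all of them are among the
`r` positions nearest to the origin. -/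
theorem exists_occurrence {p : List (Fin (k + 1)) → Prop} {n : ℕ} {δ : ℝ} {K : ℕ}
    {x : ℤ → Fin (k + 1)} (hx : x ∉ A.irregular p n δ K) (hδ : 2 * δ ≤ A.wordFreq n p) {r j : ℕ}
    (hj : K ≤ j) (hr : r < δ * j) :
    (∃ u : ℤ, -j ≤ u ∧ u < -r ∧ p (wordFrom x u n)) ∧ ∃ u : ℤ, r ≤ u ∧ u < j ∧ p (wordFrom x u n) := by
  classical
  have hx' : (r : ℝ) < occurrences p n x 0 j ∧ (r : ℝ) < occurrences p n x (-j) j := by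
    have h1 : δ * j * 2 ≤ j * A.wordFreq n p := by nlinarith [(Nat.cast_nonneg j : (0 : ℝ) ≤ j)]
    constructor <;> by_contra hc <;> refine hx ⟨j, hj, ?_⟩
    · left
      rw [not_lt] at hc
      rw [lt_abs]; right; linarith
    · right
      rw [not_lt] at hc
      rw [lt_abs]; right; linarith
  have hx1 : r < occurrences p n x 0 j := by exact_mod_cast hx'.1
  have hx2 : r < occurrences p n x (-j) j := by exact_mod_cast hx'.2
  constructor
  · by_contra! hc
    refine hx2.not_ge ?_
    refine (Finset.card_le_card (t := Finset.Ico (j - r) j) fun t ht => ?_).trans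
      (by rw [Nat.card_Ico]; omega)
    obtain ⟨h1, h2⟩ := Finset.mem_filter.1 ht
    rw [Finset.mem_range] at h1
    rw [Finset.mem_Ico]
    refine ⟨?_, h1⟩
    by_contra h3
    exact hc (-j + (t : ℕ)) (by omega) (by omega) h2
  · by_contra! hc
    refine hx1.not_ge ?_
    refine (Finset.card_le_card (t := Finset.range r) fun t ht => ?_).trans (by simp)
    obtain ⟨h1, h2⟩ := Finset.mem_filter.1 ht
    rw [Finset.mem_range] at h1 ⊢
    by_contra h3
    exact hc (0 + (t : ℕ)) (by omega) (by omega) h2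

variable {A} {T : List (Fin (k + 1)) → ℕ → ℕ}

theorem IsTable.wordFreq_mem_le (hT : A.IsTable T) (n s : ℕ) (B : List (List (Fin (k + 1)))) :
    2 ^ s * A.wordFreq n (fun w => w ∈ B) ≤ ((B.map fun w => T w s + 2).sum : ℕ) := by
  rw [← A.measure_wordFrom _ 0]
  induction B with
  | nil => simp
  | cons w B ih =>
    have h1 : {x : ℤ → Fin (k + 1) | wordFrom x 0 n ∈ w :: B} ⊆
        cylinderAt 0 w ∪ {x | wordFrom x 0 n ∈ B} := by
      intro x hx
      rcases List.mem_cons.1 hx with h | h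
      · left
        rw [cylinderAt_eq_wordFrom, ← h]
        simp
      · exact Or.inr h
    have h2 := (measureReal_mono (μ := A.measure) h1).trans (measureReal_union_le _ _)
    rw [A.measureReal_cylinderAt] at h2
    have h3 := hT.le w s
    have h4 : (0 : ℝ) < 2 ^ s := by positivity
    rw [List.map_cons, List.sum_cons, Nat.cast_add, Nat.cast_add, Nat.cast_ofNat]
    have h5 := mul_le_mul_of_nonneg_left h2 h4.le
    linarith

theorem wordFreq_bad_le (hT : A.IsTable T) {e : ℕ} {st : LayerData k} (h : SmallLayer T e st) (n : ℕ) :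
    A.wordFreq n (fun w => w ∈ st.2.2.2) ≤ eps (e + 4) := by
  have h1 := hT.wordFreq_mem_le n st.2.2.1 st.2.2.2
  have h2 : (((st.2.2.2.map fun w => T w st.2.2.1 + 2).sum : ℕ) : ℝ) * 2 ^ (e + 4) ≤ 2 ^ st.2.2.1 := by
    exact_mod_cast h
  rw [eps, le_div_iff₀ (by positivity)]
  have h3 : (0 : ℝ) < 2 ^ st.2.2.1 := by positivity
  have h4 : (0 : ℝ) < 2 ^ (e + 4) := by positivity
  have h5 := mul_le_mul_of_nonneg_right h1 h4.le
  refine le_of_mul_le_mul_left ?_ h3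
  linarith

end MarkovSystem
end

/-! ### Regular parts around the origin -/

noncomputable section

namespace MarkovSystem

variable {k : ℕ} {A : MarkovSystem k} {T : List (Fin (k + 1)) → ℕ → ℕ}

open Classical in
/-- A part around the origin which is long, typical, and has few bad positions. -/
structure RegularPart (T : List (Fin (k + 1)) → ℕ → ℕ) (e len W : ℕ) (B : List (List (Fin (k + 1))))
    (N : ℕ) (x : ℤ → Fin (k + 1)) (lo c d hi : ℤ) : Prop where
  part : IsPart N (fun i => x i = 0) lo c d hi
  c_le : c ≤ 0
  le_d : 0 ≤ d
  long : len ≤ ((Finset.Icc lo hi).filter fun i => x i ≠ 0).card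
  typical : TypicalWord T e (wordFrom x lo (hi + 1 - lo).toNat)
  few : ((Finset.Icc lo hi).filter fun i => wordAround x W i ∈ B).card * 2 ^ e ≤ (hi + 1 - lo).toNat

/-- The core reaches at least `K + W` to both sides, so the frequencies of nonzero symbols, of pairs
and of bad words hold on the part; the extra `W` is needed because bad words start `W` positions
before their centres. -/
theorem regularPart_of_regular (hT : A.IsTable T) {e len W K : ℕ} {B : List (List (Fin (k + 1)))}
    (hB : A.wordFreq (2 * W + 1) (fun w => w ∈ B) ≤ eps (e + 1)) {N : ℕ} {x : ℤ → Fin (k + 1)}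
    (hK1 : 2 ^ e ≤ K) (hK2 : len ≤ (1 - A.init 0) / 2 * K)
    (h1 : x ∉ A.irregular (fun w => w ∈ B) (2 * W + 1) (eps (e + 1)) K)
    (h2 : x ∉ A.irregular (fun w => w ≠ [0]) 1 ((1 - A.init 0) / 2) K)
    (h3 : ∀ a b, x ∉ A.irregular (fun w => w = [a, b]) 2 (eps e) K) {lo c d hi : ℤ}
    (hp : IsPart N (fun i => x i = 0) lo c d hi) (hc : c + (K + W) ≤ 0) (hd : K + W ≤ d) :
    RegularPart T e len W B N x lo c d hi := by
  classical
  have a1 := hp.lo_le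
  have a2 := hp.le_hi
  have hg := sub_pos.2 A.init_zero_lt_one
  have hn : (((hi + 1 - lo).toNat : ℕ) : ℝ) = hi + 1 - lo := by
    have : (((hi + 1 - lo).toNat : ℕ) : ℤ) = hi + 1 - lo := by omega
    exact_mod_cast this
  have hsize : (K : ℝ) ≤ hi + 1 - lo := by
    rw [← hn]; exact_mod_cast (by omega : K ≤ (hi + 1 - lo).toNat)
  refine ⟨hp, by omega, by omega, ?_, ?_, ?_⟩
  · have h := A.card_of_regular h2 (s := lo) (t := hi + 1) (by omega) (by omega)
    have e1 : (Finset.Ico lo (hi + 1)).filter (fun i => wordFrom x i 1 ≠ [0]) =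
        (Finset.Icc lo hi).filter fun i => x i ≠ 0 := by
      ext i
      simp only [Finset.mem_filter, Finset.mem_Ico, Finset.mem_Icc, wordFrom_one, ne_eq,
        List.cons.injEq, and_true, Int.lt_add_one_iff]
    rw [e1, A.wordFreq_ne_zero] at h
    have h' := (abs_le.1 h).1
    push_cast at h'
    have : (len : ℝ) ≤ ((Finset.Icc lo hi).filter fun i => x i ≠ 0).card := by nlinarith
    exact_mod_cast this
  -- A word has one pair fewer than symbols. This discrepancy is at most `eps e` times the length,
  -- since `2 ^ e ≤ K`; hence tolerance `2 * eps e`.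
  · refine typicalWord_of_isTypical hT (by omega) fun a b => ?_
    have h := A.card_of_regular (h3 a b) (s := lo) (t := hi) (by omega) (by omega)
    have e1 : ((Finset.Ico lo hi).filter fun i => wordFrom x i 2 = [a, b]).card =
        pairCount x lo hi a b := by
      unfold pairCount
      congr 1
      ext i
      simp [wordFrom_two]
    have e2 := A.wordFreq_eq_wordProb [a, b]
    rw [List.length_cons, List.length_singleton] at e2
    rw [e1, e2, wordProb_pair] at h
    have hle : A.init a * A.trans a b ≤ 1 :=
      mul_le_one₀ (A.init_le_one a) (A.trans_pos a b).le (A.trans_lt_one a b).le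
    have hge : 0 ≤ A.init a * A.trans a b := mul_nonneg (A.init_nonneg a) (A.trans_pos a b).le
    have he : 1 ≤ eps e * (hi + 1 - lo) := by
      have : (2 : ℝ) ^ e ≤ hi + 1 - lo := le_trans (by exact_mod_cast hK1) hsize
      rw [eps, one_div, inv_mul_eq_div, one_le_div (by positivity)]
      exact this
    have h' := abs_le.1 h
    have := eps_pos e
    rw [abs_le]
    constructor <;> nlinarith
  · have h := A.card_of_regular h1 (s := lo - W) (t := hi + 1 - W) (by omega) (by omega)
    have e1 : ((Finset.Icc lo hi).filter fun i => wordAround x W i ∈ B).card =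
        ((Finset.Ico (lo - W) (hi + 1 - W)).filter fun i => wordFrom x i (2 * W + 1) ∈ B).card := by
      refine Finset.card_nbij' (fun i => i - W) (fun i => i + W) ?_ ?_ ?_ ?_
      · intro i hi
        simp only [Finset.coe_filter, Finset.mem_Icc, Finset.mem_Ico, Set.mem_ofPred_eq] at hi ⊢
        exact ⟨by omega, hi.2⟩
      · intro i hi
        simp only [Finset.coe_filter, Finset.mem_Icc, Finset.mem_Ico, Set.mem_ofPred_eq] at hi ⊢
        refine ⟨by omega, ?_⟩
        rw [wordAround, add_sub_cancel_right]; exact hi.2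
      · intro i _; simp
      · intro i _; simp
    rw [← e1] at h
    have h' := (abs_le.1 h).2
    push_cast at h'
    have h2e : (0 : ℝ) < 2 ^ e := by positivity
    have hS : (0 : ℝ) ≤ hi + 1 - lo := by rw [← hn]; positivity
    have : (((Finset.Icc lo hi).filter fun i => wordAround x W i ∈ B).card : ℝ) * 2 ^ e ≤
        ((hi + 1 - lo).toNat : ℕ) := by
      rw [hn, ← le_div_iff₀ h2e]
      have e3 : ((hi : ℝ) + 1 - lo) / 2 ^ e = 2 * eps (e + 1) * (hi + 1 - lo) := by
        rw [eps_succ, eps]; ring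
      rw [e3]
      nlinarith
    exact_mod_cast this

/-- The constants are chosen in the order `K`, `M`, `N`, `K₂`, `J`. Beyond distance `K`, frequencies
are regular, and nonzero symbols `q < 0 < p` occur within `M` positions beyond `K + W`. Then `N` is
taken larger than their distance, so that no run of `N` zeros can separate them. Such a run has
positive probability and is found within `K₂` on either side, and nonzero symbols beyond the runs
within `J`. The part of `exists_isPart` therefore lies in a window of known radius. -/
theorem exists_regularParts (hT : A.IsTable T) (e len W N₀ : ℕ) {B : List (List (Fin (k + 1)))}
    (hB : A.wordFreq (2 * W + 1) (fun w => w ∈ B) ≤ eps (e + 1)) {ρ : ℝ} (hρ : 0 < ρ) :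
    ∃ (N W' : ℕ) (Bad : Set (ℤ → Fin (k + 1))), N₀ < N ∧ 2 ≤ N ∧ A.measure.real Bad ≤ ρ ∧
      ∀ x ∉ Bad, ∃ lo c d hi : ℤ, -W' + W + 1 ≤ lo ∧ hi + W + 1 ≤ W' ∧
        RegularPart T e len W B N x lo c d hi := by
  classical
  have hg := sub_pos.2 A.init_zero_lt_one
  -- The number of exceptional events: one for each pair of symbols, three further frequencies, and
  -- two blocks of `M` zeros.
  set n : ℝ := (k + 1) * (k + 1) + 5 with hn
  have hn0 : 0 < n := by positivity
  set ρ' := ρ / n with hρ'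
  have hρ0 : 0 < ρ' := by positivity
  have hlen : ∀ᶠ K : ℕ in atTop, (len : ℝ) ≤ (1 - A.init 0) / 2 * K :=
    (tendsto_natCast_atTop_atTop.const_mul_atTop (by positivity)).eventually_ge_atTop _
  obtain ⟨K, k1, k2, k3, k4, k5⟩ := ((A.exists_irregular_le (fun w => w ∈ B) (2 * W + 1)
    (eps_pos (e + 1)) hρ0).and ((A.exists_irregular_le (fun w => w ≠ [0]) 1
      (δ := (1 - A.init 0) / 2) (by positivity) hρ0).and
    ((eventually_all.2 fun a => eventually_all.2 fun b =>
      A.exists_irregular_le (fun w => w = [a, b]) 2 (eps_pos e) hρ0).and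
      ((eventually_ge_atTop (2 ^ e)).and hlen)))).exists
  obtain ⟨M, hM⟩ := (A.eventually_pr_zeros_le hρ0).exists
  set K₁ : ℕ := K + W with hK₁
  obtain ⟨N, hN⟩ : ∃ N : ℕ, N = N₀ + 2 * K₁ + 2 * M + 2 := ⟨_, rfl⟩
  set w₀ : List (Fin (k + 1)) := List.replicate N 0 with hw₀
  have hf := A.wordProb_pos w₀
  have hfreq := A.wordFreq_eq_wordProb w₀
  have hl₀ : w₀.length = N := by simp [hw₀]
  rw [hl₀] at hfreq
  obtain ⟨K₂, m1, m2⟩ := ((A.exists_irregular_le (fun w => w = w₀) N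
    (δ := A.wordProb w₀ / 2) (by positivity) hρ0).and (eventually_ge_atTop 1)).exists
  have hJ : ∀ᶠ J : ℕ in atTop, ((K₂ + N : ℕ) : ℝ) < (1 - A.init 0) / 2 * J :=
    (tendsto_natCast_atTop_atTop.const_mul_atTop (by positivity)).eventually_gt_atTop _
  obtain ⟨J, j1, j2⟩ := (hJ.and (eventually_ge_atTop K)).exists
  let Z : ℤ → Set (ℤ → Fin (k + 1)) := fun s => agreeOn (Finset.Ico s (s + M)) fun _ => 0
  refine ⟨N, J + W + 1, (A.irregular (fun w => w ∈ B) (2 * W + 1) (eps (e + 1)) K ∪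
    (A.irregular (fun w => w ≠ [0]) 1 ((1 - A.init 0) / 2) K ∪
      (A.irregular (fun w => w = w₀) N (A.wordProb w₀ / 2) K₂ ∪ (Z (K₁ + 1) ∪ Z (-K₁ - M))))) ∪
    ⋃ q ∈ (Finset.univ : Finset (Fin (k + 1) × Fin (k + 1))),
      A.irregular (fun w => w = [q.1, q.2]) 2 (eps e) K, by omega, by omega, ?_, ?_⟩
  · have b1 := measureReal_biUnion_finset_le (μ := A.measure)
      (Finset.univ : Finset (Fin (k + 1) × Fin (k + 1)))
      fun q => A.irregular (fun w => w = [q.1, q.2]) 2 (eps e) K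
    have b2 := Finset.sum_le_card_nsmul (Finset.univ : Finset (Fin (k + 1) × Fin (k + 1))) _ _
      fun q _ => k3 q.1 q.2
    rw [nsmul_eq_mul, Finset.card_univ, Fintype.card_prod, Fintype.card_fin] at b2
    push_cast at b2
    have b3 : A.measure.real (Z (K₁ + 1)) ≤ ρ' := hM _
    have b4 : A.measure.real (Z (-K₁ - M)) ≤ ρ' := hM _
    refine (measureReal_union_le _ _).trans ?_
    have b5 := (measureReal_union_le (μ := A.measure) (Z (K₁ + 1)) (Z (-K₁ - M)))
    have b6 := (measureReal_union_le (μ := A.measure)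
      (A.irregular (fun w => w = w₀) N (A.wordProb w₀ / 2) K₂) (Z (K₁ + 1) ∪ Z (-K₁ - M)))
    have b7 := (measureReal_union_le (μ := A.measure)
      (A.irregular (fun w => w ≠ [0]) 1 ((1 - A.init 0) / 2) K)
      (A.irregular (fun w => w = w₀) N (A.wordProb w₀ / 2) K₂ ∪ (Z (K₁ + 1) ∪ Z (-K₁ - M))))
    have b8 := (measureReal_union_le (μ := A.measure)
      (A.irregular (fun w => w ∈ B) (2 * W + 1) (eps (e + 1)) K)
      (A.irregular (fun w => w ≠ [0]) 1 ((1 - A.init 0) / 2) K ∪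
      (A.irregular (fun w => w = w₀) N (A.wordProb w₀ / 2) K₂ ∪ (Z (K₁ + 1) ∪ Z (-K₁ - M)))))
    have b9 : n * ρ' = ρ := by rw [hρ']; field_simp
    have b10 : n * ρ' = (k + 1) * (k + 1) * ρ' + 5 * ρ' := by rw [hn]; ring
    linarith
  · intro x hx
    simp only [Set.mem_union, Set.mem_iUnion, Finset.mem_univ, exists_prop, true_and, not_or,
      not_exists, Prod.forall] at hx
    obtain ⟨⟨x1, x2, x3, x4, x5⟩, x6⟩ := hx
    obtain ⟨p, hp1, hp2⟩ : ∃ p, p ∈ Finset.Ico ((K₁ : ℤ) + 1) (K₁ + 1 + M) ∧ x p ≠ 0 := by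
      by_contra! hc; exact x4 hc
    obtain ⟨q, hq1, hq2⟩ : ∃ p, p ∈ Finset.Ico (-(K₁ : ℤ) - M) (-K₁ - M + M) ∧ x p ≠ 0 := by
      by_contra! hc; exact x5 hc
    rw [Finset.mem_Ico] at hp1 hq1
    have hrun := A.exists_occurrence x3 (by rw [hfreq]; linarith) (r := 0) (j := K₂) le_rfl
      (by have : (0 : ℝ) < K₂ := by exact_mod_cast m2
          push_cast; positivity)
    obtain ⟨⟨u, u1, u2, u3⟩, u', u1', u2', u3'⟩ := hrun
    have hzero : ∀ u, wordFrom x u N = w₀ → ∀ j, u ≤ j → j < u + N → x j = 0 := by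
      intro u hu j j1 j2
      have := getD_wordFrom x u (n := N) (j := (j - u).toNat) (by omega)
      rw [hu, show u + ((j - u).toNat : ℤ) = j by omega] at this
      rw [← this, hw₀, List.getD_replicate _ (by omega)]
    have z1 := hzero u u3
    have z2 := hzero u' u3'
    obtain ⟨⟨v, v1, v2, v3⟩, v', v1', v2', v3'⟩ := A.exists_occurrence x2
      (by rw [A.wordFreq_ne_zero]; linarith) (r := K₂ + N) (j := J) j2 j1
    rw [wordFrom_one, Ne, List.cons.injEq] at v3 v3'
    have c1 : u + N ≤ q := by
      by_contra hc
      rcases le_or_gt u q with h | h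
      · exact hq2 (z1 q h (by omega))
      · exact hp2 (z1 p (by omega) (by omega))
    have c2 : p + 1 ≤ u' := by
      by_contra hc
      rcases le_or_gt (u' + N) p with h | h
      · omega
      · exact hp2 (z2 p (by omega) (by omega))
    obtain ⟨lo, c, d, hi, hpart, r1, r2, r3, r4⟩ := exists_isPart (z := fun i => x i = 0) (N := N)
      (q := q) (p := p) (u := u) (u' := u') (e := v) (f := v') hq2 hp2 (by omega) (by omega) c1 z1 c2 z2
      (by omega) (by simpa using v3) (by omega) (by simpa using v3')
    refine ⟨lo, c, d, hi, by omega, by omega, ?_⟩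
    exact regularPart_of_regular hT hB k4 k5 x1 x2 x6 hpart (by omega) (by omega)

end MarkovSystem
end

/-! ### Patterns with mostly typical fillers, and refinement of layers -/

noncomputable section

variable {k : ℕ}

theorem mem_similarWords {v v' : List (Fin (k + 1))} :
    v' ∈ similarWords v ↔ v'.length = v.length ∧ zeroPattern v' = zeroPattern v := by
  rw [similarWords, Finset.mem_filter, mem_words]

theorem similarWords_congr {v v' : List (Fin (k + 1))} (h : v' ∈ similarWords v) :
    similarWords v' = similarWords v := by
  obtain ⟨h1, h2⟩ := mem_similarWords.1 h
  ext w
  rw [mem_similarWords, mem_similarWords, h1, h2]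

/-- A part depends only on the pattern of non-isolated zeros, provided that the symbols next to the
interval are nonzero. -/
theorem IsPart.similar {N : ℕ} (hN : 2 ≤ N) {x y : ℤ → Fin (k + 1)} {lo c d hi : ℤ}
    (h : IsPart N (fun i => x i = 0) lo c d hi) (h1 : y (lo - 1) ≠ 0) (h2 : y (hi + 1) ≠ 0)
    (h3 : wordFrom y lo (hi + 1 - lo).toNat ∈ similarWords (wordFrom x lo (hi + 1 - lo).toNat)) :
    IsPart N (fun i => y i = 0) lo c d hi := by
  have hz := h.zeroEnds hN
  have hlt := hz.lt
  have hpat := (mem_similarWords.1 h3).2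
  rw [zeroPattern_eq_iff (by simp), length_wordFrom] at hpat
  rw [similarWords_eq_image hz] at h3
  obtain ⟨F, hF, hFy⟩ := Finset.mem_image.1 h3
  have hy : ∀ i, lo ≤ i → i ≤ hi → y i = fill ⟨lo, hi, blockZeros x lo hi⟩ F i := by
    intro i i1 i2
    have := wordFrom_inj (u := lo) (v := lo) (n := (hi + 1 - lo).toNat) hFy
      (j := (i - lo).toNat) (by omega)
    rw [show lo + ((i - lo).toNat : ℤ) = i by omega] at this
    exact this.symm
  have hf := zeroEnds_fill hz F
  have hzy : ZeroEnds y lo hi := by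
    refine ⟨hlt, ?_, ?_, ?_, ?_⟩ <;> rw [hy _ (by omega) (by omega)]
    · exact hf.left
    · exact hf.left'
    · exact hf.right
    · exact hf.right'
  have e : blockZeros y lo hi = blockZeros x lo hi := by
    ext i
    by_cases hi' : lo ≤ i ∧ i ≤ hi
    · have := hpat (i - lo).toNat (by omega)
      rw [blockZero_wordFrom hz (by omega) rfl, blockZero_wordFrom hzy (by omega) rfl,
        show lo + ((i - lo).toNat : ℤ) = i by omega] at this
      exact this
    · simp [mem_blockZeros, hi']
  rw [← isPart_blockZeros_iff hN le_rfl le_rfl h1 h2, e]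
  exact (isPart_blockZeros_iff hN le_rfl le_rfl h.not_lo h.not_hi).2 h

namespace MarkovSystem

variable {A : MarkovSystem k} {T : List (Fin (k + 1)) → ℕ → ℕ}

/-- The sequences carrying the word `v` on `[lo, hi]`, delimited by nonzero symbols. -/
def delimited (k : ℕ) (lo hi : ℤ) (v : List (Fin (k + 1))) : Set (ℤ → Fin (k + 1)) :=
  {x | wordFrom x lo (hi + 1 - lo).toNat = v ∧ x (lo - 1) ≠ 0 ∧ x (hi + 1) ≠ 0}

theorem measurableSet_delimited (lo hi : ℤ) (v : List (Fin (k + 1))) :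
    MeasurableSet (delimited k lo hi v) := by
  have h : ∀ i : ℤ, MeasurableSet {x : ℤ → Fin (k + 1) | x i ≠ 0} := fun i =>
    measurable_pi_apply i (MeasurableSet.of_discrete (s := {a | a ≠ 0}))
  exact (measurableSet_wordFrom (fun w => w = v) lo _).inter ((h _).inter (h _))

/-- A nonzero symbol on either side can be prescribed at the cost of `bd ^ 4` each. -/
theorem exists_mem_delimited (A : MarkovSystem k) {lo hi : ℤ} (hle : lo ≤ hi) {v : List (Fin (k + 1))}
    (hv : v.length = (hi + 1 - lo).toNat) :
    ∃ y ∈ delimited k lo hi v, A.bd ^ 8 * A.wordProb v ≤ A.measure.real (delimited k lo hi v) := by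
  obtain ⟨b, hb⟩ := A.exists_ne 0
  set y : ℤ → Fin (k + 1) := fun i => if i < lo ∨ hi < i then b else extendWord v lo i with hy
  have hw : wordFrom y lo (hi + 1 - lo).toNat = v := by
    rw [← hv]
    conv_rhs => rw [← wordFrom_extendWord v lo]
    refine wordFrom_congr fun j hj => ?_
    rw [hy]
    simp only
    rw [if_neg (by omega)]
  have h1 : y (lo - 1) ≠ 0 := by rw [hy]; simp only; rw [if_pos (by omega)]; exact hb
  have h2 : y (hi + 1) ≠ 0 := by rw [hy]; simp only; rw [if_pos (by omega)]; exact hb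
  refine ⟨y, ⟨hw, h1, h2⟩, ?_⟩
  set D := Finset.Ico lo (lo + ((hi + 1 - lo).toNat : ℕ)) with hD
  have e1 := A.pr_Ico y lo (hi + 1 - lo).toNat
  rw [hw, ← hD] at e1
  have e2 := A.pr_insert_ge D (hi + 1) y
  have e3 := A.pr_insert_ge (insert (hi + 1) D) (lo - 1) y
  have hb4 := pow_pos A.bd_pos 4
  have e4 : A.bd ^ 8 * A.wordProb v ≤ A.pr (insert (lo - 1) (insert (hi + 1) D)) y := by
    rw [← e1]
    have := mul_le_mul_of_nonneg_left e2 hb4.le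
    calc A.bd ^ 8 * A.pr D y = A.bd ^ 4 * (A.bd ^ 4 * A.pr D y) := by ring
      _ ≤ _ := this.trans e3
  refine e4.trans (measureReal_mono fun x hx => ⟨?_, ?_, ?_⟩)
  · rw [← hw]
    refine wordFrom_congr fun j hj => hx _ ?_
    refine Finset.mem_insert_of_mem (Finset.mem_insert_of_mem ?_)
    rw [hD, Finset.mem_Ico]; omega
  · rw [hx _ (Finset.mem_insert_self _ _)]; exact h1
  · rw [hx _ (Finset.mem_insert_of_mem (Finset.mem_insert_self _ _))]; exact h2

open Classical in
/-- At most the fraction `2 ^ (-j)` of the words similar to `v` is not typical. -/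
def MostlyTypical (A : MarkovSystem k) (T : List (Fin (k + 1)) → ℕ → ℕ) (e j : ℕ)
    (v : List (Fin (k + 1))) : Prop :=
  (∑ v' ∈ (similarWords v).filter fun v' => ¬ TypicalWord T e v', A.wordProb v') * 2 ^ j ≤
    ∑ v' ∈ similarWords v, A.wordProb v'

theorem mostlyTypical_congr {e j : ℕ} {v v' : List (Fin (k + 1))} (h : v' ∈ similarWords v) :
    A.MostlyTypical T e j v' ↔ A.MostlyTypical T e j v := by
  unfold MostlyTypical
  rw [similarWords_congr h]

/-- Markov's inequality, class by class: if a class of similar words is not mostly typical, its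
total probability is less than `2 ^ j` times that of its atypical members. These atypical words,
delimited by nonzero symbols, describe disjoint events inside `Bad`; the delimiters cost `bd ^ 8`.
-/
theorem measure_not_mostlyTypical_le {e j N W : ℕ} (hN : 2 ≤ N) {Bad : Set (ℤ → Fin (k + 1))}
    (hBad : ∀ x, ∀ lo c d hi : ℤ, -W ≤ lo → hi ≤ W → IsPart N (fun i => x i = 0) lo c d hi → c ≤ 0 →
      0 ≤ d → ¬ TypicalWord T e (wordFrom x lo (hi + 1 - lo).toNat) → x ∈ Bad) :
    A.bd ^ 8 * A.measure.real {x | ∃ lo c d hi : ℤ, -W ≤ lo ∧ hi ≤ W ∧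
      IsPart N (fun i => x i = 0) lo c d hi ∧ c ≤ 0 ∧ 0 ≤ d ∧
      ¬ A.MostlyTypical T e j (wordFrom x lo (hi + 1 - lo).toNat)} ≤ 2 ^ j * A.measure.real Bad := by
  classical
  let good : ℤ × ℤ × List (Fin (k + 1)) → Prop := fun i => ∃ (x : ℤ → Fin (k + 1)) (c d : ℤ),
    IsPart N (fun i => x i = 0) i.1 c d i.2.1 ∧ c ≤ 0 ∧ 0 ≤ d ∧
      wordFrom x i.1 (i.2.1 + 1 - i.1).toNat = i.2.2
  have good_le : ∀ i, good i → i.1 ≤ i.2.1 ∧ i.2.2.length = (i.2.1 + 1 - i.1).toNat := by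
    rintro i ⟨x, c, d, h, -, -, hw⟩
    refine ⟨(h.zeroEnds hN).lt.le, ?_⟩
    rw [← hw, length_wordFrom]
  have good_part : ∀ i, good i → ∀ v' ∈ similarWords i.2.2, ∀ y ∈ delimited k i.1 i.2.1 v',
      ∃ c d, IsPart N (fun i => y i = 0) i.1 c d i.2.1 ∧ c ≤ 0 ∧ 0 ≤ d := by
    rintro i ⟨x, c, d, h, hc, hd, hw⟩ v' hv' y ⟨y1, y2, y3⟩
    exact ⟨c, d, h.similar hN y2 y3 (by rw [y1, hw]; exact hv'), hc, hd⟩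
  have self_mem : ∀ v : List (Fin (k + 1)), v ∈ similarWords v := fun v =>
    mem_similarWords.2 ⟨rfl, rfl⟩
  set U := (Finset.range (2 * W + 2)).biUnion (words k) with hU
  set I := (Finset.Icc (-(W : ℤ)) W ×ˢ (Finset.Icc (-(W : ℤ)) W ×ˢ U)).filter
    (fun i => good i ∧ ¬ A.MostlyTypical T e j i.2.2) with hI
  have mem_I : ∀ i, i ∈ I ↔ (-W ≤ i.1 ∧ i.2.1 ≤ W) ∧ good i ∧ ¬ A.MostlyTypical T e j i.2.2 := by
    intro i
    rw [hI, Finset.mem_filter]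
    refine and_congr_left fun ⟨hg, _⟩ => ?_
    obtain ⟨g1, g2⟩ := good_le i hg
    simp only [Finset.mem_product, Finset.mem_Icc, hU, Finset.mem_biUnion, Finset.mem_range, mem_words]
    constructor
    · rintro ⟨⟨a, -⟩, ⟨-, b⟩, -⟩; exact ⟨a, b⟩
    · rintro ⟨a, b⟩; exact ⟨⟨a, by omega⟩, ⟨by omega, b⟩, _, by omega, rfl⟩
  have hX : A.measure.real {x | ∃ lo c d hi : ℤ, -W ≤ lo ∧ hi ≤ W ∧
      IsPart N (fun i => x i = 0) lo c d hi ∧ c ≤ 0 ∧ 0 ≤ d ∧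
      ¬ A.MostlyTypical T e j (wordFrom x lo (hi + 1 - lo).toNat)} ≤ ∑ i ∈ I, A.wordProb i.2.2 := by
    have h1 := measureReal_biUnion_finset_le (μ := A.measure) I fun i => cylinderAt i.1 i.2.2
    simp only [A.measureReal_cylinderAt] at h1
    refine le_trans (measureReal_mono (μ := A.measure) ?_ (measure_ne_top _ _)) h1
    rintro x ⟨lo, c, d, hi, a1, a2, a3, a4, a5, a6⟩
    rw [Set.mem_iUnion₂]
    refine ⟨(lo, hi, wordFrom x lo (hi + 1 - lo).toNat), (mem_I _).2 ⟨⟨a1, a2⟩,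
      ⟨x, c, d, a3, a4, a5, rfl⟩, a6⟩, ?_⟩
    rw [mem_cylinderAt_wordFrom]
    exact fun _ _ => rfl
  -- The words of `I` are grouped by interval and zero pattern. Each group is a full class of
  -- similar words, because membership in `I` is invariant under similarity.
  have hfib : ∑ i ∈ I, A.wordProb i.2.2 ≤
      2 ^ j * ∑ i ∈ I.filter (fun i => ¬ TypicalWord T e i.2.2), A.wordProb i.2.2 := by
    let key : ℤ × ℤ × List (Fin (k + 1)) → ℤ × ℤ × List Bool := fun i =>
      (i.1, i.2.1, zeroPattern i.2.2)
    have hkey : ∀ i ∈ I, key i ∈ I.image key := fun i hi => Finset.mem_image_of_mem _ hi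
    rw [Finset.sum_filter (s := I) (p := fun i => ¬ TypicalWord T e i.2.2),
      ← Finset.sum_fiberwise_of_maps_to hkey, ← Finset.sum_fiberwise_of_maps_to hkey, Finset.mul_sum]
    refine Finset.sum_le_sum fun y hy => ?_
    obtain ⟨i₀, hi₀, rfl⟩ := Finset.mem_image.1 hy
    obtain ⟨hb, hg, hm⟩ := (mem_I _).1 hi₀
    have hsum : ∀ f : List (Fin (k + 1)) → ℝ,
        ∑ i ∈ I.filter (fun i => key i = key i₀), f i.2.2 = ∑ v ∈ similarWords i₀.2.2, f v := by
      intro f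
      refine Finset.sum_nbij' (fun i => i.2.2) (fun v => (i₀.1, i₀.2.1, v)) ?_ ?_ ?_ ?_ ?_
      · intro i hi
        obtain ⟨h1, h2⟩ := Finset.mem_filter.1 hi
        simp only [key, Prod.mk.injEq] at h2
        have g1 := (good_le i ((mem_I _).1 h1).2.1).2
        have g2 := (good_le i₀ hg).2
        exact mem_similarWords.2 ⟨by rw [g1, g2, h2.1, h2.2.1], h2.2.2⟩
      · intro v hv
        obtain ⟨v1, v2⟩ := mem_similarWords.1 hv
        refine Finset.mem_filter.2 ⟨(mem_I _).2 ⟨hb, ?_, ?_⟩, ?_⟩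
        · obtain ⟨g1, g2⟩ := good_le i₀ hg
          obtain ⟨y, hy, -⟩ := A.exists_mem_delimited g1 (v1.trans g2)
          obtain ⟨c, d, h1, h2, h3⟩ := good_part i₀ hg v hv y hy
          exact ⟨y, c, d, h1, h2, h3, hy.1⟩
        · simp only; rwa [mostlyTypical_congr hv]
        · simp only [key, v2]
      · intro i hi
        obtain ⟨h1, h2⟩ := Finset.mem_filter.1 hi
        simp only [key, Prod.mk.injEq] at h2
        rw [← h2.1, ← h2.2.1]
      · intro v _; rfl
      · intro i _; rfl
    rw [hsum fun v => A.wordProb v, hsum fun v => if ¬ TypicalWord T e v then A.wordProb v else 0,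
      ← Finset.sum_filter]
    unfold MostlyTypical at hm
    rw [not_le] at hm
    rw [mul_comm]
    exact hm.le
  -- A sequence has at most one part whose core contains the origin, so the delimited events are
  -- disjoint and their probabilities may be added.
  have hdis : A.bd ^ 8 * ∑ i ∈ I.filter (fun i => ¬ TypicalWord T e i.2.2), A.wordProb i.2.2 ≤
      A.measure.real Bad := by
    set J := I.filter (fun i => ¬ TypicalWord T e i.2.2) with hJ
    have hmemJ : ∀ i ∈ J, ∀ x ∈ delimited k i.1 i.2.1 i.2.2, ∃ c d,
        IsPart N (fun i => x i = 0) i.1 c d i.2.1 ∧ c ≤ 0 ∧ 0 ≤ d := fun i hi x hx =>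
      good_part i ((mem_I i).1 (Finset.mem_filter.1 hi).1).2.1 _ (self_mem _) x hx
    have h1 : A.measure.real (⋃ i ∈ J, delimited k i.1 i.2.1 i.2.2) =
        ∑ i ∈ J, A.measure.real (delimited k i.1 i.2.1 i.2.2) := by
      refine measureReal_biUnion_finset (fun i hi i' hi' hne => ?_) fun i _ =>
        measurableSet_delimited _ _ _
      rw [Function.onFun, Set.disjoint_left]
      intro x hx hx'
      obtain ⟨c, d, p1, p2, p3⟩ := hmemJ i hi x hx
      obtain ⟨c', d', p1', p2', p3'⟩ := hmemJ i' hi' x hx'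
      have a1 := p1'.lo_le
      have a2 := p1'.le_hi
      obtain ⟨e1, -, -, e2⟩ := p1.unique p1' p2 p3 (by omega) (by omega)
      refine hne (Prod.ext e1 (Prod.ext e2 ?_))
      rw [← hx.1, ← hx'.1, e1, e2]
    have h2 : (⋃ i ∈ J, delimited k i.1 i.2.1 i.2.2) ⊆ Bad := by
      intro x hx
      rw [Set.mem_iUnion₂] at hx
      obtain ⟨i, hi, hx⟩ := hx
      obtain ⟨c, d, p1, p2, p3⟩ := hmemJ i hi x hx
      obtain ⟨hiI, hty⟩ := Finset.mem_filter.1 hi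
      obtain ⟨hb, -⟩ := (mem_I i).1 hiI
      exact hBad x _ c d _ hb.1 hb.2 p1 p2 p3 (by rw [hx.1]; exact hty)
    rw [Finset.mul_sum]
    refine le_trans ?_ (h1.symm.le.trans (measureReal_mono h2))
    refine Finset.sum_le_sum fun i hi => ?_
    obtain ⟨g1, g2⟩ := good_le i ((mem_I i).1 (Finset.mem_filter.1 hi).1).2.1
    obtain ⟨y, -, hy⟩ := A.exists_mem_delimited g1 g2
    exact hy
  have hb8 := pow_pos A.bd_pos 8
  calc _ ≤ A.bd ^ 8 * (2 ^ j * ∑ i ∈ I.filter (fun i => ¬ TypicalWord T e i.2.2), A.wordProb i.2.2) :=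
        mul_le_mul_of_nonneg_left (hX.trans hfib) hb8.le
    _ = 2 ^ j * (A.bd ^ 8 * ∑ i ∈ I.filter (fun i => ¬ TypicalWord T e i.2.2), A.wordProb i.2.2) := by
        ring
    _ ≤ _ := mul_le_mul_of_nonneg_left hdis (by positivity)

theorem wordFreq_mem_list {n : ℕ} {B : List (List (Fin (k + 1)))} (hB : B.Nodup)
    (hn : ∀ w ∈ B, w.length = n) : A.wordFreq n (fun w => w ∈ B) = (B.map A.wordProb).sum := by
  rw [← List.sum_toFinset _ hB, wordFreq]
  refine Finset.sum_bij (fun w _ => List.ofFn w) (fun w hw => ?_) (fun w _ w' _ h =>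
    List.ofFn_injective h) (fun w hw => ?_) fun w _ => rfl
  · have := (@Finset.mem_filter _ _ (fun _ => Classical.propDecidable _) _ _).1 hw
    exact List.mem_toFinset.2 this.2
  · have hw := List.mem_toFinset.1 hw
    obtain ⟨v, -, rfl⟩ := Finset.mem_image.1 (mem_words.2 (hn w hw))
    exact ⟨v, (@Finset.mem_filter _ _ (fun _ => Classical.propDecidable _) _ _).2
      ⟨Finset.mem_univ _, hw⟩, rfl⟩

/-- Every layer can be refined. -/
theorem exists_nextLayer (hT : A.IsTable T) (c₀ : ℕ) (L : ℕ → ℕ) (m : ℕ) (st : LayerData k)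
    (hst : SmallLayer T (m + c₀) st) : ∃ st', NextLayer T c₀ L m st st' := by
  classical
  set e := m + 1 + c₀ with he
  obtain ⟨N₀, W, s₀, B⟩ := st
  have hb8 := pow_pos A.bd_pos 8
  -- Chosen so that `Bad`, of measure at most `ρ`, and the set `X` below, of measure at most `2 ^ (m
  -- + 2) / bd ^ 8 * ρ`, together have measure at most `eps (e + 6)`.
  set ρ : ℝ := eps (e + 6) / (1 + 2 ^ (m + 1 + 1) / A.bd ^ 8) with hρ
  have hρ0 : 0 < ρ := by have := eps_pos (e + 6); positivity
  have hB : A.wordFreq (2 * W + 1) (fun w => w ∈ B) ≤ eps (e + 1) :=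
    (wordFreq_bad_le hT hst _).trans (eps_anti (by omega))
  obtain ⟨N, W', Bad, hN1, hN2, hBad, hx⟩ := exists_regularParts hT e (L (m + 1) + 4 ^ e) W N₀ hB hρ0
  set X : Set (ℤ → Fin (k + 1)) := {x | ∃ lo c d hi : ℤ, -W' ≤ lo ∧ hi ≤ W' ∧
      IsPart N (fun i => x i = 0) lo c d hi ∧ c ≤ 0 ∧ 0 ≤ d ∧
      ¬ A.MostlyTypical T e (m + 1 + 1) (wordFrom x lo (hi + 1 - lo).toNat)} with hX
  have hXle := measure_not_mostlyTypical_le (A := A) (T := T) (e := e) (j := m + 1 + 1) (W := W') hN2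
    (Bad := Bad) (by
      intro x lo c d hi _ _ h hc hd hty
      by_contra hxB
      obtain ⟨lo', c', d', hi', -, -, h'⟩ := hx x hxB
      have a1 := h'.part.lo_le
      have a2 := h'.part.le_hi
      have b1 := h'.c_le
      have b2 := h'.le_d
      obtain ⟨rfl, -, -, rfl⟩ := h.unique h'.part hc hd (by omega) (by omega)
      exact hty h'.typical)
  have hev : ∀ x, x ∉ Bad → x ∉ X → ∀ᶠ s in atTop,
      NiceWord T e (m + 1) (L (m + 1) + 4 ^ e) W B N W' s (wordAround x W' 0) := by
    intro x hxB hxX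
    obtain ⟨lo, c, d, hi, h1, h2, h⟩ := hx x hxB
    have hm : A.MostlyTypical T e (m + 1 + 1) (wordFrom x lo (hi + 1 - lo).toNat) := by
      by_contra hc
      exact hxX ⟨lo, c, d, hi, by omega, by omega, h.part, h.c_le, h.le_d, hc⟩
    filter_upwards [eventually_concentrated hT (e := e) (j := m + 1) hm] with s hs
    exact niceWord_iff.2 ⟨lo, c, d, hi, by omega, by omega, ⟨h.part, h.c_le, h.le_d, h.long, h.typical,
      h.few, hs⟩⟩
  -- The words whose niceness is not confirmed at all large precisions. This list is not obtained
  -- effectively; only its existence matters for the search.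
  set B' : List (List (Fin (k + 1))) := (allWords k (2 * W' + 1)).filter fun w =>
    decide (¬ ∀ᶠ s in atTop, NiceWord T e (m + 1) (L (m + 1) + 4 ^ e) W B N W' s w) with hB'
  have hgood : ∀ w ∈ words k (2 * W' + 1), w ∉ B' → ∀ᶠ s in atTop,
      NiceWord T e (m + 1) (L (m + 1) + 4 ^ e) W B N W' s w := by
    intro w hw hwB
    by_contra hc
    exact hwB (List.mem_filter.2 ⟨mem_allWords.2 (mem_words.1 hw), by simpa using hc⟩)
  have hsum : (B'.map A.wordProb).sum ≤ eps (e + 6) := by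
    have h1 : A.wordFreq (2 * W' + 1) (fun w => w ∈ B') = (B'.map A.wordProb).sum :=
      wordFreq_mem_list ((nodup_allWords _).filter _)
        fun w hw => mem_allWords.1 (List.mem_filter.1 hw).1
    rw [← h1, ← A.measure_wordFrom _ (0 - W')]
    have h2 : {x : ℤ → Fin (k + 1) | wordFrom x (0 - W') (2 * W' + 1) ∈ B'} ⊆ Bad ∪ X := by
      intro x hxm
      by_contra hc
      rw [Set.mem_union, not_or] at hc
      have := (List.mem_filter.1 hxm).2
      rw [decide_eq_true_eq] at this
      exact this (hev x hc.1 hc.2)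
    have h3 : A.measure.real X ≤ 2 ^ (m + 1 + 1) / A.bd ^ 8 * ρ := by
      rw [div_mul_eq_mul_div, le_div_iff₀ hb8, mul_comm]
      exact hXle.trans (mul_le_mul_of_nonneg_left hBad (by positivity))
    refine (measureReal_mono h2).trans ((measureReal_union_le _ _).trans ((add_le_add hBad h3).trans ?_))
    rw [hρ]
    have : (0 : ℝ) < 1 + 2 ^ (m + 1 + 1) / A.bd ^ 8 := by positivity
    rw [← one_add_mul, mul_div_assoc', mul_comm, mul_div_assoc, div_self this.ne', mul_one]
  have hall : ∀ᶠ s in atTop, ∀ w ∈ words k (2 * W' + 1), w ∉ B' →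
      NiceWord T e (m + 1) (L (m + 1) + 4 ^ e) W B N W' s w := by
    rw [Filter.eventually_all_finset]
    intro w hw
    by_cases h : w ∈ B'
    · exact Eventually.of_forall fun s h' => absurd h h'
    · filter_upwards [hgood w hw h] with s hs _ using hs
  have hbig : ∀ᶠ s : ℕ in atTop, (B'.length * 4 : ℝ) * 2 ^ (e + 4) ≤ 2 ^ s / 2 := by
    have ht : Tendsto (fun s : ℕ => (2 : ℝ) ^ s / 2) atTop atTop :=
      (tendsto_pow_atTop_atTop_of_one_lt one_lt_two).atTop_div_const two_pos
    exact ht.eventually_ge_atTop _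
  -- The precision comes last: it has to confirm the niceness of finitely many words, and to make
  -- the table errors, at most `4` per bad word, small compared with `2 ^ s`.
  obtain ⟨s, hs1, hs2⟩ := (hall.and hbig).exists
  refine ⟨(N, W', s, B'), hN1, ?_, hs1⟩
  have h5 : ∀ l : List (List (Fin (k + 1))), ((l.map fun w => T w s + 2).sum : ℕ) ≤
      2 ^ s * (l.map A.wordProb).sum + l.length * 4 := by
    intro l
    induction l with
    | nil => simp
    | cons w l ih =>
      have := hT.ge w s
      rw [List.map_cons, List.sum_cons, Nat.cast_add, Nat.cast_add, Nat.cast_ofNat, List.map_cons,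
        List.sum_cons, List.length_cons, Nat.cast_add, Nat.cast_one]
      linarith
  have h6 := h5 B'
  have h7 : (0 : ℝ) < 2 ^ s := by positivity
  have h8 : (0 : ℝ) < 2 ^ (e + 4) := by positivity
  have h9 : eps (e + 6) * 2 ^ (e + 4) ≤ 1 / 2 := by
    rw [eps, show e + 6 = (e + 4) + 2 by ring, pow_add]
    rw [div_mul_eq_mul_div, one_mul, div_le_iff₀ (by positivity)]
    linarith
  have h10 : (((B'.map fun w => T w s + 2).sum : ℕ) : ℝ) * 2 ^ (e + 4) ≤ 2 ^ s := by
    calc _ ≤ (2 ^ s * eps (e + 6) + B'.length * 4) * 2 ^ (e + 4) := by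
          refine mul_le_mul_of_nonneg_right (h6.trans ?_) h8.le
          have := mul_le_mul_of_nonneg_left hsum h7.le
          linarith
      _ = 2 ^ s * (eps (e + 6) * 2 ^ (e + 4)) + B'.length * 4 * 2 ^ (e + 4) := by ring
      _ ≤ 2 ^ s * (1 / 2) + 2 ^ s / 2 := add_le_add (mul_le_mul_of_nonneg_left h9 h7.le) hs2
      _ = 2 ^ s := by ring
  unfold SmallLayer
  exact_mod_cast h10

end MarkovSystem
end

noncomputable section

/-! ### Computable functions with integer values -/

namespace Computable

variable {α : Type*} [Primcodable α]

@[fun_prop] theorem toNat_fun {f : α → ℤ} (hf : Computable f) : Computable fun a => (f a).toNat := by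
  have e : ∀ z : ℤ, z.toNat = if Encodable.encode z % 2 = 0 then Encodable.encode z / 2 else 0 := by
    intro z
    cases z with
    | ofNat n =>
      have : Encodable.encode (Int.ofNat n) = 2 * n := rfl
      rw [this]; simp
    | negSucc n =>
      have : Encodable.encode (Int.negSucc n) = 2 * n + 1 := rfl
      rw [this, if_neg (by omega)]; rfl
  simp only [e]
  have h1 : Computable fun a => Encodable.encode (f a) := Primrec.encode.to_comp.comp hf
  have h2 : Computable fun a => Encodable.encode (f a) % 2 :=
    Primrec.nat_mod.to_comp.comp h1 (Computable.const 2)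
  exact .ite_fun (.eq h2 (.const 0)) (by fun_prop) (.const 0)

@[fun_prop] theorem natCast_fun {f : α → ℕ} (hf : Computable f) : Computable fun a => (f a : ℤ) := by
  have e : ∀ n : ℕ, (n : ℤ) = Denumerable.ofNat ℤ (2 * n) := by
    intro n
    have : 2 * n = Encodable.encode (n : ℤ) := rfl
    rw [this, Denumerable.ofNat_encode]
  simp only [e]
  exact (Primrec.ofNat ℤ).to_comp.comp (g := fun a => 2 * f a) (by fun_prop)

@[fun_prop] theorem neg_natCast_fun {f : α → ℕ} (hf : Computable f) :
    Computable fun a => -(f a : ℤ) := by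
  have e : ∀ n : ℕ, -(n : ℤ) = Denumerable.ofNat ℤ (2 * n - 1) := by
    intro n
    have : 2 * n - 1 = Encodable.encode (-n : ℤ) := by cases n <;> rfl
    rw [this, Denumerable.ofNat_encode]
  simp only [e]
  exact (Primrec.ofNat ℤ).to_comp.comp (g := fun a => 2 * f a - 1) (by fun_prop)

end Computable

/-! ### Tables from machines, and layers as Schnorr layerings -/

namespace MarkovSystem

variable {k : ℕ} {A : MarkovSystem k} {T : List (Fin (k + 1)) → ℕ → ℕ}

/-- A machine for the probabilities yields a computable table. -/
theorem IsMachine.exists_isTable {M : List (Fin (k + 1)) → ℕ → ℚ} (hM : A.IsMachine M) :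
    ∃ T : List (Fin (k + 1)) → ℕ → ℕ, (Computable fun q : List (Fin (k + 1)) × ℕ => T q.1 q.2) ∧
      A.IsTable T := by
  obtain ⟨⟨u, v, hu, hv, huv⟩, happ⟩ := hM
  refine ⟨fun w s => (u (w, s)).toNat * 2 ^ s / (v (w, s) + 1), ?_, fun w s => ?_⟩
  · simp only [Prod.mk.eta]
    fun_prop
  have h1 := happ w s
  have h2 := A.wordProb_pos w
  have h3 := A.wordProb_le_one w
  have h4 : (0 : ℝ) < 2 ^ s := by positivity
  have h5 : (M w s : ℝ) = (u (w, s) : ℝ) / ((v (w, s) : ℝ) + 1) := by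
    have h := huv (w, s)
    beta_reduce at h
    rw [h]; push_cast; rfl
  have h6 : (0 : ℝ) < (v (w, s) : ℝ) + 1 := by positivity
  have hε1 : eps s ≤ 1 := (eps_anti (Nat.zero_le s)).trans (by simp [eps])
  have hε : eps s * 2 ^ s = 1 := by rw [eps]; field_simp
  have hpos : 0 ≤ (M w s : ℝ) := by
    have := (abs_le.1 h1).1
    nlinarith
  have hu0 : 0 ≤ u (w, s) := by
    rw [h5] at hpos
    have := (div_nonneg_iff.1 hpos).resolve_right (fun h => absurd h.2 (not_le.2 h6))
    exact_mod_cast this.1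
  have hcast : ((u (w, s)).toNat : ℝ) = (u (w, s) : ℝ) := by
    rw [← Int.cast_natCast, Int.toNat_of_nonneg hu0]
  set a := (u (w, s)).toNat * 2 ^ s with ha
  have e1 : ((a / (v (w, s) + 1) : ℕ) : ℝ) ≤ M w s * 2 ^ s := by
    refine Nat.cast_div_le.trans (le_of_eq ?_)
    rw [h5, ha, ← hcast]; push_cast; ring
  have e2 : M w s * 2 ^ s ≤ ((a / (v (w, s) + 1) : ℕ) : ℝ) + 1 := by
    have h7 : a < (v (w, s) + 1) * (a / (v (w, s) + 1) + 1) := Nat.lt_mul_div_succ a (Nat.succ_pos _)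
    have h8 : (a : ℝ) ≤ ((v (w, s) : ℝ) + 1) * (((a / (v (w, s) + 1) : ℕ) : ℝ) + 1) := by
      exact_mod_cast h7.le
    rw [h5, div_mul_eq_mul_div, div_le_iff₀ h6, ← hcast]
    rw [ha] at h8
    push_cast at h8 ⊢
    linarith
  have e3 : |(M w s : ℝ) * 2 ^ s - 2 ^ s * A.wordProb w| ≤ 1 := by
    rw [mul_comm, ← mul_sub, abs_mul, abs_of_pos h4]
    calc 2 ^ s * |(M w s : ℝ) - A.wordProb w| ≤ 2 ^ s * (eps s * A.wordProb w) :=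
          mul_le_mul_of_nonneg_left h1 h4.le
      _ = (eps s * 2 ^ s) * A.wordProb w := by ring
      _ ≤ 1 := by rw [hε, one_mul]; exact h3
  rw [abs_le] at e3 ⊢
  constructor <;> linarith [e3.1, e3.2]

theorem wordFreq_eq_sum_words (n : ℕ) (p : List (Fin (k + 1)) → Prop) [DecidablePred p] :
    A.wordFreq n p = ∑ v ∈ (words k n).filter p, A.wordProb v := by
  rw [wordFreq, words, Finset.filter_image, Finset.sum_image fun v _ w _ h => List.ofFn_injective h]
  refine Finset.sum_congr ?_ fun _ _ => rfl
  ext v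
  simp

/-- The layering given by a computable sequence of exceptional words. -/
theorem isSchnorrLayering_wordAround (hT : A.IsTable T)
    (hTc : Computable fun q : List (Fin (k + 1)) × ℕ => T q.1 q.2) {c₀ : ℕ} {st : ℕ → LayerData k}
    (hst : Computable st) (hsmall : ∀ p, SmallLayer T (p + c₀) (st p)) :
    IsSchnorrLayering A.measure
      fun p => {x | wordAround x (st p).2.1 0 ∉ (st p).2.2.2} := by
  classical
  have hU : ∀ p, ({x : ℤ → Fin (k + 1) | wordAround x (st p).2.1 0 ∉ (st p).2.2.2}ᶜ : Set _) =
      {x | wordFrom x (0 - (st p).2.1) (2 * (st p).2.1 + 1) ∈ (st p).2.2.2} := by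
    intro p; ext x; simp [wordAround]
  have hmeas : ∀ p, A.measure.real {x | wordAround x (st p).2.1 0 ∉ (st p).2.2.2}ᶜ =
      A.wordFreq (2 * (st p).2.1 + 1) (fun w => w ∈ (st p).2.2.2) := by
    intro p
    rw [hU]
    exact A.measure_wordFrom (fun w => w ∈ (st p).2.2.2) _ _
  refine ⟨⟨fun q => q.2.1 = -((st q.1).2.1 : ℤ) ∧ q.2.2 ∈ (st q.1).2.2.2 ∧
    q.2.2.length = 2 * (st q.1).2.1 + 1, ?_, fun p => ?_⟩, ?_, fun p => ?_⟩
  · exact ComputablePred.to_re (.and (.eq (by fun_prop) (by fun_prop))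
      (.and (.mem_list (by fun_prop) (by fun_prop)) (.eq (by fun_prop) (by fun_prop))))
  · beta_reduce
    rw [hU]
    ext x
    rw [Set.mem_ofPred_eq, Set.mem_ofPred_eq]
    constructor
    · intro h
      refine ⟨-((st p).2.1 : ℤ), wordFrom x (0 - (st p).2.1) (2 * (st p).2.1 + 1),
        ⟨rfl, h, length_wordFrom _ _ _⟩, ?_⟩
      rw [← zero_sub, mem_cylinderAt_wordFrom]
      exact fun _ _ => rfl
    · rintro ⟨i, w, ⟨hi, hw, hl⟩, hx⟩
      dsimp only at hi hw hl
      rw [cylinderAt_eq_wordFrom, Set.mem_ofPred_eq, hl, hi] at hx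
      rw [zero_sub, hx]
      exact hw
  · let s : ℕ × ℕ → ℕ := fun q => q.2 + 1 + (k + 1) ^ (2 * (st q.1).2.1 + 1)
    have hs : Computable s := by simp only [s]; fun_prop
    let a : ℕ × ℕ → ℕ := fun q =>
      ∑ v ∈ (words k (2 * (st q.1).2.1 + 1)).filter (fun v => v ∈ (st q.1).2.2.2), T v (s q)
    have ha : Computable a := by
      refine (Computable.sum_words (p := fun q v => v ∈ (st q.1).2.2.2) (g := fun q v => T v (s q))
        (f := fun q : ℕ × ℕ => 2 * (st q.1).2.1 + 1) (by fun_prop)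
        (.mem_list (by fun_prop) (by fun_prop))
        (computable_table hTc (by fun_prop) (by fun_prop))).of_eq fun q => ?_
      simp only [a]
      congr!
    refine ⟨fun q => (a q : ℚ) / 2 ^ s q, ⟨fun q => (a q : ℤ), fun q => 2 ^ s q - 1, by fun_prop,
      by fun_prop, fun q => ?_⟩, fun p n => ?_⟩
    · rw [Nat.cast_sub Nat.one_le_two_pow]
      push_cast
      ring
    · beta_reduce
      rw [hmeas, wordFreq_eq_sum_words]
      set W := (st p).2.1 with hW
      set R := (words k (2 * W + 1)).filter (fun v => v ∈ (st p).2.2.2) with hR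
      have hcard : (R.card : ℝ) ≤ 2 ^ (k + 1) ^ (2 * W + 1) := by
        have h1 : R.card ≤ (k + 1) ^ (2 * W + 1) := by
          refine (Finset.card_filter_le _ _).trans (Finset.card_image_le.trans (le_of_eq ?_))
          simp
        exact_mod_cast h1.trans Nat.lt_two_pow_self.le
      have e : (((a (p, n) : ℚ) / 2 ^ s (p, n) : ℚ) : ℝ) - ∑ v ∈ R, A.wordProb v =
          (∑ v ∈ R, ((T v (s (p, n)) : ℝ) - 2 ^ s (p, n) * A.wordProb v)) / 2 ^ s (p, n) := by
        have : (2 : ℝ) ^ s (p, n) ≠ 0 := by positivity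
        rw [Finset.sum_sub_distrib, ← Finset.mul_sum]
        simp only [a]
        push_cast
        field_simp
        rfl
      rw [e, abs_div, abs_of_pos (by positivity : (0 : ℝ) < 2 ^ s (p, n)), div_le_iff₀ (by positivity)]
      calc _ ≤ ∑ v ∈ R, |(T v (s (p, n)) : ℝ) - 2 ^ s (p, n) * A.wordProb v| :=
            Finset.abs_sum_le_sum_abs _ _
        _ ≤ ∑ v ∈ R, 2 := Finset.sum_le_sum fun v _ => hT v _
        _ = R.card * 2 := by simp
        _ ≤ 2 ^ (k + 1) ^ (2 * W + 1) * 2 := by gcongr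
        _ = eps n * 2 ^ s (p, n) := by
          simp only [s, eps, pow_add, ← hW]
          field_simp
  · beta_reduce
    have h1 := wordFreq_bad_le hT (hsmall p) (2 * (st p).2.1 + 1)
    rw [← hmeas] at h1
    have h2 : eps (p + c₀ + 4) < eps p := by
      rw [eps, eps]
      exact one_div_lt_one_div_of_lt (by positivity) (pow_lt_pow_right₀ one_lt_two (by omega))
    rw [← ENNReal.ofReal_toReal (measure_ne_top A.measure _)]
    exact (ENNReal.ofReal_lt_ofReal_iff (eps_pos p)).2 (h1.trans_lt h2)

end MarkovSystem
end

noncomputable section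

/-! ### The approximate conditional probabilities -/

namespace MarkovSystem

variable {k : ℕ} {A : MarkovSystem k} {M : List (Fin (k + 1)) → ℕ → ℚ}

theorem IsMachine.condApprox_bounds (hM : A.IsMachine M) (n : ℕ) (a b : Fin (k + 1)) :
    (1 - eps (n + 2)) / (1 + eps (n + 2)) * A.trans a b ≤ condApprox M n a b ∧
      condApprox M n a b ≤ (1 + eps (n + 2)) / (1 - eps (n + 2)) * A.trans a b := by
  have e0 := eps_pos (n + 2)
  have e1 : eps (n + 2) ≤ 1 / 4 := (eps_anti (by omega : 2 ≤ n + 2)).trans (by norm_num [eps])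
  have h1 := abs_le.1 (hM.2 [a, b] (n + 2))
  have h2 := abs_le.1 (hM.2 [a] (n + 2))
  have p1 : A.wordProb [a, b] = A.init a * A.trans a b := wordProb_pair a b
  have p2 : A.wordProb [a] = A.init a := by simp [wordProb, transProd]
  rw [p1] at h1
  rw [p2] at h2
  have hi := A.init_pos a
  have ht := A.trans_pos a b
  have hit := mul_pos hi ht
  have hden : 0 < (M [a] (n + 2) : ℝ) := by nlinarith [h2.1]
  unfold condApprox
  constructor
  · rw [le_div_iff₀ hden, div_mul_eq_mul_div, div_mul_eq_mul_div, div_le_iff₀ (by linarith)]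
    calc (1 - eps (n + 2)) * A.trans a b * (M [a] (n + 2) : ℝ)
        ≤ (1 - eps (n + 2)) * A.trans a b * ((1 + eps (n + 2)) * A.init a) :=
          mul_le_mul_of_nonneg_left (by linarith [h2.2]) (mul_nonneg (by linarith) ht.le)
      _ = (1 - eps (n + 2)) * (A.init a * A.trans a b) * (1 + eps (n + 2)) := by ring
      _ ≤ _ := mul_le_mul_of_nonneg_right (by linarith [h1.1]) (by linarith)
  · rw [div_le_iff₀ hden, div_mul_eq_mul_div, div_mul_eq_mul_div, le_div_iff₀ (by linarith)]
    calc (M [a, b] (n + 2) : ℝ) * (1 - eps (n + 2))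
        ≤ (1 + eps (n + 2)) * (A.init a * A.trans a b) * (1 - eps (n + 2)) :=
          mul_le_mul_of_nonneg_right (by linarith [h1.2]) (by linarith)
      _ = (1 + eps (n + 2)) * A.trans a b * ((1 - eps (n + 2)) * A.init a) := by ring
      _ ≤ _ := mul_le_mul_of_nonneg_left (by linarith [h2.1]) (mul_nonneg (by linarith) ht.le)

theorem IsMachine.le_condApprox (hM : A.IsMachine M) (n : ℕ) (a b : Fin (k + 1)) :
    A.bd / 2 ≤ condApprox M n a b := by
  have e0 := eps_pos (n + 2)
  have e1 : eps (n + 2) ≤ 1 / 4 := (eps_anti (by omega : 2 ≤ n + 2)).trans (by norm_num [eps])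
  refine le_trans ?_ (hM.condApprox_bounds n a b).1
  have h : 1 / 2 ≤ (1 - eps (n + 2)) / (1 + eps (n + 2)) := by
    rw [le_div_iff₀ (by linarith)]; linarith
  have := mul_le_mul h (A.bd_le_trans a b) A.bd_pos.le (by linarith)
  linarith

/-- Two transition probabilities from the same symbol have sum at most `1`, so the smaller one is at
most `1 / 2`. Since the approximation at most doubles it, the bound holds at every level. -/
theorem IsMachine.iInf_condApprox_le_one (hM : A.IsMachine M) (n : ℕ) :
    ⨅ p : Fin (k + 1) × Fin (k + 1), condApprox M n p.1 p.2 ≤ 1 := by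
  have e0 := eps_pos (n + 2)
  have e1 : eps (n + 2) ≤ 1 / 4 := (eps_anti (by omega : 2 ≤ n + 2)).trans (by norm_num [eps])
  obtain ⟨b, hb⟩ := A.exists_ne 0
  have hsum : A.trans 0 0 + A.trans 0 b ≤ 1 := by
    rw [← A.trans_sum 0, ← Finset.sum_pair (Ne.symm hb)]
    exact Finset.sum_le_sum_of_subset_of_nonneg (Finset.subset_univ _) fun i _ _ => (A.trans_pos 0 i).le
  have hbdd : BddBelow (Set.range fun p : Fin (k + 1) × Fin (k + 1) => condApprox M n p.1 p.2) :=
    (Set.finite_range _).bddBelow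
  have h1 := (ciInf_le hbdd (0, 0)).trans (hM.condApprox_bounds n 0 0).2
  have h2 := (ciInf_le hbdd (0, b)).trans (hM.condApprox_bounds n 0 b).2
  have h : (1 + eps (n + 2)) / (1 - eps (n + 2)) ≤ 2 := by
    rw [div_le_iff₀ (by linarith)]; linarith
  have h3 := mul_le_mul h hsum (by linarith [A.trans_pos 0 0, A.trans_pos 0 b]) zero_le_two
  linarith

theorem IsMachine.eventually_iSup_condApprox_lt_one (hM : A.IsMachine M) :
    ∀ᶠ n in atTop, ⨆ p : Fin (k + 1) × Fin (k + 1), condApprox M n p.1 p.2 < 1 := by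
  have h : ∀ᶠ n in atTop, ∀ p : Fin (k + 1) × Fin (k + 1), condApprox M n p.1 p.2 < 1 := by
    rw [Filter.eventually_all]
    intro p
    have t1 : Tendsto (fun n : ℕ => eps (n + 2)) atTop (𝓝 0) :=
      tendsto_eps.comp (tendsto_add_atTop_nat 2)
    have t2 : Tendsto (fun n : ℕ => (1 + eps (n + 2)) / (1 - eps (n + 2)) * A.trans p.1 p.2) atTop
        (𝓝 ((1 + 0) / (1 - 0) * A.trans p.1 p.2)) :=
      ((t1.const_add 1).div (t1.const_sub 1) (by norm_num)).mul_const _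
    have h1 : (1 + 0) / (1 - 0) * A.trans p.1 p.2 < 1 := by simpa using A.trans_lt_one p.1 p.2
    filter_upwards [t2.eventually_lt_const h1] with n hn
    exact (hM.condApprox_bounds n p.1 p.2).2.trans_lt hn
  filter_upwards [h] with n hn
  obtain ⟨p, hp⟩ := exists_eq_ciSup_of_finite
    (f := fun p : Fin (k + 1) × Fin (k + 1) => condApprox M n p.1 p.2)
  rw [← hp]
  exact hn p

end MarkovSystem

section

variable {a c : ℕ} {A : MarkovSystem a} {C : MarkovSystem c} {MA : List (Fin (a + 1)) → ℕ → ℚ}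
  {MC : List (Fin (c + 1)) → ℕ → ℚ}

theorem le_etaMin (hA : A.IsMachine MA) (hC : C.IsMachine MC) (n : ℕ) :
    min A.bd C.bd / 2 ≤ etaMin MA MC n := by
  have h1 := min_le_left A.bd C.bd
  have h2 := min_le_right A.bd C.bd
  refine le_min (le_ciInf fun p => ?_) (le_ciInf fun p => ?_)
  · exact le_trans (by linarith) (hA.le_condApprox n p.1 p.2)
  · exact le_trans (by linarith) (hC.le_condApprox n p.1 p.2)

theorem etaMin_le_one (hA : A.IsMachine MA) (n : ℕ) : etaMin MA MC n ≤ 1 :=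
  (min_le_left _ _).trans (hA.iInf_condApprox_le_one n)

theorem etaMin_le_thetaMax (n : ℕ) : etaMin MA MC n ≤ thetaMax MA MC n := by
  refine (min_le_left _ _).trans (le_trans ?_ (le_max_left _ _))
  exact (ciInf_le (Set.finite_range _).bddBelow (0, 0)).trans
    (le_ciSup (f := fun p : Fin (a + 1) × Fin (a + 1) => condApprox MA n p.1 p.2)
      (Set.finite_range _).bddAbove (0, 0))

theorem eventually_thetaMax_lt_one (hA : A.IsMachine MA) (hC : C.IsMachine MC) :
    ∀ᶠ n in atTop, thetaMax MA MC n < 1 := by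
  filter_upwards [hA.eventually_iSup_condApprox_lt_one, hC.eventually_iSup_condApprox_lt_one]
    with n h1 h2
  exact max_lt h1 h2

end

/-! ### Skeletons in the layers -/

section

variable {k : ℕ} {A : MarkovSystem k} {T : List (Fin (k + 1)) → ℕ → ℕ}

/-- A position in a core does not lie in a delimiting block, so the ambiguity between two
neighbouring skeletons does not arise. -/
theorem IsPart.isSkeletonAt_iff {m : ℕ} (hm : 2 ≤ m) {x : ℤ → Fin (k + 1)} {t lo c d hi : ℤ}
    (h : IsPart m (fun i => x i = 0) lo c d hi) (hc : c ≤ t) (hd : t ≤ d) {S : Skeleton} :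
    IsSkeletonAt m x t S ↔ S = ⟨lo, hi, blockZeros x lo hi⟩ := by
  rw [_root_.isSkeletonAt_iff hm]
  constructor
  · rintro ⟨h1, h2, hz, c', d', h'⟩
    obtain ⟨rfl, -, -, rfl⟩ := h.unique h' hc hd h1 h2
    exact Skeleton.ext rfl rfl hz
  · rintro rfl
    have a1 := h.lo_le
    have a2 := h.le_hi
    exact ⟨by simp only; omega, by simp only; omega, rfl, c, d, h⟩

/-- The exceptional fillers are those giving an atypical word; `Concentrated.le` bounds their share.
-/
theorem NiceAt.exists_exceptional (hT : A.IsTable T) {e j len W : ℕ} {B : List (List (Fin (k + 1)))}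
    {N s : ℕ} (hN : 2 ≤ N) {x : ℤ → Fin (k + 1)} {t lo c d hi : ℤ}
    (h : NiceAt T e j len W B N s x t lo c d hi) {S : Skeleton} (hS : S = ⟨lo, hi, blockZeros x lo hi⟩) :
    ∃ E ⊆ fillers k S, fillerMeasure A S E ≤ eps j * fillerMeasure A S (fillers k S) ∧
      ∀ F ∈ fillers k S, F ∉ E → IsTypical A (6 * eps e) (fill S F) S.lo S.hi := by
  classical
  subst hS
  have hz := h.part.zeroEnds hN
  refine ⟨_, Finset.filter_subset (fun F => ¬ TypicalWord T e
    (wordOn ⟨lo, hi, blockZeros x lo hi⟩ (fill ⟨lo, hi, blockZeros x lo hi⟩ F))) _, ?_, ?_⟩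
  · rw [fillerMeasure_fillers A hz]
    convert h.conc.le hT using 1
    convert fillerMeasure_filter A hz fun v => ¬ TypicalWord T e v
  · intro F hF hFE
    have : TypicalWord T e (wordOn ⟨lo, hi, blockZeros x lo hi⟩ (fill ⟨lo, hi, blockZeros x lo hi⟩ F)) := by
      by_contra hc
      exact hFE (Finset.mem_filter.2 ⟨hF, hc⟩)
    exact TypicalWord.isTypical hT (by have := hz.lt; simp only; omega) this

theorem IsTypical.mono {δ δ' : ℝ} {y : ℤ → Fin (k + 1)} {lo hi : ℤ} (h : IsTypical A δ y lo hi)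
    (hle : lo ≤ hi) (hδ : δ ≤ δ') : IsTypical A δ' y lo hi := fun a b => by
  have : (lo : ℝ) ≤ hi := by exact_mod_cast hle
  exact (h a b).trans (mul_le_mul_of_nonneg_right hδ (by linarith))

end

/-! ### The Filler Lemma -/

theorem mainTheorem4 {a c : ℕ} (A : MarkovSystem a) (C : MarkovSystem c)
    (MA : List (Fin (a + 1)) → ℕ → ℚ) (MC : List (Fin (c + 1)) → ℕ → ℚ)
    (hMA : A.IsMachine MA) (hMC : C.IsMachine MC)
    (hzero : A.wordProb [0] = C.wordProb [0])
    (hzero2 : A.wordProb [0, 0] = C.wordProb [0, 0])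
    (hent : A.entropy = C.entropy)
    (L : ℕ → ℕ) (hLcomp : Computable L) (hLmono : StrictMono L)
    (hLlim : Tendsto (fun r : ℕ => 1 / etaMin MA MC (r + 1) *
      (2 : ℝ) ^ (-(L (r + 1) : ℝ) * (eps r - eps (r + 1)))) atTop (𝓝 0)) :
    ∃ N : ℕ → ℕ, Computable N ∧ StrictMono N ∧ (∀ r, 0 < N r) ∧
      (∃ K' : ℕ → Set (ℤ → Fin (a + 1)), IsSchnorrLayering A.measure K' ∧
        ∀ r, 1 ≤ r → ∀ x ∈ K' r, (∃ S, IsSkeletonAt (N r) x 0 S) ∧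
          ∀ S, IsSkeletonAt (N r) x 0 S → L r ≤ S.length) ∧
      ∃ K'' : ℕ → Set (ℤ → Fin (a + 1)), IsSchnorrLayering A.measure K'' ∧
        ∀ n : ℕ, ∃ r : ℕ, n ≤ r ∧ 1 ≤ r ∧ ∀ x ∈ K'' r, ∀ S, IsSkeletonAt (N r) x 0 S →
          (∀ F ∈ fillers a S,
            (1 + eps r) * (2 : ℝ) ^ (-(S.size : ℝ) * (A.entropy - eps r)) ≤
              classProb N MA A.entropy (etaMin MA MC) r S F r) ∧
          ∃ E ⊆ fillers a S,
            fillerMeasure A S E ≤ eps n * fillerMeasure A S (fillers a S) ∧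
            ∀ F ∈ fillers a S, F ∉ E →
              classProb N MA A.entropy (etaMin MA MC) r S F r <
                (1 + eps n) / etaMin MA MC n *
                  (2 : ℝ) ^ (-(S.size : ℝ) * (A.entropy - eps n)) ∧
              1 - 2 / |Real.logb 2 (thetaMax MA MC r)| * eps n <
                ((determined N MA A.entropy (etaMin MA MC) r S (fill S F) r).card : ℝ) /
                  (S.size : ℝ) := by
  obtain ⟨T, hTc, hT⟩ := hMA.exists_isTable
  obtain ⟨c₀, hR, hc₀⟩ := A.eventually_rateBounds.exists
  obtain ⟨st, hstc, h0, hst⟩ := exists_computable_layers (c₀ := c₀) hTc hLcomp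
    fun m s hs => MarkovSystem.exists_nextLayer hT c₀ L m s hs
  have hsmall : ∀ p, SmallLayer T (p + c₀) (st p) := by
    intro p
    cases p with
    | zero => rw [h0]; simp [SmallLayer]
    | succ p => exact (hst p).2.1
  have hmono : StrictMono fun m => (st m).1 := strictMono_nat_of_lt_succ fun m => (hst m).1
  have hlayer := MarkovSystem.isSchnorrLayering_wordAround hT hTc hstc hsmall
  set η₀ : ℝ := min A.bd C.bd / 2 with hη₀
  have hη0 : 0 < η₀ := half_pos (lt_min A.bd_pos C.bd_pos)
  have hη1 : η₀ < 1 := by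
    have := (min_le_left A.bd C.bd).trans_lt A.bd_lt_one
    linarith
  have hη := le_etaMin hMA hMC
  have hη' : ∀ m, etaMin MA MC m ≤ 1 := etaMin_le_one hMA
  have hθ : ∀ᶠ r in atTop, η₀ ≤ thetaMax MA MC r ∧ thetaMax MA MC r < 1 := by
    filter_upwards [eventually_thetaMax_lt_one hMA hMC] with r hr
    exact ⟨(hη r).trans (etaMin_le_thetaMax r), hr⟩
  -- The offset between `n` and the rank `r = n + c₁`: large enough for `eventually_typical`, for
  -- `rate r = eps r`, and for the rank to be at least `2`.
  obtain ⟨c₁, htyp, hc₁, hc₂⟩ := ((A.eventually_typical (N := fun m => (st m).1) hMA hη0 hη1 hη hη'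
    hθ).and ((tendsto_eps.eventually_le_const (half_pos A.zeroRate_pos)).and
      (eventually_ge_atTop 2))).exists
  refine ⟨fun m => (st m).1, by fun_prop, hmono, fun r => ?_, ⟨_, hlayer, fun r hr x hx => ?_⟩,
    ⟨_, hlayer, fun n => ⟨n + c₁, by omega, by omega, fun x hx S hS => ?_⟩⟩⟩
  · have := hmono.monotone (Nat.zero_le r)
    simp only [h0] at this
    exact this
  · obtain ⟨m, rfl⟩ := Nat.exists_eq_add_of_le' hr
    obtain ⟨lo, c, d, hi, h⟩ := exists_niceAt hst hx
    have h2 := (two_le_threshold h0 hst m).1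
    refine ⟨⟨_, (h.part.isSkeletonAt_iff h2 h.c_le h.le_d).2 rfl⟩, fun S hS => ?_⟩
    rw [(h.part.isSkeletonAt_iff h2 h.c_le h.le_d).1 hS]
    exact (Nat.le_add_right _ _).trans (h.long.trans (card_nonzero_le_length x lo hi))
  · obtain ⟨m, hm⟩ : ∃ m, n + c₁ = m + 1 + 1 := ⟨n + c₁ - 2, by omega⟩
    have htyp := htyp n
    rw [hm] at hx hS htyp ⊢
    obtain ⟨lo, c, d, hi, h⟩ := exists_niceAt hst hx
    have h2 := (two_le_threshold h0 hst (m + 1)).1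
    have hS' := (h.part.isSkeletonAt_iff h2 h.c_le h.le_d).1 hS
    have hgood := h.good hT h0 hst
    have hlt := (h.part.zeroEnds h2).lt
    have hsize : 4 ^ (m + 1 + 1 + c₀) ≤ S.size := by
      rw [hS']
      exact (Nat.le_add_left _ _).trans (h.long.trans ((card_nonzero_le_length x lo hi).trans
        (Nat.le_add_right _ _)))
    obtain ⟨E, hE, hmeas, hEt⟩ := h.exists_exceptional hT h2 hS'
    rw [← hS'] at hgood
    have hle : S.lo ≤ S.hi := by rw [hS']; exact hlt.le
    have hsub : S.zeros ⊆ S.window := by rw [hS']; exact blockZeros_subset x lo hi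
    have hy : ∀ F : S.blanks → Fin (a + 1), ∀ i ∈ S.zeros, fill S F i = 0 := fun F i hi =>
      fill_of_notMem F fun hb => (Finset.mem_sdiff.1 hb).2 hi
    refine ⟨fun F _ => ?_, E, hE, hmeas.trans ?_, fun F hF hFE => ?_⟩
    · refine le_cylApprox_determined hMA (fun m => hη0.trans_le (hη m)) hη' hR hsub hgood (hy F) le_rfl
        ?_ ?_
      · have h3 : eps (m + 2) ≤ A.zeroRate / 2 := (eps_anti (by omega)).trans hc₁
        exact min_eq_left (by nlinarith [eps_pos (m + 2), A.zeroRate_pos])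
      -- The size is at least `4 ^ (r + c₀)` and the gap of the rates at least a constant times `eps
      -- r`, so their product is at least `4` by the choice of `c₀`.
      · have h3 := A.rate_gap (m + 1)
        have h4 : ((4 ^ (m + 1 + 1 + c₀) : ℕ) : ℝ) ≤ S.size := by exact_mod_cast hsize
        have h5 : 0 < min 1 A.zeroRate := lt_min one_pos A.zeroRate_pos
        have h6 : (1 : ℝ) ≤ 4 ^ (m + 1 + 1) * eps (m + 1 + 1) := by
          rw [eps, mul_one_div, ← div_pow]
          exact one_le_pow₀ (by norm_num)
        calc (4 : ℝ) ≤ 4 ^ c₀ * min 1 A.zeroRate := hc₀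
          _ ≤ (4 ^ (m + 1 + 1) * eps (m + 1 + 1)) * (4 ^ c₀ * min 1 A.zeroRate) :=
            le_mul_of_one_le_left (by positivity) h6
          _ = ((4 ^ (m + 1 + 1 + c₀) : ℕ) : ℝ) * (min 1 A.zeroRate * eps (m + 1 + 1)) := by
            push_cast; ring
          _ ≤ S.size * (A.rate (m + 1) - A.rate (m + 2)) :=
            mul_le_mul h4 h3 (mul_nonneg h5.le (eps_pos _).le) (Nat.cast_nonneg _)
    · refine mul_le_mul_of_nonneg_right (eps_anti (by omega)) ?_
      exact Finset.sum_nonneg fun F _ => (A.wordProb_pos _).le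
    · refine htyp S hsub hle ((Nat.pow_le_pow_right (by norm_num) (by omega)).trans hsize) _ ?_
      exact (hEt F hF hFE).mono hle (mul_le_mul_of_nonneg_left (eps_anti (by omega)) (by norm_num))
end
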